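/- Let $\mathbb G$ be a compact quantum group of Kac type, i.e. its Haar state $h$ on the Hopf $*$-algebra $\mathrm{Pol}(\mathbb G)$ (with coproduct $\Delta$ and antipode $S$) is a trace. For every $\alpha\in\mathrm{Irr}(\mathbb G)$ fix a representative $U^\alpha=[u^\alpha_{ij}]\in M_{n_\alpha}(\mathrm{Pol}(\mathbb G))$, an irreducible unitary representation. Let $\ell^\infty(\widehat{\mathbb G})=\ell^\infty\text{-}\bigoplus_{\alpha}M_{n_\alpha}$, and let the Fourier algebra $A(\mathbb G)=\ell^1(\widehat{\mathbb G})$ be its predual $\ell^1\text{-}\bigoplus_\alpha S^1_{n_\alpha}$ with the predual operator space structure. Embed $\mathrm{Pol}(\mathbb G)\hookrightarrow A(\mathbb G)$ by $x\mapsto\mathcal F(x)\cdot\widehat h$, where $\mathcal F(x)=\big([h((u^\alpha_{ji})^*x)]_{i,j}\big)_\alpha$ is the Fourier transform, $\widehat h((X_\alpha)_\alpha)=\sum_\alpha n_\alpha\mathrm{Tr}(X_\alpha)$ is the Haar weight and $(X\cdot\widehat h)(Y)=\widehat h(YX)$; thus $\langle u^\alpha_{ij},(X_\gamma)_\gamma\rangle=(X_\alpha)_{ij}$.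 Put $a\star b=h(S(b_{(1)})a)\,b_{(2)}$ for $a,b\in\mathrm{Pol}(\mathbb G)$. Let $\Phi:A(\mathbb G)\,\widehat\otimes\,A(\mathbb G)\to A(\mathbb G)$ be the continuous extension to the operator space projective tensor product of the twisted convolution $a\otimes b\mapsto a\star S(b)$ on $\mathrm{Pol}(\mathbb G)\odot\mathrm{Pol}(\mathbb G)$, and let $A_\Delta(\mathbb G):=\mathrm{ran}\,\Phi\subseteq A(\mathbb G)$, with the operator space structure that makes $\Phi$ a complete quotient map onto $A_\Delta(\mathbb G)$. Let $\widehat\Delta$ be the coproduct of $\ell^\infty(\widehat{\mathbb G})$: for $X\in\ell^\infty(\widehat{\mathbb G})$ and $\beta,\gamma\in\mathrm{Irr}(\mathbb G)$, the component of $\widehat\Delta(X)$ in $M_{n_\beta}\otimes M_{n_\gamma}$ is $$\widehat\Delta(X)(\beta,\gamma)=\sum_{k,l,p,q}\langle u^\beta_{kl}u^\gamma_{pq},X\rangle\,e^\beta_{kl}\otimes e^\gamma_{pq},$$ and let $\widehat\Delta_*$ be given by $\langle\widehat\Delta_*(\omega\otimes\varphi),X\rangle=(\omega\otimes\varphi)(\widehat\Delta(X))=\sum_{\beta,\gamma}(\omega_\beta\otimes\varphi_\gamma)\big(\widehat\Delta(X)(\beta,\gamma)\big)$,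 where $\omega_\beta$, $\varphi_\gamma$ are the restrictions of $\omega,\varphi$ to the blocks $M_{n_\beta}$, $M_{n_\gamma}$ (on $\mathrm{Pol}(\mathbb G)$ this is the usual multiplication). Then $\mathrm{Pol}(\mathbb G)\subseteq A_\Delta(\mathbb G)$, and $(A_\Delta(\mathbb G),\widehat\Delta_*)$ is a completely contractive Banach algebra: $A_\Delta(\mathbb G)$ is a (complete) operator space, $\widehat\Delta_*(\omega\otimes\varphi)\in A_\Delta(\mathbb G)$ for all $\omega,\varphi\in A_\Delta(\mathbb G)$, the resulting multiplication is associative and submultiplicative for the norm, and it extends to a complete contraction $A_\Delta(\mathbb G)\,\widehat\otimes\,A_\Delta(\mathbb G)\to A_\Delta(\mathbb G)$. -/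

import Mathlib

set_option linter.unusedSectionVars false

universe u v

open scoped TensorProduct ENNReal Matrix Kronecker Matrix.Norms.L2Operator

/-! ### Operator spaces -/

/-- A family of functions `‖·‖ₙ` on the matrix spaces `Mₙ(E)`, `n ∈ ℕ`. -/
class MatrixNormed (E : Type*) [AddCommGroup E] [Module ℂ E] where
  mnorm : ∀ n : ℕ, Matrix (Fin n) (Fin n) E → ℝ

open MatrixNormed (mnorm)

/-- The norm of `E = M₁(E)`. -/
def MatrixNormed.norm₁ {E : Type*} [AddCommGroup E] [Module ℂ E] [MatrixNormed E] (x : E) : ℝ :=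
  mnorm 1 (Matrix.of fun _ _ => x)

open MatrixNormed (norm₁)

/-- The product `a x b` of a matrix `x` over `E` with rectangular scalar matrices `a`, `b`. -/
def smulMatrix {ι κ E : Type*} [Fintype ι] [AddCommGroup E] [Module ℂ E]
    (a : Matrix κ ι ℂ) (x : Matrix ι ι E) (b : Matrix ι κ ℂ) : Matrix κ κ E :=
  Matrix.of fun i j => ∑ k, ∑ l, (a i k * b l j) • x k l

/-- The block diagonal matrix `x ⊕ y ∈ M_{m+n}(E)`. -/
def directSumMatrix {E : Type*} [AddCommGroup E] {m n : ℕ}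
    (x : Matrix (Fin m) (Fin m) E) (y : Matrix (Fin n) (Fin n) E) :
    Matrix (Fin (m + n)) (Fin (m + n)) E :=
  Matrix.reindex finSumFinEquiv finSumFinEquiv (Matrix.fromBlocks x 0 0 y)

/-- `E` with its matrix norms is a (complete) operator space, by Ruan's axioms. Norms of scalar
matrices are operator norms between Euclidean spaces. -/
structure IsOperatorSpace (E : Type*) [AddCommGroup E] [Module ℂ E] [MatrixNormed E] : Prop where
  eq_zero_iff : ∀ (n : ℕ) (x : Matrix (Fin n) (Fin n) E), mnorm n x = 0 ↔ x = 0
  add_le : ∀ (n : ℕ) (x y : Matrix (Fin n) (Fin n) E), mnorm n (x + y) ≤ mnorm n x + mnorm n y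
  smul_eq : ∀ (n : ℕ) (c : ℂ) (x : Matrix (Fin n) (Fin n) E), mnorm n (c • x) = ‖c‖ * mnorm n x
  directSum_eq : ∀ (m n : ℕ) (x : Matrix (Fin m) (Fin m) E) (y : Matrix (Fin n) (Fin n) E),
    mnorm (m + n) (directSumMatrix x y) = max (mnorm m x) (mnorm n y)
  smulMatrix_le : ∀ (m n : ℕ) (a : Matrix (Fin m) (Fin n) ℂ) (x : Matrix (Fin n) (Fin n) E)
    (b : Matrix (Fin n) (Fin m) ℂ), mnorm m (smulMatrix a x b) ≤ ‖a‖ * mnorm n x * ‖b‖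
  complete : ∀ x : ℕ → E, (∀ ε > 0, ∃ N, ∀ j ≥ N, ∀ k ≥ N, norm₁ (x j - x k) < ε) →
    ∃ y : E, Filter.Tendsto (fun k => norm₁ (x k - y)) Filter.atTop (nhds 0)

/-- The operator space projective norms on the algebraic tensor product `V ⊙ W`:
`‖u‖ₙ = inf {‖a‖ ‖v‖ ‖w‖ ‖b‖ : u = a (v ⊗ w) b}`, where `v ∈ M_p(V)`, `w ∈ M_q(W)` and
`a ∈ M_{n,pq}`, `b ∈ M_{pq,n}` are scalar matrices. -/
noncomputable instance projectiveMatrixNormed (V W : Type*)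
    [AddCommGroup V] [Module ℂ V] [MatrixNormed V]
    [AddCommGroup W] [Module ℂ W] [MatrixNormed W] : MatrixNormed (V ⊗[ℂ] W) where
  mnorm n u := sInf {r : ℝ | ∃ (p q : ℕ) (v : Matrix (Fin p) (Fin p) V)
    (w : Matrix (Fin q) (Fin q) W) (a : Matrix (Fin n) (Fin p × Fin q) ℂ)
    (b : Matrix (Fin p × Fin q) (Fin n) ℂ),
    u = smulMatrix a (v ⊗ₖₜ[ℂ] w) b ∧ r = ‖a‖ * mnorm p v * mnorm q w * ‖b‖}

/-- `T : E → F` is a complete contraction: all its amplifications `Mₙ(E) → Mₙ(F)` are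
contractive. -/
def IsCompleteContraction {E F : Type*} [AddCommGroup E] [Module ℂ E] [MatrixNormed E]
    [AddCommGroup F] [Module ℂ F] [MatrixNormed F] (T : E →ₗ[ℂ] F) : Prop :=
  ∀ (n : ℕ) (x : Matrix (Fin n) (Fin n) E), mnorm n (x.map T) ≤ mnorm n x

/-- `E` with the bilinear multiplication `mul` is a completely contractive Banach algebra: it is a
(complete) operator space, `mul` is associative and submultiplicative, and its linearization
extends to a complete contraction on the completed operator space projective tensor product of `E`
with itself. As `E` is complete, the latter says that the linearization is a complete contraction
for the projective norms on the algebraic tensor product, which is dense in the completion. -/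
structure IsCompletelyContractiveBanachAlgebra {E : Type*} [AddCommGroup E] [Module ℂ E]
    [MatrixNormed E] (mul : E →ₗ[ℂ] E →ₗ[ℂ] E) : Prop where
  isOperatorSpace : IsOperatorSpace E
  mul_assoc : ∀ x y z : E, mul (mul x y) z = mul x (mul y z)
  norm_mul_le : ∀ x y : E, norm₁ (mul x y) ≤ norm₁ x * norm₁ y
  completelyContractive : IsCompleteContraction (TensorProduct.lift mul)

/-! ### Compact quantum groups -/

section Representations

variable {A : Type*} [Ring A] [StarRing A] [HopfAlgebra ℂ A]

/-- `u ∈ Mₙ(A)` is a finite-dimensional unitary representation. -/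
structure IsUnitaryRep {n : ℕ} (u : Matrix (Fin n) (Fin n) A) : Prop where
  star_mul : uᴴ * u = 1
  mul_star : u * uᴴ = 1
  comul : ∀ i j, Coalgebra.comul (R := ℂ) (u i j) = ∑ k, u i k ⊗ₜ[ℂ] u k j

/-- The scalar matrix `T` intertwines `v` and `u`: `u (T ⊗ 1) = (T ⊗ 1) v`. -/
def Intertwines {n m : ℕ} (u : Matrix (Fin n) (Fin n) A) (v : Matrix (Fin m) (Fin m) A)
    (T : Matrix (Fin n) (Fin m) ℂ) : Prop :=
  u * T.map (algebraMap ℂ A) = T.map (algebraMap ℂ A) * v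

/-- The only self-intertwiners of `u` are the scalars, and `u` is not zero-dimensional. -/
def IsIrreducibleRep {n : ℕ} (u : Matrix (Fin n) (Fin n) A) : Prop :=
  0 < n ∧ ∀ T : Matrix (Fin n) (Fin n) ℂ, Intertwines u u T → ∃ c : ℂ, T = c • 1

/-- Unitary equivalence of representations. -/
def EquivalentRep {n m : ℕ} (u : Matrix (Fin n) (Fin n) A) (v : Matrix (Fin m) (Fin m) A) : Prop :=
  ∃ T : Matrix (Fin n) (Fin m) ℂ, Tᴴ * T = 1 ∧ T * Tᴴ = 1 ∧ Intertwines u v T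

/-- `h` is a left and right invariant state. -/
structure IsHaarState (h : A →ₗ[ℂ] ℂ) : Prop where
  map_one : h 1 = 1
  nonneg : ∀ a, 0 ≤ (h (star a * a)).re ∧ (h (star a * a)).im = 0
  left_inv : ∀ a, TensorProduct.lid ℂ A (h.rTensor A (Coalgebra.comul a)) = h a • 1
  right_inv : ∀ a, TensorProduct.rid ℂ A (h.lTensor A (Coalgebra.comul a)) = h a • 1

end Representations

/-- A compact quantum group `𝔾`, given by its CQG algebra `A = Pol(𝔾)`: a Hopf `*`-algebra spanned
by the matrix coefficients of finite-dimensional unitary representations. The structure also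
records the Haar state (which is unique) and a choice of representatives `u^α`, `α ∈ Irr(𝔾)`,
of the equivalence classes of irreducible unitary representations. -/
structure CompactQuantumGroup (A : Type u) [Ring A] [StarRing A] [HopfAlgebra ℂ A]
    [StarModule ℂ A] where
  comul_star : ∀ a : A,
    Coalgebra.comul (R := ℂ) (star a) = star (Coalgebra.comul (R := ℂ) a)
  span_coeff : Submodule.span ℂ {x : A | ∃ (n : ℕ) (u : Matrix (Fin n) (Fin n) A),
    IsUnitaryRep u ∧ ∃ i j, x = u i j} = ⊤
  /-- the Haar state -/
  haar : A →ₗ[ℂ] ℂ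
  isHaarState : IsHaarState haar
  /-- the index set of the classes of irreducible representations -/
  Irr : Type v
  /-- the dimension `n_α` -/
  dim : Irr → ℕ
  /-- the representative `u^α` -/
  rep : ∀ α, Matrix (Fin (dim α)) (Fin (dim α)) A
  isUnitaryRep : ∀ α, IsUnitaryRep (rep α)
  isIrreducibleRep : ∀ α, IsIrreducibleRep (rep α)
  eq_of_equivalent : ∀ α β, EquivalentRep (rep α) (rep β) → α = β
  exists_equivalent : ∀ (n : ℕ) (u : Matrix (Fin n) (Fin n) A), IsUnitaryRep u →
    IsIrreducibleRep u → ∃ α, EquivalentRep (rep α) u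

namespace CompactQuantumGroup

variable {A : Type u} [Ring A] [StarRing A] [HopfAlgebra ℂ A] [StarModule ℂ A]
  (G : CompactQuantumGroup.{u, v} A)

/-- `𝔾` is of Kac type: its Haar state is a trace. -/
def IsKac : Prop := ∀ a b : A, G.haar (a * b) = G.haar (b * a)

/-! ### The dual discrete quantum group and the Fourier algebra -/

/-- The block `M_{n_α}` with the operator norm. -/
abbrev Block (α : G.Irr) := Matrix (Fin (G.dim α)) (Fin (G.dim α)) ℂ

/-- `ℓ^∞(𝔾̂)`, the `ℓ^∞`-direct sum of the blocks `M_{n_α}`. -/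
noncomputable abbrev LInfty := lp (fun α => G.Block α) ∞

/-- The operator space structure of `ℓ^∞(𝔾̂)`: the norm of `X ∈ Mₙ(ℓ^∞(𝔾̂))` is the supremum of the
operator norms of its components in `Mₙ(M_{n_α})`. -/
noncomputable instance : MatrixNormed G.LInfty where
  mnorm n X := ⨆ α, ‖(Matrix.of fun s t => X s.1 t.1 α s.2 t.2 :
    Matrix (Fin n × Fin (G.dim α)) (Fin n × Fin (G.dim α)) ℂ)‖

/-- The Fourier algebra `A(𝔾) = ℓ^1(𝔾̂)`, the predual of `ℓ^∞(𝔾̂)`: the `ℓ^1`-direct sum of the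
trace classes `S^1_{n_α}`, each realized as the Banach space dual of `M_{n_α}`. -/
noncomputable def FourierAlgebra := lp (fun α => G.Block α →L[ℂ] ℂ) 1

noncomputable instance : NormedAddCommGroup G.FourierAlgebra :=
  inferInstanceAs (NormedAddCommGroup (lp (fun α => G.Block α →L[ℂ] ℂ) 1))

noncomputable instance : NormedSpace ℂ G.FourierAlgebra :=
  inferInstanceAs (NormedSpace ℂ (lp (fun α => G.Block α →L[ℂ] ℂ) 1))

/-- The component `ω_α` of `ω`. -/
def component (ω : G.FourierAlgebra) (α : G.Irr) : G.Block α →L[ℂ] ℂ := ω.1 α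

/-- The duality between `A(𝔾)` and `ℓ^∞(𝔾̂)`. -/
noncomputable def pair (ω : G.FourierAlgebra) (X : G.LInfty) : ℂ := ∑' α, G.component ω α (X α)

/-- The operator space structure of `A(𝔾)` as the predual of `ℓ^∞(𝔾̂)`: the norm of
`ω ∈ Mₙ(A(𝔾))` is the completely bounded norm of `X ↦ [ω_{ij}(X)]`, `ℓ^∞(𝔾̂) → Mₙ`. -/
noncomputable instance : MatrixNormed G.FourierAlgebra where
  mnorm n ω := sSup {r : ℝ | ∃ (m : ℕ) (X : Matrix (Fin m) (Fin m) G.LInfty), mnorm m X ≤ 1 ∧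
    r = ‖(Matrix.of fun s t => G.pair (ω s.1 t.1) (X s.2 t.2) :
      Matrix (Fin n × Fin m) (Fin n × Fin m) ℂ)‖}

/-- The Fourier transform `F(x) = (x·h ⊗ id)(U^*)`, where `U = ⨁ u^α` and `(x·h)(y) = h(yx)`. -/
noncomputable def fourierTransform (x : A) (α : G.Irr) : G.Block α :=
  Matrix.of fun j i => G.haar (star (G.rep α i j) * x)

/-- The `α`-component of the functional `F(x)·ĥ : Y ↦ ĥ(Y F(x))`, where `ĥ = ∑ n_α Tr` is the Haar
weight of `𝔾̂` for `𝔾` of Kac type. -/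
noncomputable def fourierBlock (x : A) (α : G.Irr) : G.Block α →L[ℂ] ℂ :=
  LinearMap.toContinuousLinearMap ((G.dim α : ℂ) •
    (Matrix.traceLinearMap (Fin (G.dim α)) ℂ ℂ ∘ₗ
      LinearMap.mulRight ℂ (G.fourierTransform x α)))

end CompactQuantumGroup

/-! Schur orthogonality, used only to see that `F(x)·ĥ` is finitely supported. -/

section Schur

variable {A : Type u} [Ring A] [StarRing A] [HopfAlgebra ℂ A] [StarModule ℂ A]

theorem map_algebraMap_conjTranspose {n m : ℕ} (T : Matrix (Fin n) (Fin m) ℂ) :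
    (T.map (algebraMap ℂ A))ᴴ = Tᴴ.map (algebraMap ℂ A) := by
  ext i j
  simp only [Matrix.conjTranspose_apply, Matrix.map_apply]
  exact (algebraMap_star_comm _).symm

theorem Intertwines.adjoint {n m : ℕ} {u : Matrix (Fin n) (Fin n) A}
    {v : Matrix (Fin m) (Fin m) A} (hu : IsUnitaryRep u) (hv : IsUnitaryRep v)
    {T : Matrix (Fin n) (Fin m) ℂ} (h : Intertwines u v T) : Intertwines v u Tᴴ := by
  have h1 := congrArg Matrix.conjTranspose h
  rw [Matrix.conjTranspose_mul, Matrix.conjTranspose_mul, map_algebraMap_conjTranspose] at h1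
  unfold Intertwines
  calc v * Tᴴ.map (algebraMap ℂ A)
      = v * (Tᴴ.map (algebraMap ℂ A) * uᴴ) * u := by
        rw [Matrix.mul_assoc, Matrix.mul_assoc, hu.star_mul, Matrix.mul_one]
    _ = Tᴴ.map (algebraMap ℂ A) * u := by
        rw [h1, ← Matrix.mul_assoc, hv.mul_star, Matrix.one_mul]

theorem Intertwines.comp {n m k : ℕ} {u : Matrix (Fin n) (Fin n) A}
    {v : Matrix (Fin m) (Fin m) A} {w : Matrix (Fin k) (Fin k) A}
    {T : Matrix (Fin n) (Fin m) ℂ} {S : Matrix (Fin m) (Fin k) ℂ}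
    (h : Intertwines u v T) (h' : Intertwines v w S) : Intertwines u w (T * S) := by
  unfold Intertwines at *
  rw [Matrix.map_mul, ← Matrix.mul_assoc, h, Matrix.mul_assoc, h', Matrix.mul_assoc]

theorem Intertwines.smul {n m : ℕ} {u : Matrix (Fin n) (Fin n) A}
    {v : Matrix (Fin m) (Fin m) A} {T : Matrix (Fin n) (Fin m) ℂ} (c : ℂ)
    (h : Intertwines u v T) : Intertwines u v (c • T) := by
  unfold Intertwines at *
  have : (c • T).map (algebraMap ℂ A) = c • T.map (algebraMap ℂ A) := by
    ext i j
    simp [Algebra.smul_def]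
  rw [this, Matrix.mul_smul, Matrix.smul_mul, h]

theorem Intertwines.eq_zero_or_equivalent {n m : ℕ} {u : Matrix (Fin n) (Fin n) A}
    {v : Matrix (Fin m) (Fin m) A} (hu : IsUnitaryRep u) (hv : IsUnitaryRep v)
    (iu : IsIrreducibleRep u) (iv : IsIrreducibleRep v)
    {S : Matrix (Fin n) (Fin m) ℂ} (h : Intertwines u v S) : S = 0 ∨ EquivalentRep u v := by
  obtain ⟨c, hc⟩ := iu.2 _ (h.comp (h.adjoint hu hv))
  obtain ⟨d, hd⟩ := iv.2 _ ((h.adjoint hu hv).comp h)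
  by_cases hS : S = 0
  · exact Or.inl hS
  right
  have hcd : c = d := by
    have h1 : c • S = d • S := by
      calc c • S = (S * Sᴴ) * S := by rw [hc]; simp
        _ = S * (Sᴴ * S) := Matrix.mul_assoc _ _ _
        _ = d • S := by rw [hd]; simp
    by_contra hne
    apply hS
    have : (c - d) • S = 0 := by rw [sub_smul, h1, sub_self]
    exact (smul_eq_zero.1 this).resolve_left (sub_ne_zero.2 hne)
  have hc0 : c ≠ 0 := by
    rintro rfl
    rw [zero_smul] at hc
    apply hS
    ext i j
    have h2 := congrArg Complex.re (congrFun (congrFun hc i) i)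
    simp only [Matrix.mul_apply, Matrix.conjTranspose_apply, Matrix.zero_apply, Complex.star_def,
      Complex.mul_conj, Complex.re_sum, Complex.ofReal_re, Complex.zero_re] at h2
    exact Complex.normSq_eq_zero.1
      ((Finset.sum_eq_zero_iff_of_nonneg fun k _ => Complex.normSq_nonneg _).1 h2 j
        (Finset.mem_univ j))
  obtain ⟨r, hr0, hr⟩ : ∃ r : ℝ, 0 ≤ r ∧ c = (r : ℂ) := by
    have h2 := congrFun (congrFun hc ⟨0, iu.1⟩) ⟨0, iu.1⟩
    refine ⟨∑ k, ‖S ⟨0, iu.1⟩ k‖ ^ 2, Finset.sum_nonneg fun _ _ => by positivity, ?_⟩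
    simp only [Matrix.mul_apply, Matrix.conjTranspose_apply, Matrix.smul_apply, Matrix.one_apply_eq,
      smul_eq_mul, mul_one] at h2
    rw [← h2]
    push_cast
    refine Finset.sum_congr rfl fun k _ => ?_
    exact Complex.mul_conj' _
  have hrp : 0 < r := lt_of_le_of_ne hr0 (by rintro rfl; exact hc0 (by simp [hr]))
  have key : (((Real.sqrt r)⁻¹ : ℝ) : ℂ) * (((Real.sqrt r)⁻¹ : ℝ) : ℂ) * c = 1 := by
    rw [hr, ← Complex.ofReal_mul, ← Complex.ofReal_mul, ← mul_inv, Real.mul_self_sqrt hr0,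
      inv_mul_cancel₀ hrp.ne', Complex.ofReal_one]
  refine ⟨(((Real.sqrt r)⁻¹ : ℝ) : ℂ) • S, ?_, ?_, h.smul _⟩
  · rw [Matrix.conjTranspose_smul, Matrix.smul_mul, Matrix.mul_smul, hd, smul_smul, smul_smul,
      ← hcd]
    rw [Complex.star_def, Complex.conj_ofReal, key, one_smul]
  · rw [Matrix.conjTranspose_smul, Matrix.smul_mul, Matrix.mul_smul, hc, smul_smul, smul_smul]
    rw [Complex.star_def, Complex.conj_ofReal, key, one_smul]

theorem haar_intertwines (G : CompactQuantumGroup.{u, v} A) {n m : ℕ} {u : Matrix (Fin n) (Fin n) A}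
    {v : Matrix (Fin m) (Fin m) A} (hu : IsUnitaryRep u) (hv : IsUnitaryRep v)
    (i : Fin n) (k : Fin m) :
    Intertwines u v (Matrix.of fun s t => G.haar (star (u i s) * v k t)) := by
  set T : Matrix (Fin n) (Fin m) ℂ := Matrix.of fun s t => G.haar (star (u i s) * v k t) with hT
  have h1 : uᴴ * (T.map (algebraMap ℂ A) * v) = T.map (algebraMap ℂ A) := by
    ext j l
    have h2 := G.isHaarState.left_inv (star (u i j) * v k l)
    rw [Bialgebra.comul_mul, G.comul_star, hu.comul, hv.comul, star_sum, Finset.sum_mul_sum] at h2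
    simp only [TensorProduct.star_tmul, Algebra.TensorProduct.tmul_mul_tmul, map_sum,
      LinearMap.rTensor_tmul, TensorProduct.lid_tmul] at h2
    simp only [Matrix.mul_apply, Matrix.conjTranspose_apply, Matrix.map_apply, hT, Matrix.of_apply,
      Finset.mul_sum]
    rw [Algebra.algebraMap_eq_smul_one, ← h2]
    refine Finset.sum_congr rfl fun s _ => Finset.sum_congr rfl fun t _ => ?_
    rw [← Algebra.smul_def, mul_smul_comm]
  unfold Intertwines
  calc u * T.map (algebraMap ℂ A) = u * (uᴴ * (T.map (algebraMap ℂ A) * v)) := by rw [h1]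
    _ = T.map (algebraMap ℂ A) * v := by rw [← Matrix.mul_assoc, hu.mul_star, Matrix.one_mul]

theorem finite_support_coeff (G : CompactQuantumGroup.{u, v} A) {m : ℕ} {v : Matrix (Fin m) (Fin m) A}
    (hv : IsUnitaryRep v) (k l : Fin m) : {α | G.fourierTransform (v k l) α ≠ 0}.Finite := by
  have hex : ∀ α : {α | G.fourierTransform (v k l) α ≠ 0}, ∃ i j : Fin (G.dim α),
      G.haar (star (G.rep α i j) * v k l) ≠ 0 := by
    rintro ⟨α, hα⟩
    by_contra! hcon
    exact hα (by ext j i; exact hcon i j)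
  choose i j hij using hex
  let T : ∀ α : {α | G.fourierTransform (v k l) α ≠ 0}, Matrix (Fin (G.dim α)) (Fin m) ℂ :=
    fun α => Matrix.of fun s t => G.haar (star (G.rep α (i α) s) * v k t)
  have hT : ∀ α : {α | G.fourierTransform (v k l) α ≠ 0},
      Intertwines (G.rep α) v (T α) := fun α =>
    haar_intertwines G (G.isUnitaryRep α) hv (i α) k
  let w : {α | G.fourierTransform (v k l) α ≠ 0} → EuclideanSpace ℂ (Fin m) := fun α =>
    WithLp.toLp 2 (T α (j α))
  have hw0 : ∀ α, w α ≠ 0 := by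
    intro α h0
    apply hij α
    have := congrArg (fun z : EuclideanSpace ℂ (Fin m) => z l) h0
    simpa [w, T] using this
  have hw : LinearIndependent ℂ w := by
    refine linearIndependent_of_ne_zero_of_inner_eq_zero hw0 ?_
    intro α β hne
    have h0 : T β * (T α)ᴴ = 0 := by
      refine (Intertwines.eq_zero_or_equivalent (G.isUnitaryRep β) (G.isUnitaryRep α)
        (G.isIrreducibleRep β) (G.isIrreducibleRep α)
        ((hT β).comp ((hT α).adjoint (G.isUnitaryRep α) hv))).resolve_right fun he => ?_
      exact hne (Subtype.ext (G.eq_of_equivalent _ _ he).symm)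
    have h1 := congrFun (congrFun h0 (j β)) (j α)
    simp only [Matrix.mul_apply, Matrix.conjTranspose_apply, Matrix.zero_apply] at h1
    rw [← h1, PiLp.inner_apply]
    rfl
  have := hw.finite
  exact Set.toFinite _

end Schur

namespace CompactQuantumGroup

variable {A : Type u} [Ring A] [StarRing A] [HopfAlgebra ℂ A] [StarModule ℂ A]
  (G : CompactQuantumGroup.{u, v} A)

theorem fourierTransform_add (x y : A) (α : G.Irr) :
    G.fourierTransform (x + y) α = G.fourierTransform x α + G.fourierTransform y α := by
  ext i j
  simp [fourierTransform, mul_add]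

theorem fourierTransform_smul (c : ℂ) (x : A) (α : G.Irr) :
    G.fourierTransform (c • x) α = c • G.fourierTransform x α := by
  ext i j
  simp [fourierTransform]

theorem fourierTransform_finite_support (x : A) : {α | G.fourierTransform x α ≠ 0}.Finite := by
  have hx : x ∈ Submodule.span ℂ {x : A | ∃ (n : ℕ) (u : Matrix (Fin n) (Fin n) A),
      IsUnitaryRep u ∧ ∃ i j, x = u i j} := by rw [G.span_coeff]; trivial
  induction hx using Submodule.span_induction with
  | mem x hx =>
    obtain ⟨n, u, hu, i, j, rfl⟩ := hx
    exact finite_support_coeff G hu i j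
  | zero =>
    convert Set.finite_empty
    ext α
    simp only [Set.mem_ofPred_eq, Set.mem_empty_iff_false, iff_false, not_not]
    ext i j
    simp [fourierTransform]
  | add x y _ _ hx hy =>
    refine (hx.union hy).subset fun α hα => ?_
    by_contra hcon
    simp only [Set.mem_union, Set.mem_ofPred_eq, not_or, not_not] at hcon
    exact hα (by rw [fourierTransform_add, hcon.1, hcon.2, add_zero])
  | smul c x _ hx =>
    refine hx.subset fun α hα h0 => hα ?_
    rw [fourierTransform_smul, h0, smul_zero]

/-- The embedding `Pol(𝔾) → A(𝔾)`, `x ↦ F(x)·ĥ`. -/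
noncomputable def fourierEmbedding : A →ₗ[ℂ] G.FourierAlgebra where
  toFun x := (⟨G.fourierBlock x, by
    refine (memℓp_zero ?_).of_exponent_ge zero_le
    refine (G.fourierTransform_finite_support x).subset fun α hα h0 => hα ?_
    ext Y
    simp [fourierBlock, h0]⟩ : lp (fun α => G.Block α →L[ℂ] ℂ) 1)
  map_add' x y := by
    refine Subtype.ext (funext fun α => ContinuousLinearMap.ext fun Y => ?_)
    change G.fourierBlock (x + y) α Y = G.fourierBlock x α Y + G.fourierBlock y α Y
    simp [fourierBlock, fourierTransform_add, mul_add]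
  map_smul' c x := by
    refine Subtype.ext (funext fun α => ContinuousLinearMap.ext fun Y => ?_)
    change G.fourierBlock (c • x) α Y = c • G.fourierBlock x α Y
    simp [fourierBlock, fourierTransform_smul, mul_left_comm]

/-! ### The twisted convolution and the space `A_Δ(𝔾)` -/

/-- The convolution `a ⋆ b = h(S(b₍₁₎) a) b₍₂₎` on `Pol(𝔾)`. -/
noncomputable def conv : A →ₗ[ℂ] A →ₗ[ℂ] A :=
  LinearMap.mk₂ ℂ
    (fun a b => TensorProduct.lid ℂ A ((G.haar ∘ₗ LinearMap.mulRight ℂ a ∘ₗ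
      HopfAlgebra.antipode ℂ (A := A)).rTensor A (Coalgebra.comul b)))
    (fun a a' b => by
      rw [← map_add, ← LinearMap.add_apply, ← LinearMap.rTensor_add]
      congr 3
      ext x
      simp [mul_add])
    (fun c a b => by
      rw [← map_smul, ← LinearMap.smul_apply, ← LinearMap.rTensor_smul]
      congr 3
      ext x
      simp)
    (fun a b b' => by simp only [map_add])
    (fun c a b => by simp only [map_smul])

/-- The twisted convolution `Φ : Pol(𝔾) ⊙ Pol(𝔾) → Pol(𝔾)`, `a ⊗ b ↦ a ⋆ S(b)`. -/
noncomputable def twistedConv : A ⊗[ℂ] A →ₗ[ℂ] A :=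
  TensorProduct.lift (G.conv.compl₂ (HopfAlgebra.antipode ℂ))

/-- The inclusion of `Pol(𝔾) ⊙ Pol(𝔾)` into `A(𝔾) ⊙ A(𝔾)`. -/
noncomputable def tensorEmbedding :
    A ⊗[ℂ] A →ₗ[ℂ] G.FourierAlgebra ⊗[ℂ] G.FourierAlgebra :=
  TensorProduct.map G.fourierEmbedding G.fourierEmbedding

/-- `U` is a series in `Mₙ(Pol(𝔾) ⊙ Pol(𝔾))` that converges absolutely for the projective norm of
`A(𝔾) ⊙ A(𝔾)` and whose image under (the amplification of) `Φ` converges to `ω` in `Mₙ(A(𝔾))`.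
Since `Pol(𝔾) ⊙ Pol(𝔾)` is dense, the sums of such `U` are exactly the elements of `Mₙ` of the
completed projective tensor product that the continuous extension of `Φ` sends to `ω`. -/
def Represents {n : ℕ} (U : ℕ → Matrix (Fin n) (Fin n) (A ⊗[ℂ] A))
    (ω : Matrix (Fin n) (Fin n) G.FourierAlgebra) : Prop :=
  Summable (fun k => mnorm n ((U k).map G.tensorEmbedding)) ∧
    ∀ i j, HasSum (fun k => G.fourierEmbedding (G.twistedConv (U k i j))) (ω i j)

theorem fourier_mnorm_nonneg (n : ℕ) (ω : Matrix (Fin n) (Fin n) G.FourierAlgebra) :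
    0 ≤ mnorm n ω := by
  refine Real.sSup_nonneg ?_
  rintro r ⟨m, X, -, rfl⟩
  exact norm_nonneg _

theorem projective_mnorm_zero (n : ℕ) :
    mnorm n (0 : Matrix (Fin n) (Fin n) (G.FourierAlgebra ⊗[ℂ] G.FourierAlgebra)) = 0 := by
  have hlb : ∀ r ∈ {r : ℝ | ∃ (p q : ℕ) (v : Matrix (Fin p) (Fin p) G.FourierAlgebra)
      (w : Matrix (Fin q) (Fin q) G.FourierAlgebra) (a : Matrix (Fin n) (Fin p × Fin q) ℂ)
      (b : Matrix (Fin p × Fin q) (Fin n) ℂ),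
      (0 : Matrix (Fin n) (Fin n) (G.FourierAlgebra ⊗[ℂ] G.FourierAlgebra)) =
        smulMatrix a (v ⊗ₖₜ[ℂ] w) b ∧ r = ‖a‖ * mnorm p v * mnorm q w * ‖b‖}, 0 ≤ r := by
    rintro r ⟨p, q, v, w, a, b, -, rfl⟩
    have := G.fourier_mnorm_nonneg p v
    have := G.fourier_mnorm_nonneg q w
    positivity
  refine le_antisymm (csInf_le ⟨0, hlb⟩ ⟨0, 0, 0, 0, 0, 0, ?_, by simp⟩) (Real.sInf_nonneg hlb)
  ext i j
  simp [smulMatrix]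

theorem projective_mnorm_smul (n : ℕ) {c : ℂ} (hc : c ≠ 0)
    (u : Matrix (Fin n) (Fin n) (G.FourierAlgebra ⊗[ℂ] G.FourierAlgebra)) :
    mnorm n (c • u) = ‖c‖ * mnorm n u := by
  have hs : ∀ (p q : ℕ) (v : Matrix (Fin p) (Fin p) G.FourierAlgebra)
      (w : Matrix (Fin q) (Fin q) G.FourierAlgebra) (a : Matrix (Fin n) (Fin p × Fin q) ℂ)
      (b : Matrix (Fin p × Fin q) (Fin n) ℂ) (d : ℂ),
      smulMatrix (d • a) (v ⊗ₖₜ[ℂ] w) b = d • smulMatrix a (v ⊗ₖₜ[ℂ] w) b := by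
    intro p q v w a b d
    ext i j
    simp only [smulMatrix, Matrix.of_apply, Matrix.smul_apply, Finset.smul_sum, smul_smul,
      smul_eq_mul, mul_assoc]
  change sInf (_ : Set ℝ) = ‖c‖ • sInf (_ : Set ℝ)
  rw [← Real.sInf_smul_of_nonneg (norm_nonneg c)]
  congr 1
  ext r
  constructor
  · rintro ⟨p, q, v, w, a, b, hu, rfl⟩
    refine ⟨‖c⁻¹ • a‖ * mnorm p v * mnorm q w * ‖b‖, ⟨p, q, v, w, c⁻¹ • a, b, ?_, rfl⟩, ?_⟩
    · rw [hs, ← hu, inv_smul_smul₀ hc]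
    · have : ‖c‖ ≠ 0 := norm_ne_zero_iff.2 hc
      simp only [norm_smul, norm_inv, smul_eq_mul]
      field_simp
  · rintro ⟨_, ⟨p, q, v, w, a, b, rfl, rfl⟩, rfl⟩
    refine ⟨p, q, v, w, c • a, b, (hs _ _ _ _ _ _ _).symm, ?_⟩
    simp only [norm_smul, smul_eq_mul, mul_assoc]

variable {G}

theorem Represents.zero {n : ℕ} :
    G.Represents (fun _ => 0) (0 : Matrix (Fin n) (Fin n) G.FourierAlgebra) := by
  refine ⟨?_, fun i j => by simp [hasSum_zero]⟩
  have : (0 : Matrix (Fin n) (Fin n) (A ⊗[ℂ] A)).map G.tensorEmbedding = 0 :=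
    Matrix.map_zero _ (map_zero _)
  simp only [this, projective_mnorm_zero]
  exact summable_zero

theorem Represents.add {n : ℕ} {U V : ℕ → Matrix (Fin n) (Fin n) (A ⊗[ℂ] A)}
    {ω φ : Matrix (Fin n) (Fin n) G.FourierAlgebra} (hU : G.Represents U ω)
    (hV : G.Represents V φ) :
    G.Represents (fun k => Sum.elim U V (Equiv.natSumNatEquivNat.symm k)) (ω + φ) := by
  refine ⟨?_, fun i j => ?_⟩
  · refine (Equiv.natSumNatEquivNat.symm.summable_iff
      (f := fun s => mnorm n ((Sum.elim U V s).map G.tensorEmbedding))).2 ?_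
    exact Summable.sum _ hU.1 hV.1
  · refine (Equiv.natSumNatEquivNat.symm.hasSum_iff
      (f := fun s => G.fourierEmbedding (G.twistedConv (Sum.elim U V s i j)))).2 ?_
    exact HasSum.sum (hU.2 i j) (hV.2 i j)

theorem Represents.smul {n : ℕ} {U : ℕ → Matrix (Fin n) (Fin n) (A ⊗[ℂ] A)}
    {ω : Matrix (Fin n) (Fin n) G.FourierAlgebra} {c : ℂ} (hc : c ≠ 0) (hU : G.Represents U ω) :
    G.Represents (fun k => c • U k) (c • ω) := by
  refine ⟨?_, fun i j => ?_⟩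
  · have : ∀ k, (c • U k).map G.tensorEmbedding = c • (U k).map G.tensorEmbedding := fun k => by
      ext i j
      simp
    simp only [this, projective_mnorm_smul G n hc]
    exact hU.1.mul_left _
  · simpa using (hU.2 i j).const_smul c

variable (G)

/-- `A_Δ(𝔾)`, the range of `Φ : A(𝔾) ⊗̂ A(𝔾) → A(𝔾)`. -/
noncomputable def ADelta : Submodule ℂ G.FourierAlgebra where
  carrier := {ω | ∃ U : ℕ → Matrix (Fin 1) (Fin 1) (A ⊗[ℂ] A),
    G.Represents U (Matrix.of fun _ _ => ω)}
  zero_mem' := ⟨_, Represents.zero⟩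
  add_mem' := fun ⟨_, hU⟩ ⟨_, hV⟩ => ⟨_, hU.add hV⟩
  smul_mem' c ω := by
    rintro ⟨U, hU⟩
    by_cases hc : c = 0
    · subst hc
      rw [zero_smul]
      exact ⟨_, Represents.zero⟩
    · exact ⟨_, hU.smul hc⟩

noncomputable instance : AddCommGroup G.ADelta := inferInstance

noncomputable instance : Module ℂ G.ADelta := inferInstance

/-- The operator space structure of `A_Δ(𝔾)` that makes `Φ : A(𝔾) ⊗̂ A(𝔾) → A_Δ(𝔾)` a complete
quotient map: the norm of `ω ∈ Mₙ(A_Δ(𝔾))` is the infimum of the norms of its preimages in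
`Mₙ(A(𝔾) ⊗̂ A(𝔾))`; the norm of an element of the completed tensor product is the infimum of
`∑ₖ ‖Uₖ‖` over the series with sum this element. -/
noncomputable instance : MatrixNormed G.ADelta where
  mnorm n ω := sInf {r : ℝ | ∃ U : ℕ → Matrix (Fin n) (Fin n) (A ⊗[ℂ] A),
    G.Represents U (ω.map Subtype.val) ∧ r = ∑' k, mnorm n ((U k).map G.tensorEmbedding)}

/-! ### The dual coproduct -/

/-- The dual coproduct: the component of `Δ̂(X)` in `M_{n_β} ⊗ M_{n_γ}`. Its entries are obtained
by applying the functional `X` of `Pol(𝔾)` to the third leg of `(Δ̂ ⊗ id)(U) = U₁₃ U₂₃`, where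
`U = ∑ e^α_{ij} ⊗ u^α_{ij}`, that is, of
`∑ e^β_{kl} ⊗ e^γ_{pq} ⊗ u^β_{kl} u^γ_{pq}`. -/
noncomputable def dualCoproduct (X : G.LInfty) (β γ : G.Irr) :
    Matrix (Fin (G.dim β) × Fin (G.dim γ)) (Fin (G.dim β) × Fin (G.dim γ)) ℂ :=
  Matrix.of fun s t => G.pair (G.fourierEmbedding (G.rep β s.1 t.1 * G.rep γ s.2 t.2)) X

/-- The value of `ω_β ⊗ φ_γ` at an element of `M_{n_β} ⊗ M_{n_γ}`. -/
noncomputable def tensorPair (ω φ : G.FourierAlgebra) (β γ : G.Irr)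
    (Y : Matrix (Fin (G.dim β) × Fin (G.dim γ)) (Fin (G.dim β) × Fin (G.dim γ)) ℂ) : ℂ :=
  ∑ s, ∑ t, G.component ω β (Matrix.single s.1 t.1 1) *
    G.component φ γ (Matrix.single s.2 t.2 1) * Y s t

end CompactQuantumGroup

/-!
Suppose first that `Pol(𝔾)` consists of functions on a compact group. Then
`Φ(U)(s) = ∫ U(sr, r) dr`, and `E(U)(s, t) = ∫ U(sr, tr) dr` is the projection onto the functions of
`s t⁻¹`, so that `Φ(E(U) V) = Φ(U) Φ(V)` for all `U`, `V`. Since `E` is an average of translations,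
it is contractive for the projective norm, and that norm is submultiplicative because the
multiplication of `A(𝔾)` is completely contractive. Hence the quotient norm of `A_Δ(𝔾)` is
submultiplicative, and the same argument applies to matrices. The proof carries this over to compact
quantum groups of Kac type.

*The average.* A quantum group has no points to integrate over. On a given element of
`Pol(𝔾) ⊙ Pol(𝔾)`, however, only finitely many irreducible representations matter, and only the
second moments of the points are used. So the points are replaced by a finite family of contractions
`W_s ∈ ℓ^∞(𝔾̂)` for which the average of `W_s ⊗ W̄_s` reproduces the Schur orthogonality relations;
Fourier matrices with random signs attached to their rows and columns have this property
(`exists_isAveraging`). Traciality of the Haar state makes the entrywise adjoint of a unitary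
representation unitary (`IsKac.isUnitaryRep_conj`), so `W̄_s` is again a contraction. The resulting
operator `averageTwist` on `Pol(𝔾) ⊙ Pol(𝔾)` is contractive for the projective norm, and it makes
`Φ` multiplicative with respect to the product `(a ⊗ b)(c ⊗ d) = ac ⊗ db` of `Pol(𝔾) ⊙ Pol(𝔾)^op`
(`IsKac.eventually_twistedConv_opMul`). The same averages write `⟨Φ(U), X⟩` as a mean of elementary
tensors of functionals, so that `Φ` is contractive (`IsKac.norm_twistedConv_le`).

*The product.* A product of two irreducible representations gives a `*`-homomorphism on `ℓ^∞(𝔾̂)`,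
and so do its amplifications; therefore the multiplication of `A(𝔾)` is completely contractive
(`IsKac.matrixNormOn_kronecker_le`). Truncation to finitely many irreducible representations is
completely contractive on `A(𝔾)`, so the projective norm on `Pol(𝔾) ⊙ Pol(𝔾)` can be computed from
decompositions over `Pol(𝔾)` (`IsKac.exists_decomposition_of_polNorm_lt`). Together these make the
projective norm submultiplicative, jointly completely, for the product above
(`IsKac.polNorm_opMul_le`).

*The algebra.* Elements of `A_Δ(𝔾)` are values of `Φ` on absolutely convergent series in
`Pol(𝔾) ⊙ Pol(𝔾)`. Averaging the terms of one series and multiplying them with those of another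
gives a double series that represents the product (`IsKac.exists_represents_mul`); this yields both
`A_Δ(𝔾) A_Δ(𝔾) ⊆ A_Δ(𝔾)` and complete contractivity. Associativity is inherited from `Pol(𝔾)` by
density, and Ruan's axioms pass from the projective norm to the quotient
(`isMatricialSeminorm_ADelta`). Finally `Pol(𝔾)` is spanned by the coefficients `u^α_{ik}`
(`span_rep_eq_top`), and `u^α_{ik} = n_α Φ(u^α_{ij} ⊗ (u^α_{kj})^*)` by the orthogonality relations
(`IsKac.twistedConv_rep`), so that `Pol(𝔾) ⊆ A_Δ(𝔾)`.
-/

/-! ### Operator norms of scalar matrices -/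

section ScalarMatrices

variable {ι κ ι' κ' μ : Type*} [Fintype ι] [Fintype κ] [Fintype ι'] [Fintype κ'] [Fintype μ]
  [DecidableEq ι] [DecidableEq κ] [DecidableEq ι'] [DecidableEq κ'] [DecidableEq μ]

theorem Matrix.l2_opNorm_one_le : ‖(1 : Matrix ι ι ℂ)‖ ≤ 1 := by
  rw [← Matrix.diagonal_one, Matrix.l2_opNorm_diagonal]
  exact (pi_norm_le_iff_of_nonneg zero_le_one).2 fun i => by simp

theorem Matrix.l2_opNorm_mul_conjTranspose_self (M : Matrix ι κ ℂ) : ‖M * Mᴴ‖ = ‖M‖ * ‖M‖ := by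
  have := Matrix.l2_opNorm_conjTranspose_mul_self Mᴴ
  rwa [Matrix.conjTranspose_conjTranspose, Matrix.l2_opNorm_conjTranspose] at this

theorem Matrix.l2_opNorm_le_of_mul_conjTranspose_le {M : Matrix ι κ ℂ} {C : ℝ} (hC : 0 ≤ C)
    (h : ‖M * Mᴴ‖ ≤ C * C) : ‖M‖ ≤ C := by
  rw [Matrix.l2_opNorm_mul_conjTranspose_self] at h
  exact abs_le_of_sq_le_sq' (by nlinarith) hC |>.2

theorem Matrix.l2_opNorm_le_of_conjTranspose_mul_le {M : Matrix ι κ ℂ} {C : ℝ} (hC : 0 ≤ C)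
    (h : ‖Mᴴ * M‖ ≤ C * C) : ‖M‖ ≤ C := by
  rw [Matrix.l2_opNorm_conjTranspose_mul_self] at h
  exact abs_le_of_sq_le_sq' (by nlinarith) hC |>.2

/-- The `0`-`1` matrix of a map `f : ι → κ`; multiplication by it selects rows. -/
def selectMatrix (f : ι → κ) : Matrix ι κ ℂ := (1 : Matrix κ κ ℂ).submatrix f id

theorem selectMatrix_mul_conjTranspose {f : ι → κ} (hf : Function.Injective f) :
    selectMatrix f * (selectMatrix f)ᴴ = 1 := by
  ext i j
  simp [selectMatrix, Matrix.mul_apply, Matrix.one_apply, hf.eq_iff, eq_comm]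

theorem norm_selectMatrix_le {f : ι → κ} (hf : Function.Injective f) :
    ‖selectMatrix f‖ ≤ 1 := by
  refine Matrix.l2_opNorm_le_of_mul_conjTranspose_le zero_le_one ?_
  rw [selectMatrix_mul_conjTranspose hf, one_mul]
  exact Matrix.l2_opNorm_one_le

theorem norm_selectMatrix_conjTranspose_le {f : ι → κ} (hf : Function.Injective f) :
    ‖(selectMatrix f)ᴴ‖ ≤ 1 := by
  rw [Matrix.l2_opNorm_conjTranspose]
  exact norm_selectMatrix_le hf

theorem Matrix.l2_opNorm_submatrix_le (M : Matrix κ κ' ℂ) {f : ι → κ} {g : ι' → κ'}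
    (hf : Function.Injective f) (hg : Function.Injective g) : ‖M.submatrix f g‖ ≤ ‖M‖ := by
  have h : M.submatrix f g = selectMatrix f * (M * (selectMatrix g)ᴴ) := by
    ext i j
    simp [selectMatrix, Matrix.mul_apply, Matrix.one_apply]
  rw [h]
  calc _ ≤ ‖selectMatrix f‖ * (‖M‖ * ‖(selectMatrix g)ᴴ‖) :=
        (Matrix.l2_opNorm_mul _ _).trans (by gcongr; exact Matrix.l2_opNorm_mul _ _)
    _ ≤ 1 * (‖M‖ * 1) := by
        gcongr
        · exact norm_selectMatrix_le hf
        · exact norm_selectMatrix_conjTranspose_le hg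
    _ = ‖M‖ := by ring

theorem Matrix.l2_opNorm_submatrix_equiv (M : Matrix κ κ' ℂ) (e : ι ≃ κ) (f : ι' ≃ κ') :
    ‖M.submatrix e f‖ = ‖M‖ := by
  refine le_antisymm (M.l2_opNorm_submatrix_le e.injective f.injective) ?_
  have := (M.submatrix e f).l2_opNorm_submatrix_le e.symm.injective f.symm.injective
  simpa using this

theorem Matrix.l2_opNorm_unit (s : Matrix Unit Unit ℂ) : ‖s‖ = ‖s () ()‖ := by
  have : s = Matrix.diagonal fun _ => s () () := by ext i j; simp
  rw [this, Matrix.l2_opNorm_diagonal]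
  simp

theorem Matrix.l2_opNorm_col (b : Matrix κ Unit ℂ) :
    ‖b‖ * ‖b‖ = ∑ k, ‖b k ()‖ ^ 2 := by
  rw [← Matrix.l2_opNorm_conjTranspose_mul_self, Matrix.l2_opNorm_unit]
  have : (bᴴ * b) () () = ((∑ k, ‖b k ()‖ ^ 2 : ℝ) : ℂ) := by
    simp [Matrix.mul_apply, Complex.conj_mul']
  rw [this, Complex.norm_real, Real.norm_of_nonneg (Finset.sum_nonneg fun _ _ => by positivity)]

/-- A scalar matrix is bounded by `C` as soon as its compressions to rows and columns are. -/
theorem Matrix.l2_opNorm_le_of_compress {M : Matrix ι κ ℂ} {C : ℝ} (hC : 0 ≤ C)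
    (h : ∀ (a : Matrix Unit ι ℂ) (b : Matrix κ Unit ℂ), ‖a * M * b‖ ≤ C * ‖a‖ * ‖b‖) :
    ‖M‖ ≤ C := by
  have hcol : ∀ b : Matrix κ Unit ℂ, ‖M * b‖ ≤ C * ‖b‖ := by
    intro b
    have h1 := h (M * b)ᴴ b
    rw [Matrix.mul_assoc, Matrix.l2_opNorm_conjTranspose_mul_self,
      Matrix.l2_opNorm_conjTranspose] at h1
    rcases eq_or_lt_of_le (norm_nonneg (M * b)) with h0 | h0
    · rw [← h0]; positivity
    · nlinarith
  rw [Matrix.l2_opNorm_def]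
  refine ContinuousLinearMap.opNorm_le_bound _ hC fun x => ?_
  have h2 := hcol (Matrix.of fun k _ => x k)
  have hx : ‖(Matrix.of fun k _ => x k : Matrix κ Unit ℂ)‖ = ‖x‖ := by
    rw [← sq_eq_sq₀ (norm_nonneg _) (norm_nonneg _), EuclideanSpace.norm_sq_eq, sq,
      Matrix.l2_opNorm_col]
    simp
  have hy : ‖M * (Matrix.of fun k _ => x k : Matrix κ Unit ℂ)‖ =
      ‖WithLp.toLp 2 (M *ᵥ x.ofLp)‖ := by
    rw [← sq_eq_sq₀ (norm_nonneg _) (norm_nonneg _), EuclideanSpace.norm_sq_eq, sq,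
      Matrix.l2_opNorm_col]
    simp [Matrix.mul_apply, Matrix.mulVec, dotProduct]
  rw [hx, hy] at h2
  exact h2

theorem Matrix.l2_opNorm_map_star_col (b : Matrix κ Unit ℂ) : ‖b.map star‖ = ‖b‖ := by
  rw [← sq_eq_sq₀ (norm_nonneg _) (norm_nonneg _), sq, sq, Matrix.l2_opNorm_col,
    Matrix.l2_opNorm_col]
  simp

theorem Matrix.l2_opNorm_map_star_row (a : Matrix Unit κ ℂ) : ‖a.map star‖ = ‖a‖ := by
  rw [← Matrix.l2_opNorm_conjTranspose a, ← Matrix.l2_opNorm_conjTranspose (a.map star),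
    ← Matrix.l2_opNorm_map_star_col aᴴ]
  rfl

/-- Entrywise conjugation is isometric: it amounts to conjugating the vectors on both sides. -/
theorem Matrix.l2_opNorm_map_star_le (M : Matrix ι κ ℂ) : ‖M.map star‖ ≤ ‖M‖ := by
  refine Matrix.l2_opNorm_le_of_compress (norm_nonneg _) fun a b => ?_
  have h : a * M.map star * b = (a.map star * M * b.map star).map star := by
    ext i j
    simp [Matrix.mul_apply, Finset.sum_mul]
  rw [h, Matrix.l2_opNorm_map_star_col]
  calc _ ≤ ‖a.map star‖ * ‖M‖ * ‖b.map star‖ :=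
        (Matrix.l2_opNorm_mul _ _).trans (by gcongr; exact Matrix.l2_opNorm_mul _ _)
    _ = _ := by rw [Matrix.l2_opNorm_map_star_col, Matrix.l2_opNorm_map_star_row]; ring

/-- The block diagonal embedding is a homomorphism of `C*`-algebras, hence contractive. -/
theorem Matrix.l2_opNorm_fromBlocks_zero_le (x : Matrix ι κ ℂ) (y : Matrix ι' κ' ℂ) :
    ‖Matrix.fromBlocks x 0 0 y‖ ≤ max ‖x‖ ‖y‖ := by
  let φ : Matrix κ κ ℂ × Matrix κ' κ' ℂ →⋆ₙₐ[ℂ] Matrix (κ ⊕ κ') (κ ⊕ κ') ℂ :=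
    { toFun := fun p => Matrix.fromBlocks p.1 0 0 p.2
      map_smul' := fun c p => by simp [Matrix.fromBlocks_smul]
      map_zero' := by simp
      map_add' := fun p q => by simp [Matrix.fromBlocks_add]
      map_mul' := fun p q => by simp [Matrix.fromBlocks_multiply]
      map_star' := fun p => by
        simp [Matrix.star_eq_conjTranspose, Matrix.fromBlocks_conjTranspose] }
  refine Matrix.l2_opNorm_le_of_conjTranspose_mul_le (le_max_of_le_left (norm_nonneg _)) ?_
  have h := NonUnitalStarAlgHom.norm_apply_le φ (xᴴ * x, yᴴ * y)
  have h' : (Matrix.fromBlocks x 0 0 y)ᴴ * Matrix.fromBlocks x 0 0 y = φ (xᴴ * x, yᴴ * y) := by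
    simp [φ, Matrix.fromBlocks_conjTranspose, Matrix.fromBlocks_multiply]
  rw [h']
  refine h.trans ?_
  rw [Prod.norm_def]
  simp only [Matrix.l2_opNorm_conjTranspose_mul_self]
  exact max_le (mul_self_le_mul_self (norm_nonneg _) (le_max_left _ _))
    (mul_self_le_mul_self (norm_nonneg _) (le_max_right _ _))

theorem Matrix.l2_opNorm_kronecker_one_le (x : Matrix κ κ ℂ) :
    ‖x ⊗ₖ (1 : Matrix κ' κ' ℂ)‖ ≤ ‖x‖ := by
  let φ : Matrix κ κ ℂ →⋆ₙₐ[ℂ] Matrix (κ × κ') (κ × κ') ℂ :=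
    { toFun := fun p => p ⊗ₖ 1
      map_smul' := fun c p => by simp [Matrix.smul_kronecker]
      map_zero' := by simp
      map_add' := fun p q => by simp [Matrix.add_kronecker]
      map_mul' := fun p q => by rw [← Matrix.mul_kronecker_mul, one_mul]
      map_star' := fun p => by
        simp [Matrix.star_eq_conjTranspose, Matrix.conjTranspose_kronecker] }
  exact NonUnitalStarAlgHom.norm_apply_le φ x

theorem Matrix.l2_opNorm_kronecker_le (x : Matrix ι κ ℂ) (y : Matrix ι' κ' ℂ) :
    ‖x ⊗ₖ y‖ ≤ ‖x‖ * ‖y‖ := by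
  refine Matrix.l2_opNorm_le_of_conjTranspose_mul_le (by positivity) ?_
  have h : (x ⊗ₖ y)ᴴ * x ⊗ₖ y =
      ((xᴴ * x) ⊗ₖ (1 : Matrix κ' κ' ℂ)) * ((yᴴ * y) ⊗ₖ (1 : Matrix κ κ ℂ)).submatrix
        (Equiv.prodComm κ κ') (Equiv.prodComm κ κ') := by
    have : ((yᴴ * y) ⊗ₖ (1 : Matrix κ κ ℂ)).submatrix (Equiv.prodComm κ κ') (Equiv.prodComm κ κ')
        = (1 : Matrix κ κ ℂ) ⊗ₖ (yᴴ * y) := by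
      ext i j
      simp [Matrix.kroneckerMap_apply, Matrix.one_apply, mul_comm]
    rw [this, ← Matrix.mul_kronecker_mul, one_mul, mul_one, Matrix.conjTranspose_kronecker,
      ← Matrix.mul_kronecker_mul]
  rw [h]
  calc _ ≤ ‖(xᴴ * x) ⊗ₖ (1 : Matrix κ' κ' ℂ)‖ * ‖(yᴴ * y) ⊗ₖ (1 : Matrix κ κ ℂ)‖ := by
        refine (Matrix.l2_opNorm_mul _ _).trans_eq ?_
        rw [Matrix.l2_opNorm_submatrix_equiv]
    _ ≤ ‖xᴴ * x‖ * ‖yᴴ * y‖ := by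
        gcongr <;> exact Matrix.l2_opNorm_kronecker_one_le _
    _ = _ := by rw [Matrix.l2_opNorm_conjTranspose_mul_self,
                  Matrix.l2_opNorm_conjTranspose_mul_self]; ring

theorem Matrix.l2_opNorm_fromCols_le (a : Matrix ι κ ℂ) (b : Matrix ι κ' ℂ) {r s : ℝ}
    (hr : 0 ≤ r) (hs : 0 ≤ s) (ha : ‖a‖ ≤ √r) (hb : ‖b‖ ≤ √s) :
    ‖Matrix.fromCols a b‖ ≤ √(r + s) := by
  refine Matrix.l2_opNorm_le_of_mul_conjTranspose_le (Real.sqrt_nonneg _) ?_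
  rw [Matrix.conjTranspose_fromCols_eq_fromRows_conjTranspose, Matrix.fromCols_mul_fromRows,
    Real.mul_self_sqrt (by positivity)]
  refine (norm_add_le _ _).trans (add_le_add ?_ ?_)
  · rw [Matrix.l2_opNorm_mul_conjTranspose_self, ← Real.mul_self_sqrt hr]
    gcongr
  · rw [Matrix.l2_opNorm_mul_conjTranspose_self, ← Real.mul_self_sqrt hs]
    gcongr

theorem Matrix.l2_opNorm_fromRows_le (a : Matrix κ ι ℂ) (b : Matrix κ' ι ℂ) {r s : ℝ}
    (hr : 0 ≤ r) (hs : 0 ≤ s) (ha : ‖a‖ ≤ √r) (hb : ‖b‖ ≤ √s) :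
    ‖Matrix.fromRows a b‖ ≤ √(r + s) := by
  rw [← Matrix.l2_opNorm_conjTranspose, Matrix.conjTranspose_fromRows_eq_fromCols_conjTranspose]
  exact Matrix.l2_opNorm_fromCols_le _ _ hr hs (by rwa [Matrix.l2_opNorm_conjTranspose])
    (by rwa [Matrix.l2_opNorm_conjTranspose])

theorem Matrix.l2_opNorm_mul_mul_le (a : Matrix ι κ ℂ) (b : Matrix κ κ' ℂ) (c : Matrix κ' ι' ℂ) :
    ‖a * b * c‖ ≤ ‖a‖ * ‖b‖ * ‖c‖ :=
  (Matrix.l2_opNorm_mul _ _).trans (by gcongr; exact Matrix.l2_opNorm_mul _ _)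

end ScalarMatrices

/-! ### Matricial seminorms -/

section SmulMatrix

variable {ι κ ι' κ' μ E F : Type*} [Fintype ι] [Fintype κ] [Fintype ι'] [Fintype κ'] [Fintype μ]
  [AddCommGroup E] [Module ℂ E] [AddCommGroup F] [Module ℂ F]

theorem smulMatrix_smulMatrix (a : Matrix μ κ ℂ) (c : Matrix κ ι ℂ) (x : Matrix ι ι E)
    (d : Matrix ι κ ℂ) (b : Matrix κ μ ℂ) :
    smulMatrix a (smulMatrix c x d) b = smulMatrix (a * c) x (d * b) := by
  ext i j
  simp only [smulMatrix, Matrix.of_apply, Matrix.mul_apply, Finset.smul_sum, smul_smul,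
    Finset.sum_mul_sum, Finset.sum_smul]
  calc _ = ∑ k, ∑ s, ∑ l, ∑ t, (a i k * b l j * (c k s * d t l)) • x s t :=
        Finset.sum_congr rfl fun k _ => Finset.sum_comm
    _ = ∑ s, ∑ k, ∑ t, ∑ l, (a i k * b l j * (c k s * d t l)) • x s t := by
        rw [Finset.sum_comm]
        exact Finset.sum_congr rfl fun s _ => Finset.sum_congr rfl fun k _ => Finset.sum_comm
    _ = ∑ s, ∑ t, ∑ k, ∑ l, (a i k * b l j * (c k s * d t l)) • x s t :=
        Finset.sum_congr rfl fun s _ => Finset.sum_comm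
    _ = _ := by
        refine Finset.sum_congr rfl fun s _ => Finset.sum_congr rfl fun t _ =>
          Finset.sum_congr rfl fun k _ => Finset.sum_congr rfl fun l _ => ?_
        congr 1
        ring

theorem smulMatrix_map (a : Matrix κ ι ℂ) (x : Matrix ι ι E) (b : Matrix ι κ ℂ) (T : E →ₗ[ℂ] F) :
    (smulMatrix a x b).map T = smulMatrix a (x.map T) b := by
  ext i j
  simp [smulMatrix]

theorem smulMatrix_smul (c : ℂ) (a : Matrix κ ι ℂ) (x : Matrix ι ι E) (b : Matrix ι κ ℂ) :
    smulMatrix a (c • x) b = c • smulMatrix a x b := by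
  ext i j
  simp [smulMatrix, Finset.smul_sum, smul_smul, mul_comm]

theorem smul_smulMatrix (c : ℂ) (a : Matrix κ ι ℂ) (x : Matrix ι ι E) (b : Matrix ι κ ℂ) :
    smulMatrix (c • a) x b = c • smulMatrix a x b := by
  ext i j
  simp [smulMatrix, Finset.smul_sum, smul_smul, mul_assoc]

theorem smulMatrix_smul_right (c : ℂ) (a : Matrix κ ι ℂ) (x : Matrix ι ι E) (b : Matrix ι κ ℂ) :
    smulMatrix a x (c • b) = c • smulMatrix a x b := by
  ext i j
  simp [smulMatrix, Finset.smul_sum, smul_smul, mul_left_comm]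

theorem smulMatrix_select [DecidableEq ι] (x : Matrix ι ι E) (f : κ → ι) :
    smulMatrix (selectMatrix f) x (selectMatrix f)ᴴ = x.submatrix f f := by
  ext i j
  simp [smulMatrix, selectMatrix, Matrix.one_apply]

theorem smulMatrix_one [DecidableEq ι] (x : Matrix ι ι E) : smulMatrix 1 x 1 = x := by
  ext i j
  simp [smulMatrix, Matrix.one_apply]

theorem smulMatrix_fromBlocks (a : Matrix μ ι ℂ) (a' : Matrix μ κ ℂ) (x : Matrix ι ι E)
    (y : Matrix κ κ E) (b : Matrix ι μ ℂ) (b' : Matrix κ μ ℂ) :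
    smulMatrix (Matrix.fromCols a a') (Matrix.fromBlocks x 0 0 y) (Matrix.fromRows b b') =
      smulMatrix a x b + smulMatrix a' y b' := by
  ext i j
  simp [smulMatrix, Fintype.sum_sum_type]

end SmulMatrix

/-- A family of functions on the matrix spaces over `E` satisfying Ruan's axioms, except for
definiteness and completeness. -/
structure IsMatricialSeminorm {E : Type*} [AddCommGroup E] [Module ℂ E]
    (N : ∀ n : ℕ, Matrix (Fin n) (Fin n) E → ℝ) : Prop where
  add_le : ∀ (n : ℕ) (x y : Matrix (Fin n) (Fin n) E), N n (x + y) ≤ N n x + N n y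
  smulMatrix_le : ∀ (m n : ℕ) (a : Matrix (Fin m) (Fin n) ℂ) (x : Matrix (Fin n) (Fin n) E)
    (b : Matrix (Fin n) (Fin m) ℂ), N m (smulMatrix a x b) ≤ ‖a‖ * N n x * ‖b‖
  directSum_le : ∀ (m n : ℕ) (x : Matrix (Fin m) (Fin m) E) (y : Matrix (Fin n) (Fin n) E),
    N (m + n) (directSumMatrix x y) ≤ max (N m x) (N n y)

/-- The norm of a matrix over `E` indexed by a finite type, by way of an enumeration of that type;
for matricial seminorms the enumeration does not matter. -/
noncomputable def matrixNormOn {E ι : Type*} [Fintype ι]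
    (N : ∀ n : ℕ, Matrix (Fin n) (Fin n) E → ℝ) (x : Matrix ι ι E) : ℝ :=
  N (Fintype.card ι) (x.submatrix (Fintype.equivFin ι).symm (Fintype.equivFin ι).symm)

namespace IsMatricialSeminorm

variable {E : Type*} [AddCommGroup E] [Module ℂ E] {N : ∀ n : ℕ, Matrix (Fin n) (Fin n) E → ℝ}
  (hN : IsMatricialSeminorm N)

include hN

theorem map_zero (n : ℕ) : N n 0 = 0 := by
  have h1 := hN.smulMatrix_le n n 0 0 0
  have h2 := hN.add_le n 0 0
  have h3 : smulMatrix (0 : Matrix (Fin n) (Fin n) ℂ) (0 : Matrix (Fin n) (Fin n) E) 0 = 0 := by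
    ext i j; simp [smulMatrix]
  rw [h3, norm_zero, zero_mul, zero_mul] at h1
  rw [add_zero] at h2
  linarith

/-- The axiom on scalar matrices, before the sign of the norm is known. -/
theorem smul_le (n : ℕ) (c : ℂ) (x : Matrix (Fin n) (Fin n) E) : N n (c • x) ≤ ‖c‖ * |N n x| := by
  have h := hN.smulMatrix_le n n (c • 1) x 1
  rw [smul_smulMatrix, smulMatrix_one, norm_smul] at h
  refine h.trans ?_
  have h1 : ‖(1 : Matrix (Fin n) (Fin n) ℂ)‖ ≤ 1 := Matrix.l2_opNorm_one_le
  calc ‖c‖ * ‖(1 : Matrix (Fin n) (Fin n) ℂ)‖ * N n x * ‖(1 : Matrix (Fin n) (Fin n) ℂ)‖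
      ≤ ‖c‖ * ‖(1 : Matrix (Fin n) (Fin n) ℂ)‖ * |N n x| * ‖(1 : Matrix (Fin n) (Fin n) ℂ)‖ := by
        gcongr; exact le_abs_self _
    _ ≤ ‖c‖ * 1 * |N n x| * 1 := by gcongr
    _ = _ := by ring

/-- Positivity is not an axiom: a negative value would survive `x + (-1) • x = 0`. -/
theorem nonneg (n : ℕ) (x : Matrix (Fin n) (Fin n) E) : 0 ≤ N n x := by
  by_contra! hneg
  have h := hN.add_le n x ((-1 : ℂ) • x)
  have h' := hN.smulMatrix_le n n ((-1 : ℂ) • 1) x 1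
  rw [smul_smulMatrix, smulMatrix_one] at h'
  have h2 : x + (-1 : ℂ) • x = 0 := by simp
  rw [h2, hN.map_zero] at h
  have h3 : ‖((-1 : ℂ) • 1 : Matrix (Fin n) (Fin n) ℂ)‖ * N n x *
      ‖(1 : Matrix (Fin n) (Fin n) ℂ)‖ ≤ 0 :=
    mul_nonpos_of_nonpos_of_nonneg (mul_nonpos_of_nonneg_of_nonpos (norm_nonneg _) hneg.le)
      (norm_nonneg _)
  linarith

theorem smul_eq (n : ℕ) (c : ℂ) (x : Matrix (Fin n) (Fin n) E) :
    N n (c • x) = ‖c‖ * N n x := by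
  have h : ∀ (c : ℂ) (x : Matrix (Fin n) (Fin n) E), N n (c • x) ≤ ‖c‖ * N n x := fun c x => by
    have := hN.smul_le n c x
    rwa [abs_of_nonneg (hN.nonneg n x)] at this
  refine le_antisymm (h c x) ?_
  rcases eq_or_ne c 0 with rfl | hc
  · simpa using hN.nonneg n _
  · have h1 := h c⁻¹ (c • x)
    rw [inv_smul_smul₀ hc, norm_inv] at h1
    have h2 : 0 < ‖c‖ := norm_pos_iff.2 hc
    calc ‖c‖ * N n x ≤ ‖c‖ * (‖c‖⁻¹ * N n (c • x)) := by gcongr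
      _ = _ := by field_simp

/-- Compression to, and permutation of, a set of indices is multiplication by `0`-`1` matrices of
norm at most one. -/
theorem submatrix_le {m n : ℕ} (x : Matrix (Fin n) (Fin n) E) {f : Fin m → Fin n}
    (hf : Function.Injective f) : N m (x.submatrix f f) ≤ N n x := by
  rw [← smulMatrix_select]
  calc _ ≤ ‖selectMatrix f‖ * N n x * ‖(selectMatrix f)ᴴ‖ := hN.smulMatrix_le _ _ _ _ _
    _ ≤ 1 * N n x * 1 := by
        have := hN.nonneg n x
        gcongr
        · exact norm_selectMatrix_le hf
        · exact norm_selectMatrix_conjTranspose_le hf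
    _ = _ := by ring

theorem matrixNormOn_eq {ι : Type*} [Fintype ι] (x : Matrix ι ι E) {n : ℕ} (e : Fin n ≃ ι) :
    matrixNormOn N x = N n (x.submatrix e e) := by
  have hn : n = Fintype.card ι := by simpa using Fintype.card_congr e
  subst hn
  unfold matrixNormOn
  refine le_antisymm ?_ ?_
  · have := hN.submatrix_le (x.submatrix e e)
      ((Fintype.equivFin ι).symm.trans e.symm).injective
    simpa [Matrix.submatrix_submatrix, Function.comp_def] using this
  · have := hN.submatrix_le (x.submatrix (Fintype.equivFin ι).symm (Fintype.equivFin ι).symm)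
      (e.trans (Fintype.equivFin ι)).injective
    simpa [Matrix.submatrix_submatrix, Function.comp_def] using this

theorem matrixNormOn_fin {n : ℕ} (x : Matrix (Fin n) (Fin n) E) : matrixNormOn N x = N n x := by
  simpa using hN.matrixNormOn_eq x (Equiv.refl _)

theorem matrixNormOn_nonneg {ι : Type*} [Fintype ι] (x : Matrix ι ι E) : 0 ≤ matrixNormOn N x :=
  hN.nonneg _ _

theorem matrixNormOn_fromBlocks_le {ι κ : Type*} [Fintype ι] [Fintype κ] (x : Matrix ι ι E)
    (y : Matrix κ κ E) :
    matrixNormOn N (Matrix.fromBlocks x 0 0 y) ≤ max (matrixNormOn N x) (matrixNormOn N y) := by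
  set e := (Fintype.equivFin ι).symm with he
  set f := (Fintype.equivFin κ).symm with hf
  rw [hN.matrixNormOn_eq (Matrix.fromBlocks x 0 0 y)
    (finSumFinEquiv.symm.trans (e.sumCongr f))]
  have h : (Matrix.fromBlocks x 0 0 y).submatrix (finSumFinEquiv.symm.trans (e.sumCongr f))
      (finSumFinEquiv.symm.trans (e.sumCongr f)) =
      directSumMatrix (x.submatrix e e) (y.submatrix f f) := by
    rw [directSumMatrix, Matrix.reindex_apply]
    ext i j
    simp only [Matrix.submatrix_apply, Equiv.trans_apply]
    rcases finSumFinEquiv.symm i with i | i <;> rcases finSumFinEquiv.symm j with j | j <;> simp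
  rw [h]
  exact hN.directSum_le _ _ _ _

theorem directSum_eq (m n : ℕ) (x : Matrix (Fin m) (Fin m) E) (y : Matrix (Fin n) (Fin n) E) :
    N (m + n) (directSumMatrix x y) = max (N m x) (N n y) := by
  refine le_antisymm (hN.directSum_le m n x y) (max_le ?_ ?_)
  · have h := hN.submatrix_le (directSumMatrix x y) (Fin.castAdd_injective m n)
    have hx : (directSumMatrix x y).submatrix (Fin.castAdd n) (Fin.castAdd n) = x := by
      ext i j
      simp [directSumMatrix]
    rwa [hx] at h
  · have h := hN.submatrix_le (directSumMatrix x y) (Fin.natAdd_injective n m)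
    have hy : (directSumMatrix x y).submatrix (Fin.natAdd m) (Fin.natAdd m) = y := by
      ext i j
      simp [directSumMatrix]
    rwa [hy] at h

theorem entry_le (n : ℕ) (x : Matrix (Fin n) (Fin n) E) (i j : Fin n) :
    N 1 (Matrix.of fun _ _ => x i j) ≤ N n x := by
  have h : (Matrix.of fun _ _ => x i j : Matrix (Fin 1) (Fin 1) E) =
      smulMatrix (selectMatrix fun _ : Fin 1 => i) x (selectMatrix fun _ : Fin 1 => j)ᴴ := by
    ext k l
    simp [smulMatrix, selectMatrix, Matrix.one_apply]
  rw [h]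
  calc _ ≤ ‖selectMatrix fun _ : Fin 1 => i‖ * N n x * ‖(selectMatrix fun _ : Fin 1 => j)ᴴ‖ :=
        hN.smulMatrix_le _ _ _ _ _
    _ ≤ 1 * N n x * 1 := by
        have := hN.nonneg n x
        gcongr
        · exact norm_selectMatrix_le (Function.injective_of_subsingleton _)
        · exact norm_selectMatrix_conjTranspose_le (Function.injective_of_subsingleton _)
    _ = _ := by ring

theorem sum_le {ι : Type*} (s : Finset ι) (n : ℕ) (x : ι → Matrix (Fin n) (Fin n) E) :
    N n (∑ i ∈ s, x i) ≤ ∑ i ∈ s, N n (x i) := by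
  classical
  induction s using Finset.induction_on with
  | empty => simp [hN.map_zero]
  | insert i s hi ih =>
    rw [Finset.sum_insert hi, Finset.sum_insert hi]
    exact (hN.add_le _ _ _).trans (by gcongr)

theorem le_sum_entries (n : ℕ) (x : Matrix (Fin n) (Fin n) E) :
    N n x ≤ ∑ i, ∑ j, N 1 (Matrix.of fun _ _ => x i j) := by
  have h : x = ∑ i, ∑ j, smulMatrix (selectMatrix fun _ : Fin 1 => i)ᴴ
      (Matrix.of fun _ _ => x i j) (selectMatrix fun _ : Fin 1 => j) := by
    ext k l
    simp [smulMatrix, selectMatrix, Matrix.one_apply, Matrix.sum_apply]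
  calc N n x ≤ ∑ i, ∑ j, N n (smulMatrix (selectMatrix fun _ : Fin 1 => i)ᴴ
      (Matrix.of fun _ _ => x i j) (selectMatrix fun _ : Fin 1 => j)) := by
        conv_lhs => rw [h]
        exact (hN.sum_le _ _ _).trans (Finset.sum_le_sum fun i _ => hN.sum_le _ _ _)
    _ ≤ _ := by
        refine Finset.sum_le_sum fun i _ => Finset.sum_le_sum fun j _ => ?_
        have h0 := hN.nonneg 1 (Matrix.of fun _ _ => x i j)
        refine (hN.smulMatrix_le _ _ _ _ _).trans ?_
        calc _ ≤ 1 * N 1 (Matrix.of fun _ _ => x i j) * 1 := by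
              gcongr
              · exact norm_selectMatrix_conjTranspose_le (Function.injective_of_subsingleton _)
              · exact norm_selectMatrix_le (Function.injective_of_subsingleton _)
          _ = _ := by ring

end IsMatricialSeminorm

/-! ### The operator space projective norm -/

section DirectSum

variable {κ κ' E : Type*} [AddCommGroup E] [Module ℂ E] {m n : ℕ}

theorem Fin.castAdd_ne_natAdd (i : Fin m) (j : Fin n) : Fin.castAdd n i ≠ Fin.natAdd m j := by
  simp only [ne_eq, Fin.ext_iff, Fin.val_castAdd, Fin.val_natAdd]
  omega

theorem fromCols_select_castAdd_natAdd (a : Matrix (Fin m) κ ℂ) (a' : Matrix (Fin n) κ' ℂ) :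
    Matrix.fromCols ((selectMatrix (Fin.castAdd n : Fin m → Fin (m + n)))ᴴ * a)
      ((selectMatrix (Fin.natAdd m : Fin n → Fin (m + n)))ᴴ * a') =
      (Matrix.fromBlocks a 0 0 a').submatrix finSumFinEquiv.symm id := by
  ext i j
  refine Fin.addCases (fun i => ?_) (fun i => ?_) i <;> rcases j with j | j <;>
    simp [selectMatrix, Matrix.mul_apply, Matrix.one_apply, Fin.castAdd_ne_natAdd,
      (Fin.castAdd_ne_natAdd _ _).symm]

theorem fromRows_select_castAdd_natAdd (b : Matrix κ (Fin m) ℂ) (b' : Matrix κ' (Fin n) ℂ) :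
    Matrix.fromRows (b * selectMatrix (Fin.castAdd n : Fin m → Fin (m + n)))
      (b' * selectMatrix (Fin.natAdd m : Fin n → Fin (m + n))) =
      (Matrix.fromBlocks b 0 0 b').submatrix id finSumFinEquiv.symm := by
  ext i j
  refine Fin.addCases (fun j => ?_) (fun j => ?_) j <;> rcases i with i | i <;>
    simp [selectMatrix, Matrix.mul_apply, Matrix.one_apply, Fin.castAdd_ne_natAdd,
      (Fin.castAdd_ne_natAdd _ _).symm]

theorem directSumMatrix_eq_add (x : Matrix (Fin m) (Fin m) E) (y : Matrix (Fin n) (Fin n) E) :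
    directSumMatrix x y =
      smulMatrix (selectMatrix (Fin.castAdd n : Fin m → Fin (m + n)))ᴴ x
        (selectMatrix (Fin.castAdd n)) +
      smulMatrix (selectMatrix (Fin.natAdd m : Fin n → Fin (m + n)))ᴴ y
        (selectMatrix (Fin.natAdd m)) := by
  ext i j
  refine Fin.addCases (fun i => ?_) (fun i => ?_) i <;>
    refine Fin.addCases (fun j => ?_) (fun j => ?_) j <;>
    simp [directSumMatrix, smulMatrix, selectMatrix, Matrix.one_apply, Fin.castAdd_ne_natAdd,
      (Fin.castAdd_ne_natAdd _ _).symm]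

end DirectSum

section Projective

variable {V W : Type*} [AddCommGroup V] [Module ℂ V] [MatrixNormed V]
  [AddCommGroup W] [Module ℂ W] [MatrixNormed W]

theorem smulMatrix_kronecker_reindex {ι κ ι' κ' μ : Type*} [Fintype ι] [Fintype κ] [Fintype ι']
    [Fintype κ'] (a : Matrix μ (ι × κ) ℂ) (v : Matrix ι ι V) (w : Matrix κ κ W)
    (b : Matrix (ι × κ) μ ℂ) (e : ι' ≃ ι) (f : κ' ≃ κ) :
    smulMatrix (a.submatrix id (e.prodCongr f)) (v.submatrix e e ⊗ₖₜ[ℂ] w.submatrix f f)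
      (b.submatrix (e.prodCongr f) id) = smulMatrix a (v ⊗ₖₜ[ℂ] w) b := by
  ext i j
  simp only [smulMatrix, Matrix.of_apply, Matrix.submatrix_apply, id]
  rw [← (e.prodCongr f).sum_comp]
  refine Finset.sum_congr rfl fun k _ => ?_
  rw [← (e.prodCongr f).sum_comp]
  rfl

/-- `u` has a decomposition `u = a (v ⊗ w) b` into contractions `v`, `w` and scalar matrices of
norm at most `√r`. -/
def IsProjectivelyBounded {n : ℕ} (u : Matrix (Fin n) (Fin n) (V ⊗[ℂ] W)) (r : ℝ) : Prop :=
  ∃ (p q : ℕ) (v : Matrix (Fin p) (Fin p) V) (w : Matrix (Fin q) (Fin q) W)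
    (a : Matrix (Fin n) (Fin p × Fin q) ℂ) (b : Matrix (Fin p × Fin q) (Fin n) ℂ),
    u = smulMatrix a (v ⊗ₖₜ[ℂ] w) b ∧ mnorm p v ≤ 1 ∧ mnorm q w ≤ 1 ∧ ‖a‖ ≤ √r ∧ ‖b‖ ≤ √r

/-- The map of index sets under which `(v ⊕ v') ⊗ (w ⊕ w')` restricts to
`(v ⊗ w) ⊕ (v' ⊗ w')`. -/
def diagonalIndex (ι κ ι' κ' : Type*) : (ι × κ) ⊕ (ι' × κ') → (ι ⊕ ι') × (κ ⊕ κ') :=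
  Sum.elim (fun x => (Sum.inl x.1, Sum.inl x.2)) fun x => (Sum.inr x.1, Sum.inr x.2)

theorem diagonalIndex_injective (ι κ ι' κ' : Type*) :
    Function.Injective (diagonalIndex ι κ ι' κ') := by
  rintro (⟨x, y⟩ | ⟨x, y⟩) (⟨x', y'⟩ | ⟨x', y'⟩) h <;> simp_all [diagonalIndex]

/-- A sum of two decompositions is again one, with the direct sums of the factors in the middle. -/
theorem smulMatrix_kronecker_add {ι κ ι' κ' μ : Type*} [Fintype ι] [Fintype κ] [Fintype ι']
    [Fintype κ'] [Fintype μ] [DecidableEq ι] [DecidableEq κ] [DecidableEq ι'] [DecidableEq κ']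
    (a : Matrix μ (ι × κ) ℂ) (v : Matrix ι ι V) (w : Matrix κ κ W) (b : Matrix (ι × κ) μ ℂ)
    (a' : Matrix μ (ι' × κ') ℂ) (v' : Matrix ι' ι' V) (w' : Matrix κ' κ' W)
    (b' : Matrix (ι' × κ') μ ℂ) :
    smulMatrix a (v ⊗ₖₜ[ℂ] w) b + smulMatrix a' (v' ⊗ₖₜ[ℂ] w') b' =
      smulMatrix (Matrix.fromCols a a' * selectMatrix (diagonalIndex ι κ ι' κ'))
        (Matrix.fromBlocks v 0 0 v' ⊗ₖₜ[ℂ] Matrix.fromBlocks w 0 0 w')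
        ((selectMatrix (diagonalIndex ι κ ι' κ'))ᴴ * Matrix.fromRows b b') := by
  have h1 : (Matrix.fromBlocks v 0 0 v' ⊗ₖₜ[ℂ] Matrix.fromBlocks w 0 0 w').submatrix
      (diagonalIndex ι κ ι' κ') (diagonalIndex ι κ ι' κ') =
      Matrix.fromBlocks (v ⊗ₖₜ[ℂ] w) 0 0 (v' ⊗ₖₜ[ℂ] w') := by
    ext (i | i) (j | j) <;> simp [diagonalIndex]
  rw [← smulMatrix_smulMatrix, smulMatrix_select, h1, smulMatrix_fromBlocks]

/-- Every matrix over `V ⊗ W` has a decomposition, so that the infimum defining the projective norm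
is taken over a nonempty set. -/
theorem exists_decomposition {n : ℕ} (u : Matrix (Fin n) (Fin n) (V ⊗[ℂ] W)) :
    ∃ (p q : ℕ) (v : Matrix (Fin p) (Fin p) V) (w : Matrix (Fin q) (Fin q) W)
      (a : Matrix (Fin n) (Fin p × Fin q) ℂ) (b : Matrix (Fin p × Fin q) (Fin n) ℂ),
      u = smulMatrix a (v ⊗ₖₜ[ℂ] w) b := by
  let S : AddSubmonoid (Matrix (Fin n) (Fin n) (V ⊗[ℂ] W)) :=
    { carrier := {u | ∃ (p q : ℕ) (v : Matrix (Fin p) (Fin p) V) (w : Matrix (Fin q) (Fin q) W)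
        (a : Matrix (Fin n) (Fin p × Fin q) ℂ) (b : Matrix (Fin p × Fin q) (Fin n) ℂ),
        u = smulMatrix a (v ⊗ₖₜ[ℂ] w) b}
      zero_mem' := ⟨0, 0, 0, 0, 0, 0, by ext i j; simp [smulMatrix]⟩
      add_mem' := by
        rintro _ _ ⟨p, q, v, w, a, b, rfl⟩ ⟨p', q', v', w', a', b', rfl⟩
        rw [smulMatrix_kronecker_add, ← smulMatrix_kronecker_reindex _ _ _ _
          finSumFinEquiv.symm finSumFinEquiv.symm]
        exact ⟨_, _, _, _, _, _, rfl⟩ }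
  have hsingle : ∀ (i j : Fin n) (t : V ⊗[ℂ] W), Matrix.single i j t ∈ S := by
    intro i j t
    induction t using TensorProduct.induction_on with
    | zero => rw [Matrix.single_zero]; exact S.zero_mem
    | add x y hx hy => rw [Matrix.single_add]; exact S.add_mem hx hy
    | tmul x y =>
      refine ⟨1, 1, Matrix.of fun _ _ => x, Matrix.of fun _ _ => y,
        Matrix.of fun k _ => if i = k then 1 else 0,
        Matrix.of fun _ l => if j = l then 1 else 0, ?_⟩
      ext k l
      by_cases hi : i = k <;> by_cases hj : j = l <;> simp [smulMatrix, hi, hj]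
  rw [Matrix.matrix_eq_sum_single u]
  exact S.sum_mem fun i _ => S.sum_mem fun j _ => hsingle i j _

variable (hV : IsMatricialSeminorm (mnorm (E := V))) (hW : IsMatricialSeminorm (mnorm (E := W)))

include hV hW

theorem projective_bddBelow (n : ℕ) (u : Matrix (Fin n) (Fin n) (V ⊗[ℂ] W)) :
    ∀ r ∈ {r : ℝ | ∃ (p q : ℕ) (v : Matrix (Fin p) (Fin p) V)
      (w : Matrix (Fin q) (Fin q) W) (a : Matrix (Fin n) (Fin p × Fin q) ℂ)
      (b : Matrix (Fin p × Fin q) (Fin n) ℂ),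
      u = smulMatrix a (v ⊗ₖₜ[ℂ] w) b ∧ r = ‖a‖ * mnorm p v * mnorm q w * ‖b‖}, 0 ≤ r := by
  rintro r ⟨p, q, v, w, a, b, -, rfl⟩
  have := hV.nonneg p v
  have := hW.nonneg q w
  positivity

theorem projective_nonneg (n : ℕ) (u : Matrix (Fin n) (Fin n) (V ⊗[ℂ] W)) : 0 ≤ mnorm n u :=
  Real.sInf_nonneg (projective_bddBelow hV hW n u)

theorem projective_le {n : ℕ} {ι κ : Type*} [Fintype ι] [DecidableEq ι] [Fintype κ]
    [DecidableEq κ] (v : Matrix ι ι V) (w : Matrix κ κ W) (a : Matrix (Fin n) (ι × κ) ℂ)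
    (b : Matrix (ι × κ) (Fin n) ℂ) :
    mnorm n (smulMatrix a (v ⊗ₖₜ[ℂ] w) b) ≤
      ‖a‖ * matrixNormOn mnorm v * matrixNormOn mnorm w * ‖b‖ := by
  refine csInf_le ⟨0, projective_bddBelow hV hW _ _⟩ ?_
  set e := (Fintype.equivFin ι).symm
  set f := (Fintype.equivFin κ).symm
  refine ⟨_, _, v.submatrix e e, w.submatrix f f, a.submatrix id (e.prodCongr f),
    b.submatrix (e.prodCongr f) id, (smulMatrix_kronecker_reindex a v w b e f).symm, ?_⟩
  have ha := Matrix.l2_opNorm_submatrix_equiv a (Equiv.refl _) (e.prodCongr f)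
  have hb := Matrix.l2_opNorm_submatrix_equiv b (e.prodCongr f) (Equiv.refl _)
  rw [Equiv.coe_refl] at ha hb
  rw [ha, hb]
  rfl

/-- Scaling the factors of a decomposition to norm one and distributing the rest evenly. -/
theorem isProjectivelyBounded_of_decomposition {n p q : ℕ} {r : ℝ} (v : Matrix (Fin p) (Fin p) V)
    (w : Matrix (Fin q) (Fin q) W) (a : Matrix (Fin n) (Fin p × Fin q) ℂ)
    (b : Matrix (Fin p × Fin q) (Fin n) ℂ) (hr : ‖a‖ * mnorm p v * mnorm q w * ‖b‖ < r) :
    IsProjectivelyBounded (smulMatrix a (v ⊗ₖₜ[ℂ] w) b) r := by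
  have hv0 := hV.nonneg p v
  have hw0 := hW.nonneg q w
  have hr0 : 0 < r := lt_of_le_of_lt (by positivity) hr
  -- Enlarging all four norms slightly avoids dividing by zero.
  obtain ⟨ε, hε, hlt⟩ : ∃ ε : ℝ, 0 < ε ∧
      (‖a‖ + ε) * (mnorm p v + ε) * (mnorm q w + ε) * (‖b‖ + ε) < r := by
    have hc : Filter.Tendsto
        (fun ε : ℝ => (‖a‖ + ε) * (mnorm p v + ε) * (mnorm q w + ε) * (‖b‖ + ε))
        (nhdsWithin 0 (Set.Ioi 0)) (nhds ((‖a‖ + 0) * (mnorm p v + 0) * (mnorm q w + 0) *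
          (‖b‖ + 0))) :=
      (Continuous.tendsto (by fun_prop) 0).mono_left nhdsWithin_le_nhds
    simp only [add_zero] at hc
    obtain ⟨ε, h1, h2⟩ := ((hc.eventually (gt_mem_nhds hr)).and self_mem_nhdsWithin).exists
    exact ⟨ε, h2, h1⟩
  set x := ‖a‖ + ε
  set y := mnorm p v + ε
  set z := mnorm q w + ε
  set t := ‖b‖ + ε
  have hx : 0 < x := by positivity
  have hy : 0 < y := by positivity
  have hz : 0 < z := by positivity
  have ht : 0 < t := by positivity
  have hs : 0 < √r := Real.sqrt_pos.2 hr0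
  refine ⟨p, q, ((y⁻¹ : ℝ) : ℂ) • v, ((z⁻¹ : ℝ) : ℂ) • w, ((√r / x : ℝ) : ℂ) • a,
    ((x * y * z / √r : ℝ) : ℂ) • b, ?_, ?_, ?_, ?_, ?_⟩
  · have h : (((y⁻¹ : ℝ) : ℂ) • v) ⊗ₖₜ[ℂ] (((z⁻¹ : ℝ) : ℂ) • w) =
        ((y⁻¹ * z⁻¹ : ℝ) : ℂ) • (v ⊗ₖₜ[ℂ] w) := by
      ext i j
      simp [TensorProduct.smul_tmul', TensorProduct.tmul_smul, smul_smul, mul_comm]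
    rw [h, smul_smulMatrix, smulMatrix_smul, smulMatrix_smul_right, smul_smul, smul_smul,
      ← Complex.ofReal_mul, ← Complex.ofReal_mul]
    have : √r / x * (y⁻¹ * z⁻¹) * (x * y * z / √r) = 1 := by field_simp
    rw [this, Complex.ofReal_one, one_smul]
  · rw [hV.smul_eq, Complex.norm_real, Real.norm_of_nonneg (by positivity), inv_mul_le_iff₀ hy]
    simp only [y]; linarith
  · rw [hW.smul_eq, Complex.norm_real, Real.norm_of_nonneg (by positivity), inv_mul_le_iff₀ hz]
    simp only [z]; linarith
  · rw [norm_smul, Complex.norm_real, Real.norm_of_nonneg (by positivity), div_mul_eq_mul_div,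
      div_le_iff₀ hx]
    gcongr
    simp only [x]; linarith
  · rw [norm_smul, Complex.norm_real, Real.norm_of_nonneg (by positivity), div_mul_eq_mul_div,
      div_le_iff₀ hs, Real.mul_self_sqrt hr0.le]
    refine le_trans ?_ hlt.le
    gcongr
    simp only [t]; linarith

/-- The estimate behind both the triangle inequality and the norm of a direct sum: the direct sum of
the middle factors costs nothing, so only the outer scalar matrices count. As all of them have norm
at most `√r` or `√r'`, side by side they have norm at most `√(r + r')`, and in orthogonal positions
at most `√(max r r')`. -/
theorem projective_add_le_of_bounded {n m m' : ℕ} {r r' s : ℝ}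
    {u : Matrix (Fin m) (Fin m) (V ⊗[ℂ] W)} {u' : Matrix (Fin m') (Fin m') (V ⊗[ℂ] W)}
    (hu : IsProjectivelyBounded u r) (hu' : IsProjectivelyBounded u' r') (hs : 0 ≤ s)
    (c : Matrix (Fin n) (Fin m) ℂ) (c' : Matrix (Fin n) (Fin m') ℂ)
    (d : Matrix (Fin m) (Fin n) ℂ) (d' : Matrix (Fin m') (Fin n) ℂ)
    (hrow : ∀ (p q p' q' : ℕ) (a : Matrix (Fin m) (Fin p × Fin q) ℂ)
      (a' : Matrix (Fin m') (Fin p' × Fin q') ℂ), ‖a‖ ≤ √r → ‖a'‖ ≤ √r' →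
      ‖Matrix.fromCols (c * a) (c' * a')‖ ≤ √s)
    (hcol : ∀ (p q p' q' : ℕ) (b : Matrix (Fin p × Fin q) (Fin m) ℂ)
      (b' : Matrix (Fin p' × Fin q') (Fin m') ℂ), ‖b‖ ≤ √r → ‖b'‖ ≤ √r' →
      ‖Matrix.fromRows (b * d) (b' * d')‖ ≤ √s) :
    mnorm n (smulMatrix c u d + smulMatrix c' u' d') ≤ s := by
  obtain ⟨p, q, v, w, a, b, rfl, hv, hw, ha, hb⟩ := hu
  obtain ⟨p', q', v', w', a', b', rfl, hv', hw', ha', hb'⟩ := hu'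
  have hf := diagonalIndex_injective (Fin p) (Fin q) (Fin p') (Fin q')
  rw [smulMatrix_smulMatrix, smulMatrix_smulMatrix, smulMatrix_kronecker_add]
  refine (projective_le hV hW _ _ _ _).trans ?_
  have e1 : ‖Matrix.fromCols (c * a) (c' * a') * selectMatrix
      (diagonalIndex (Fin p) (Fin q) (Fin p') (Fin q'))‖ ≤ √s :=
    (Matrix.l2_opNorm_mul _ _).trans ((mul_le_mul (hrow _ _ _ _ a a' ha ha')
      (norm_selectMatrix_le hf) (norm_nonneg _) (Real.sqrt_nonneg _)).trans (mul_one _).le)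
  have e2 : ‖(selectMatrix (diagonalIndex (Fin p) (Fin q) (Fin p') (Fin q')))ᴴ *
      Matrix.fromRows (b * d) (b' * d')‖ ≤ √s :=
    (Matrix.l2_opNorm_mul _ _).trans ((mul_le_mul (norm_selectMatrix_conjTranspose_le hf)
      (hcol _ _ _ _ b b' hb hb') (norm_nonneg _) zero_le_one).trans (one_mul _).le)
  have e3 : matrixNormOn mnorm (Matrix.fromBlocks v 0 0 v') ≤ 1 :=
    (hV.matrixNormOn_fromBlocks_le v v').trans
      (max_le (by rwa [hV.matrixNormOn_fin]) (by rwa [hV.matrixNormOn_fin]))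
  have e4 : matrixNormOn mnorm (Matrix.fromBlocks w 0 0 w') ≤ 1 :=
    (hW.matrixNormOn_fromBlocks_le w w').trans
      (max_le (by rwa [hW.matrixNormOn_fin]) (by rwa [hW.matrixNormOn_fin]))
  have := hV.matrixNormOn_nonneg (Matrix.fromBlocks v 0 0 v')
  have := hW.matrixNormOn_nonneg (Matrix.fromBlocks w 0 0 w')
  calc _ ≤ √s * 1 * 1 * √s := by gcongr
    _ = s := by rw [mul_one, mul_one, Real.mul_self_sqrt hs]

theorem isProjectivelyBounded_of_lt {n : ℕ} {r : ℝ} {u : Matrix (Fin n) (Fin n) (V ⊗[ℂ] W)}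
    (hr : mnorm n u < r) : IsProjectivelyBounded u r := by
  obtain ⟨p, q, v, w, a, b, h⟩ := exists_decomposition u
  obtain ⟨_, ⟨p, q, v, w, a, b, rfl, rfl⟩, hlt⟩ := exists_lt_of_csInf_lt
    (by exact ⟨_, p, q, v, w, a, b, h, rfl⟩) hr
  exact isProjectivelyBounded_of_decomposition hV hW v w a b hlt

theorem isMatricialSeminorm_projective :
    IsMatricialSeminorm (mnorm (E := V ⊗[ℂ] W)) where
  add_le n u u' := by
    refine le_of_forall_pos_le_add fun ε hε => ?_
    have h0 := projective_nonneg hV hW n u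
    have h0' := projective_nonneg hV hW n u'
    have h1 := isProjectivelyBounded_of_lt hV hW (show mnorm n u < mnorm n u + ε / 2 by linarith)
    have h2 := isProjectivelyBounded_of_lt hV hW (show mnorm n u' < mnorm n u' + ε / 2 by linarith)
    have h3 := projective_add_le_of_bounded hV hW (n := n)
      (s := mnorm n u + ε / 2 + (mnorm n u' + ε / 2)) h1 h2 (by positivity) 1 1 1 1
      (fun p q p' q' a a' ha ha' => by
        rw [Matrix.one_mul, Matrix.one_mul]
        exact Matrix.l2_opNorm_fromCols_le _ _ (by positivity) (by positivity) ha ha')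
      (fun p q p' q' b b' hb hb' => by
        rw [Matrix.mul_one, Matrix.mul_one]
        exact Matrix.l2_opNorm_fromRows_le _ _ (by positivity) (by positivity) hb hb')
    rw [smulMatrix_one, smulMatrix_one] at h3
    linarith
  smulMatrix_le m n c u d := by
    refine le_of_forall_pos_le_add fun ε hε => ?_
    have h0 := projective_nonneg hV hW n u
    obtain ⟨δ, hδ, hle⟩ : ∃ δ : ℝ, 0 < δ ∧ ‖c‖ * (mnorm n u + δ) * ‖d‖ ≤
        ‖c‖ * mnorm n u * ‖d‖ + ε := by
      refine ⟨ε / (‖c‖ * ‖d‖ + 1), by positivity, ?_⟩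
      have : ‖c‖ * (mnorm n u + ε / (‖c‖ * ‖d‖ + 1)) * ‖d‖ =
          ‖c‖ * mnorm n u * ‖d‖ + ε * ((‖c‖ * ‖d‖) / (‖c‖ * ‖d‖ + 1)) := by ring
      rw [this]
      have h1 : (‖c‖ * ‖d‖) / (‖c‖ * ‖d‖ + 1) ≤ 1 := by
        rw [div_le_one (by positivity)]; linarith
      nlinarith
    obtain ⟨p, q, v, w, a, b, h, hv, hw, ha, hb⟩ :=
      isProjectivelyBounded_of_lt hV hW (show mnorm n u < mnorm n u + δ by linarith)
    refine le_trans ?_ hle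
    conv_lhs => rw [h]
    rw [smulMatrix_smulMatrix]
    refine (projective_le hV hW _ _ _ _).trans ?_
    rw [hV.matrixNormOn_fin, hW.matrixNormOn_fin]
    have := hV.nonneg p v
    have := hW.nonneg q w
    calc _ ≤ (‖c‖ * √(mnorm n u + δ)) * 1 * 1 * (√(mnorm n u + δ) * ‖d‖) := by
          gcongr
          · exact (Matrix.l2_opNorm_mul _ _).trans (by gcongr)
          · exact (Matrix.l2_opNorm_mul _ _).trans (by gcongr)
      _ = ‖c‖ * (√(mnorm n u + δ) * √(mnorm n u + δ)) * ‖d‖ := by ring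
      _ = _ := by rw [Real.mul_self_sqrt (by positivity)]
  directSum_le m n u u' := by
    refine le_of_forall_pos_le_add fun ε hε => ?_
    have h0 := projective_nonneg hV hW m u
    have h0' := projective_nonneg hV hW n u'
    set s := max (mnorm m u) (mnorm n u') + ε with hs
    have hs0 : 0 ≤ s := by positivity
    have h1 := isProjectivelyBounded_of_lt hV hW
      (show mnorm m u < s from (le_max_left _ _).trans_lt (by linarith))
    have h2 := isProjectivelyBounded_of_lt hV hW
      (show mnorm n u' < s from (le_max_right _ _).trans_lt (by linarith))
    have h3 := projective_add_le_of_bounded hV hW (n := m + n) h1 h2 hs0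
      (selectMatrix (Fin.castAdd n))ᴴ (selectMatrix (Fin.natAdd m))ᴴ
      (selectMatrix (Fin.castAdd n)) (selectMatrix (Fin.natAdd m))
      (fun p q p' q' a a' ha ha' => by
        rw [fromCols_select_castAdd_natAdd]
        exact (Matrix.l2_opNorm_submatrix_le _ finSumFinEquiv.symm.injective
          Function.injective_id).trans
          ((Matrix.l2_opNorm_fromBlocks_zero_le _ _).trans (max_le ha ha')))
      (fun p q p' q' b b' hb hb' => by
        rw [fromRows_select_castAdd_natAdd]
        exact (Matrix.l2_opNorm_submatrix_le _ Function.injective_id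
          finSumFinEquiv.symm.injective).trans
          ((Matrix.l2_opNorm_fromBlocks_zero_le _ _).trans (max_le hb hb')))
    rwa [← directSumMatrix_eq_add] at h3

end Projective

/-! ### Complete reducibility of unitary representations -/

section Reducibility

variable {A : Type u} [Ring A] [StarRing A] [HopfAlgebra ℂ A] [StarModule ℂ A]

theorem IsUnitaryRep.counit_apply {n : ℕ} {u : Matrix (Fin n) (Fin n) A} (hu : IsUnitaryRep u)
    (i j : Fin n) : Coalgebra.counit (R := ℂ) (u i j) = if i = j then 1 else 0 := by
  have h1 : (Matrix.of fun i j => algebraMap ℂ A (Coalgebra.counit (R := ℂ) (u i j))) * u = u := by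
    ext i j
    have h := Coalgebra.rTensor_counit_comul (R := ℂ) (u i j)
    rw [hu.comul] at h
    have h2 := congrArg (TensorProduct.lid ℂ A) h
    simpa [Matrix.mul_apply, Algebra.smul_def] using h2
  have h2 : (Matrix.of fun i j => algebraMap ℂ A (Coalgebra.counit (R := ℂ) (u i j))) = 1 := by
    rw [← hu.mul_star]
    conv_rhs => rw [← h1]
    rw [Matrix.mul_assoc, h1, hu.mul_star, Matrix.mul_one]
  have h3 := congrArg (Coalgebra.counit (R := ℂ)) (congrFun (congrFun h2 i) j)
  rw [Matrix.of_apply, Bialgebra.counit_algebraMap] at h3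
  rw [h3, Matrix.one_apply]
  split_ifs <;> simp

theorem IsUnitaryRep.antipode_apply {n : ℕ} {u : Matrix (Fin n) (Fin n) A} (hu : IsUnitaryRep u)
    (i j : Fin n) : HopfAlgebra.antipode ℂ (u i j) = star (u j i) := by
  have h1 : (Matrix.of fun i j => HopfAlgebra.antipode ℂ (u i j)) * u = 1 := by
    ext i j
    have h := HopfAlgebra.mul_antipode_rTensor_comul_apply (R := ℂ) (u i j)
    rw [hu.comul, hu.counit_apply] at h
    rw [Matrix.one_apply, Matrix.mul_apply]
    have h2 : algebraMap ℂ A (if i = j then 1 else 0) = if i = j then 1 else 0 := by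
      split_ifs <;> simp
    rw [← h2, ← h]
    simp
  have h2 : (Matrix.of fun i j => HopfAlgebra.antipode ℂ (u i j)) = uᴴ := by
    calc _ = (Matrix.of fun i j => HopfAlgebra.antipode ℂ (u i j)) * (u * uᴴ) := by
          rw [hu.mul_star, Matrix.mul_one]
      _ = uᴴ := by rw [← Matrix.mul_assoc, h1, Matrix.one_mul]
  exact congrFun (congrFun h2 i) j

/-- The coproduct of a representation as the matrix equation `Δ(u) = u₁₂ u₁₃`. -/
theorem comul_iff_map_comul {n : ℕ} (u : Matrix (Fin n) (Fin n) A) :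
    (∀ i j, Coalgebra.comul (R := ℂ) (u i j) = ∑ k, u i k ⊗ₜ[ℂ] u k j) ↔
    u.map (Bialgebra.comulAlgHom ℂ A) =
      u.map (Algebra.TensorProduct.includeLeft : A →ₐ[ℂ] A ⊗[ℂ] A) *
        u.map (Algebra.TensorProduct.includeRight : A →ₐ[ℂ] A ⊗[ℂ] A) := by
  rw [← Matrix.ext_iff]
  simp [Matrix.mul_apply]

theorem map_algebraMap_map {n m : ℕ} {B : Type*} [Ring B] [Algebra ℂ B] (φ : A →ₐ[ℂ] B)
    (T : Matrix (Fin n) (Fin m) ℂ) : (T.map (algebraMap ℂ A)).map φ = T.map (algebraMap ℂ B) := by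
  ext i j
  simp

/-- A unitary representation compresses to a unitary representation on the range of a projection
`V Vᴴ` that it commutes with. -/
theorem IsUnitaryRep.compress {n m : ℕ} {u : Matrix (Fin n) (Fin n) A} (hu : IsUnitaryRep u)
    {V : Matrix (Fin n) (Fin m) ℂ} (hV : Vᴴ * V = 1) (hP : Intertwines u u (V * Vᴴ)) :
    IsUnitaryRep (Vᴴ.map (algebraMap ℂ A) * u * V.map (algebraMap ℂ A)) := by
  have h1 : Vᴴ.map (algebraMap ℂ A) * V.map (algebraMap ℂ A) = 1 := by
    rw [← Matrix.map_mul, hV, Matrix.map_one _ (map_zero _) (map_one _)]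
  have hP' : u * (V.map (algebraMap ℂ A) * Vᴴ.map (algebraMap ℂ A)) =
      V.map (algebraMap ℂ A) * Vᴴ.map (algebraMap ℂ A) * u := by
    rw [← Matrix.map_mul]
    exact hP
  have hP'' : uᴴ * (V.map (algebraMap ℂ A) * Vᴴ.map (algebraMap ℂ A)) =
      V.map (algebraMap ℂ A) * Vᴴ.map (algebraMap ℂ A) * uᴴ := by
    have := congrArg Matrix.conjTranspose hP'
    simp only [Matrix.conjTranspose_mul, map_algebraMap_conjTranspose,
      Matrix.conjTranspose_conjTranspose] at this
    exact this.symm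
  have hs : (Vᴴ.map (algebraMap ℂ A) * u * V.map (algebraMap ℂ A))ᴴ =
      Vᴴ.map (algebraMap ℂ A) * uᴴ * V.map (algebraMap ℂ A) := by
    simp only [Matrix.conjTranspose_mul, map_algebraMap_conjTranspose,
      Matrix.conjTranspose_conjTranspose, Matrix.mul_assoc]
  refine ⟨?_, ?_, ?_⟩
  · rw [hs]
    calc _ = Vᴴ.map (algebraMap ℂ A) * (uᴴ * (V.map (algebraMap ℂ A) *
          Vᴴ.map (algebraMap ℂ A))) * u * V.map (algebraMap ℂ A) := by
          simp only [Matrix.mul_assoc]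
      _ = (Vᴴ.map (algebraMap ℂ A) * V.map (algebraMap ℂ A)) *
          (Vᴴ.map (algebraMap ℂ A) * (uᴴ * u) * V.map (algebraMap ℂ A)) := by
          rw [hP'']; simp only [Matrix.mul_assoc]
      _ = 1 := by rw [hu.star_mul, Matrix.mul_one, h1, Matrix.one_mul]
  · rw [hs]
    calc _ = Vᴴ.map (algebraMap ℂ A) * (u * (V.map (algebraMap ℂ A) *
          Vᴴ.map (algebraMap ℂ A))) * uᴴ * V.map (algebraMap ℂ A) := by
          simp only [Matrix.mul_assoc]
      _ = (Vᴴ.map (algebraMap ℂ A) * V.map (algebraMap ℂ A)) *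
          (Vᴴ.map (algebraMap ℂ A) * (u * uᴴ) * V.map (algebraMap ℂ A)) := by
          rw [hP']; simp only [Matrix.mul_assoc]
      _ = 1 := by rw [hu.mul_star, Matrix.mul_one, h1, Matrix.one_mul]
  · rw [comul_iff_map_comul]
    have hc := (comul_iff_map_comul u).1 hu.comul
    have hL := congrArg
      (fun M : Matrix (Fin n) (Fin n) A =>
        M.map (Algebra.TensorProduct.includeLeft : A →ₐ[ℂ] A ⊗[ℂ] A)) hP'
    simp only [Matrix.map_mul, map_algebraMap_map] at hL ⊢
    have h1' : Vᴴ.map (algebraMap ℂ (A ⊗[ℂ] A)) * V.map (algebraMap ℂ (A ⊗[ℂ] A)) = 1 := by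
      rw [← Matrix.map_mul, hV, Matrix.map_one _ (map_zero _) (map_one _)]
    rw [hc]
    set L := u.map (Algebra.TensorProduct.includeLeft : A →ₐ[ℂ] A ⊗[ℂ] A)
    set R := u.map (Algebra.TensorProduct.includeRight : A →ₐ[ℂ] A ⊗[ℂ] A)
    symm
    calc _ = Vᴴ.map (algebraMap ℂ (A ⊗[ℂ] A)) * (L * (V.map (algebraMap ℂ (A ⊗[ℂ] A)) *
          Vᴴ.map (algebraMap ℂ (A ⊗[ℂ] A)))) * R * V.map (algebraMap ℂ (A ⊗[ℂ] A)) := by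
          simp only [Matrix.mul_assoc]
      _ = (Vᴴ.map (algebraMap ℂ (A ⊗[ℂ] A)) * V.map (algebraMap ℂ (A ⊗[ℂ] A))) *
          (Vᴴ.map (algebraMap ℂ (A ⊗[ℂ] A)) * (L * R) * V.map (algebraMap ℂ (A ⊗[ℂ] A))) := by
          rw [hL]; simp only [Matrix.mul_assoc]
      _ = _ := by rw [h1', Matrix.one_mul]

theorem Intertwines.add {n m : ℕ} {u : Matrix (Fin n) (Fin n) A} {v : Matrix (Fin m) (Fin m) A}
    {T S : Matrix (Fin n) (Fin m) ℂ} (h : Intertwines u v T) (h' : Intertwines u v S) :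
    Intertwines u v (T + S) := by
  unfold Intertwines at *
  rw [Matrix.map_add _ (map_add _), Matrix.mul_add, Matrix.add_mul, h, h']

/-- A self-intertwiner commutes with its spectral projections. -/
theorem Intertwines.spectral_projection {n : ℕ} {u : Matrix (Fin n) (Fin n) A}
    {W : Matrix (Fin n) (Fin n) ℂ} (hW : Wᴴ * W = 1) {d : Fin n → ℂ}
    (h : Intertwines u u (W * Matrix.diagonal d * Wᴴ)) (p : Fin n → Prop) [DecidablePred p]
    (hp : ∀ i j, d i = d j → (p i ↔ p j)) :
    Intertwines u u (W * Matrix.diagonal (fun i => if p i then 1 else 0) * Wᴴ) := by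
  have hW' : W * Wᴴ = 1 := mul_eq_one_comm.1 hW
  have h1 : Wᴴ.map (algebraMap ℂ A) * W.map (algebraMap ℂ A) = 1 := by
    rw [← Matrix.map_mul, hW, Matrix.map_one _ (map_zero _) (map_one _)]
  have h2 : W.map (algebraMap ℂ A) * Wᴴ.map (algebraMap ℂ A) = 1 := by
    rw [← Matrix.map_mul, hW', Matrix.map_one _ (map_zero _) (map_one _)]
  set w := W.map (algebraMap ℂ A)
  set w' := Wᴴ.map (algebraMap ℂ A)
  set u' := w' * u * w with hu'
  have key : ∀ e : Fin n → ℂ, Intertwines u u (W * Matrix.diagonal e * Wᴴ) ↔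
      ∀ i j, (e i - e j) • u' i j = 0 := by
    intro e
    have hd : (Matrix.diagonal e).map (algebraMap ℂ A) =
        Matrix.diagonal fun i => algebraMap ℂ A (e i) := Matrix.diagonal_map (map_zero _)
    unfold Intertwines
    rw [Matrix.map_mul, Matrix.map_mul, hd]
    have h3 : u * (w * (Matrix.diagonal fun i => algebraMap ℂ A (e i)) * w') =
        w * (Matrix.diagonal fun i => algebraMap ℂ A (e i)) * w' * u ↔
        u' * (Matrix.diagonal fun i => algebraMap ℂ A (e i)) =
        (Matrix.diagonal fun i => algebraMap ℂ A (e i)) * u' := by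
      constructor
      · intro h
        have := congrArg (fun M => w' * M * w) h
        calc _ = w' * (u * (w * (Matrix.diagonal fun i => algebraMap ℂ A (e i)) * w')) * w := by
              rw [hu']; simp only [Matrix.mul_assoc, h1, Matrix.mul_one]
          _ = (w' * w) * (Matrix.diagonal fun i => algebraMap ℂ A (e i)) * u' := by
              rw [this, hu']; simp only [Matrix.mul_assoc]
          _ = _ := by rw [h1, Matrix.one_mul]
      · intro h
        calc _ = w * w' * u * (w * (Matrix.diagonal fun i => algebraMap ℂ A (e i)) * w') := by
              rw [h2, Matrix.one_mul]
          _ = w * (u' * (Matrix.diagonal fun i => algebraMap ℂ A (e i))) * w' := by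
              rw [hu']; simp only [Matrix.mul_assoc]
          _ = w * (Matrix.diagonal fun i => algebraMap ℂ A (e i)) * w' * u * (w * w') := by
              rw [h, hu']; simp only [Matrix.mul_assoc]
          _ = _ := by rw [h2, Matrix.mul_one]
    rw [h3, ← Matrix.ext_iff]
    refine forall_congr' fun i => forall_congr' fun j => ?_
    rw [Matrix.mul_diagonal, Matrix.diagonal_mul, ← Algebra.commutes, ← Algebra.smul_def,
      ← Algebra.smul_def, sub_smul, sub_eq_zero, eq_comm]
  -- In the eigenbasis, commuting with `diagonal e` means vanishing between different values of `e`.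
  rw [key] at h ⊢
  intro i j
  by_cases hij : d i = d j
  · simp [hp i j hij]
  · rw [(smul_eq_zero.1 (h i j)).resolve_left (sub_ne_zero.2 hij), smul_zero]

/-- A unitary representation with a nonscalar self-intertwiner is a direct sum of two smaller
ones. -/
theorem IsUnitaryRep.exists_splitting {n : ℕ} {u : Matrix (Fin n) (Fin n) A}
    (hu : IsUnitaryRep u) {T : Matrix (Fin n) (Fin n) ℂ} (hT : Intertwines u u T)
    (hns : ¬ ∃ c : ℂ, T = c • 1) :
    ∃ (m m' : ℕ) (V : Matrix (Fin n) (Fin m) ℂ) (V' : Matrix (Fin n) (Fin m') ℂ),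
      m < n ∧ m' < n ∧ Vᴴ * V = 1 ∧ V'ᴴ * V' = 1 ∧ V * Vᴴ + V' * V'ᴴ = 1 ∧
      Intertwines u u (V * Vᴴ) ∧ Intertwines u u (V' * V'ᴴ) := by
  classical
  -- The real and imaginary parts of `T` are intertwiners as well, and they are not both scalar.
  obtain ⟨H, hH, hHu, hHs⟩ : ∃ H : Matrix (Fin n) (Fin n) ℂ, H.IsHermitian ∧
      Intertwines u u H ∧ ¬ ∃ c : ℂ, H = c • 1 := by
    by_contra! hcon
    obtain ⟨c, hc⟩ := hcon (T + Tᴴ) (Matrix.isHermitian_add_transpose_self T)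
      (hT.add (hT.adjoint hu hu))
    obtain ⟨d, hd⟩ := hcon (Complex.I • T + (Complex.I • T)ᴴ)
      (Matrix.isHermitian_add_transpose_self _) ((hT.smul _).add ((hT.smul _).adjoint hu hu))
    refine hns ⟨(c - Complex.I * d) / 2, ?_⟩
    have h1 : (2 : ℂ) • T = (T + Tᴴ) + (-Complex.I) • (Complex.I • T + (Complex.I • T)ᴴ) := by
      rw [Matrix.conjTranspose_smul, smul_add, smul_smul, smul_smul]
      simp only [two_smul, Complex.star_def, Complex.conj_I, neg_mul, mul_neg, Complex.I_mul_I,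
        neg_neg, one_smul, neg_smul]
      abel
    rw [hc, hd, smul_smul, ← add_smul] at h1
    have h2 : T = (2 : ℂ)⁻¹ • ((2 : ℂ) • T) := by rw [smul_smul]; simp
    rw [h2, h1, smul_smul]
    congr 1
    ring
  set W : Matrix (Fin n) (Fin n) ℂ := hH.eigenvectorUnitary.1
  have hW : Wᴴ * W = 1 := Unitary.coe_star_mul_self hH.eigenvectorUnitary
  have hW' : W * Wᴴ = 1 := Unitary.coe_mul_star_self hH.eigenvectorUnitary
  set d : Fin n → ℂ := fun i => (hH.eigenvalues i : ℂ) with hd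
  have hspec : H = W * Matrix.diagonal d * Wᴴ := by
    have := hH.spectral_theorem
    rw [Unitary.conjStarAlgAut_apply] at this
    exact this
  obtain ⟨i₀, j₀, hne⟩ : ∃ i j, d i ≠ d j := by
    by_contra! hcon
    apply hHs
    rcases isEmpty_or_nonempty (Fin n) with he | ⟨⟨i⟩⟩
    · exact ⟨0, by ext i; exact he.elim i⟩
    · refine ⟨d i, ?_⟩
      have : Matrix.diagonal d = d i • 1 := by
        ext j k
        by_cases hjk : j = k
        · subst hjk; simp [hcon j i]
        · simp [hjk]
      rw [hspec, this, Matrix.mul_smul, Matrix.mul_one, Matrix.smul_mul, hW']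
  rw [hspec] at hHu
  -- The eigenvectors selected by `p` form an isometry onto the range of a spectral projection.
  have hgen : ∀ p : Fin n → Prop, (∀ i j, d i = d j → (p i ↔ p j)) → (∃ i, ¬ p i) →
      ∃ (m : ℕ) (V : Matrix (Fin n) (Fin m) ℂ), m < n ∧ Vᴴ * V = 1 ∧
        V * Vᴴ = W * Matrix.diagonal (fun i => if p i then 1 else 0) * Wᴴ ∧
        Intertwines u u (V * Vᴴ) := by
    intro p hp ⟨k, hk⟩
    let e := (Fintype.equivFin {i // p i}).symm
    have hV : (W.submatrix id fun i => (e i : Fin n)) * (W.submatrix id fun i => (e i : Fin n))ᴴ =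
        W * Matrix.diagonal (fun i => if p i then 1 else 0) * Wᴴ := by
      ext i j
      rw [Matrix.mul_apply, Matrix.mul_apply]
      simp only [Matrix.submatrix_apply, Matrix.conjTranspose_apply, id, Matrix.mul_diagonal]
      rw [e.sum_comp fun k : {i // p i} => W i k * star (W j k),
        ← Finset.sum_subtype (Finset.univ.filter p) (fun x => by simp)
          (fun k => W i k * star (W j k)), Finset.sum_filter]
      exact Finset.sum_congr rfl fun x _ => by split_ifs <;> simp
    refine ⟨_, W.submatrix id fun i => (e i : Fin n), ?_, ?_, hV, ?_⟩
    · simpa using Fintype.card_subtype_lt (p := p) hk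
    · have h1 : (W.submatrix id fun i => (e i : Fin n))ᴴ * W.submatrix id (fun i => (e i : Fin n)) =
          (Wᴴ * W).submatrix (fun i => (e i : Fin n)) fun i => (e i : Fin n) := by
        ext i j
        simp [Matrix.mul_apply]
      rw [h1, hW]
      exact Matrix.submatrix_one _ (Subtype.val_injective.comp e.injective)
    · rw [hV]
      exact hHu.spectral_projection hW p hp
  obtain ⟨m, V, hm, hV1, hV2, hV3⟩ := hgen (fun i => d i = d i₀) (fun i j h => by rw [h])
    ⟨j₀, fun h => hne h.symm⟩
  obtain ⟨m', V', hm', hV1', hV2', hV3'⟩ := hgen (fun i => ¬ d i = d i₀) (fun i j h => by rw [h])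
    ⟨i₀, fun h => h rfl⟩
  refine ⟨m, m', V, V', hm, hm', hV1, hV1', ?_, hV3, hV3'⟩
  rw [hV2, hV2', ← Matrix.add_mul, ← Matrix.mul_add, Matrix.diagonal_add]
  have hone : ∀ f : Fin n → ℂ, (∀ i, f i = 1) → W * Matrix.diagonal f * Wᴴ = 1 := fun f hf => by
    rw [funext hf, Matrix.diagonal_one, Matrix.mul_one, hW']
  refine hone _ fun i => ?_
  by_cases h : d i = d i₀ <;> simp [h]

theorem mul_mul_apply_mem {n m : ℕ} (S : Submodule ℂ A) {v : Matrix (Fin m) (Fin m) A}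
    (hv : ∀ i j, v i j ∈ S) (T : Matrix (Fin n) (Fin m) ℂ) (T' : Matrix (Fin m) (Fin n) ℂ)
    (i j : Fin n) : (T.map (algebraMap ℂ A) * v * T'.map (algebraMap ℂ A)) i j ∈ S := by
  simp only [Matrix.mul_apply, Matrix.map_apply, Finset.sum_mul]
  refine S.sum_mem fun k _ => S.sum_mem fun l _ => ?_
  rw [← Algebra.commutes, ← Algebra.smul_def, ← Algebra.smul_def]
  exact S.smul_mem _ (S.smul_mem _ (hv _ _))

/-- Coefficients of unitary representations are combinations of coefficients of the chosen
irreducible ones: a representation that is not irreducible splits into smaller ones. -/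
theorem IsUnitaryRep.apply_mem_span (G : CompactQuantumGroup.{u, v} A) (n : ℕ)
    (u : Matrix (Fin n) (Fin n) A) (hu : IsUnitaryRep u) (i j : Fin n) :
    u i j ∈ Submodule.span ℂ {x | ∃ (α : G.Irr) (i j : Fin (G.dim α)), x = G.rep α i j} := by
  induction n using Nat.strong_induction_on with
  | _ n ih =>
    set S := Submodule.span ℂ {x | ∃ (α : G.Irr) (i j : Fin (G.dim α)), x = G.rep α i j} with hS
    by_cases hirr : ∀ T : Matrix (Fin n) (Fin n) ℂ, Intertwines u u T → ∃ c : ℂ, T = c • 1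
    · obtain ⟨α, T, hT1, -, hT⟩ := G.exists_equivalent n u hu ⟨i.pos, hirr⟩
      have h1 : u = Tᴴ.map (algebraMap ℂ A) * G.rep α * T.map (algebraMap ℂ A) := by
        rw [Matrix.mul_assoc, hT, ← Matrix.mul_assoc, ← Matrix.map_mul, hT1,
          Matrix.map_one _ (map_zero _) (map_one _), Matrix.one_mul]
      rw [h1]
      exact mul_mul_apply_mem S (fun k l => Submodule.subset_span ⟨α, k, l, rfl⟩) _ _ i j
    · push Not at hirr
      obtain ⟨T, hT, hns⟩ := hirr
      obtain ⟨m, m', V, V', hm, hm', hV, hV', hsum, hP, hP'⟩ :=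
        hu.exists_splitting hT (by push Not; exact hns)
      have hpart : ∀ {m : ℕ} {V : Matrix (Fin n) (Fin m) ℂ}, m < n → Vᴴ * V = 1 →
          Intertwines u u (V * Vᴴ) → (u * (V * Vᴴ).map (algebraMap ℂ A)) i j ∈ S := by
        intro m V hm hV hP
        have h1 : u * (V * Vᴴ).map (algebraMap ℂ A) = V.map (algebraMap ℂ A) *
            (Vᴴ.map (algebraMap ℂ A) * u * V.map (algebraMap ℂ A)) * Vᴴ.map (algebraMap ℂ A) := by
          have h2 : V * Vᴴ = V * Vᴴ * (V * Vᴴ) := by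
            rw [Matrix.mul_assoc, ← Matrix.mul_assoc Vᴴ, hV, Matrix.one_mul]
          conv_lhs => rw [h2, Matrix.map_mul, ← Matrix.mul_assoc, hP]
          simp only [Matrix.map_mul, Matrix.mul_assoc]
        rw [h1]
        exact mul_mul_apply_mem S (ih m hm _ (hu.compress hV hP)) _ _ i j
      have h3 : u = u * (V * Vᴴ).map (algebraMap ℂ A) + u * (V' * V'ᴴ).map (algebraMap ℂ A) := by
        rw [← Matrix.mul_add, ← Matrix.map_add _ (map_add _), hsum,
          Matrix.map_one _ (map_zero _) (map_one _), Matrix.mul_one]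
      rw [h3]
      exact S.add_mem (hpart hm hV hP) (hpart hm' hV' hP')

theorem span_rep_eq_top (G : CompactQuantumGroup.{u, v} A) :
    Submodule.span ℂ {x | ∃ (α : G.Irr) (i j : Fin (G.dim α)), x = G.rep α i j} = ⊤ := by
  rw [eq_top_iff, ← G.span_coeff, Submodule.span_le]
  rintro _ ⟨n, u, hu, i, j, rfl⟩
  exact hu.apply_mem_span G n u i j

end Reducibility

/-! ### Orthogonality relations and the twisted convolution of coefficients -/

namespace CompactQuantumGroup

variable {A : Type u} [Ring A] [StarRing A] [HopfAlgebra ℂ A] [StarModule ℂ A]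
  (G : CompactQuantumGroup.{u, v} A)

theorem dim_ne_zero (α : G.Irr) : (G.dim α : ℂ) ≠ 0 :=
  Nat.cast_ne_zero.2 (G.isIrreducibleRep α).1.ne'

theorem span_induction {p : A → Prop} (hrep : ∀ α i j, p (G.rep α i j)) (h0 : p 0)
    (hadd : ∀ x y, p x → p y → p (x + y)) (hsmul : ∀ (c : ℂ) x, p x → p (c • x)) (x : A) : p x := by
  have hx : x ∈ Submodule.span ℂ {x | ∃ (α : G.Irr) (i j : Fin (G.dim α)), x = G.rep α i j} := by
    rw [span_rep_eq_top]; trivial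
  induction hx using Submodule.span_induction with
  | mem x hx => obtain ⟨α, i, j, rfl⟩ := hx; exact hrep α i j
  | zero => exact h0
  | add x y _ _ hx hy => exact hadd x y hx hy
  | smul c x _ hx => exact hsmul c x hx

theorem linearMap_ext {M : Type*} [AddCommGroup M] [Module ℂ M] {f g : A →ₗ[ℂ] M}
    (h : ∀ α i j, f (G.rep α i j) = g (G.rep α i j)) : f = g := by
  refine LinearMap.ext (G.span_induction h (by simp) (fun x y hx hy => ?_) fun c x hx => ?_)
  · rw [map_add, map_add, hx, hy]
  · rw [map_smul, map_smul, hx]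

theorem comul_star_rep (α : G.Irr) (i j : Fin (G.dim α)) :
    Coalgebra.comul (R := ℂ) (star (G.rep α i j)) =
      ∑ k, star (G.rep α i k) ⊗ₜ[ℂ] star (G.rep α k j) := by
  rw [G.comul_star, (G.isUnitaryRep α).comul, star_sum]
  simp [TensorProduct.star_tmul]

theorem haar_star_rep_mul_of_ne {α β : G.Irr} (h : α ≠ β) (i j : Fin (G.dim α))
    (k l : Fin (G.dim β)) : G.haar (star (G.rep α i j) * G.rep β k l) = 0 := by
  have h1 := haar_intertwines G (G.isUnitaryRep α) (G.isUnitaryRep β) i k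
  have h2 := (h1.eq_zero_or_equivalent (G.isUnitaryRep α) (G.isUnitaryRep β)
    (G.isIrreducibleRep α) (G.isIrreducibleRep β)).resolve_right
      fun he => h (G.eq_of_equivalent _ _ he)
  exact congrFun (congrFun h2 j) l

variable {G}

/-- The Schur orthogonality relations of a compact quantum group of Kac type. Traciality of the
Haar state makes the matrix of the intertwiner constants itself an intertwiner. -/
theorem IsKac.haar_star_rep_mul (hG : G.IsKac) (α : G.Irr) (i j k l : Fin (G.dim α)) :
    G.haar (star (G.rep α i j) * G.rep α k l) =
      if i = k then (if j = l then (G.dim α : ℂ)⁻¹ else 0) else 0 := by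
  have hu := G.isUnitaryRep α
  have h1 : ∀ i k, ∃ c : ℂ, ∀ j l,
      G.haar (star (G.rep α i j) * G.rep α k l) = if j = l then c else 0 := by
    intro i k
    obtain ⟨c, hc⟩ := (G.isIrreducibleRep α).2 _ (haar_intertwines G hu hu i k)
    refine ⟨c, fun j l => ?_⟩
    have := congrFun (congrFun hc j) l
    simpa [Matrix.one_apply] using this
  choose c hc using h1
  -- Invariance of `h`, applied to the products `u_{kj} u_{ij}^*`.
  have h2 : G.rep α * (Matrix.of fun a b => c b a).map (algebraMap ℂ A) * (G.rep α)ᴴ =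
      (Matrix.of fun a b => c b a).map (algebraMap ℂ A) := by
    ext k i
    have h3 := G.isHaarState.right_inv (G.rep α k j * star (G.rep α i j))
    rw [Bialgebra.comul_mul, hu.comul, G.comul_star_rep, Finset.sum_mul_sum, hG, hc] at h3
    simp only [Algebra.TensorProduct.tmul_mul_tmul, map_sum, LinearMap.lTensor_tmul,
      TensorProduct.rid_tmul, if_true] at h3
    simp only [Matrix.mul_apply, Matrix.map_apply, Matrix.of_apply, Matrix.conjTranspose_apply,
      Algebra.algebraMap_eq_smul_one, ← h3, Finset.sum_mul]
    rw [Finset.sum_comm]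
    refine Finset.sum_congr rfl fun a _ => Finset.sum_congr rfl fun b _ => ?_
    rw [hG, hc, if_pos rfl, mul_smul_comm, mul_one, smul_mul_assoc]
  have h4 : Intertwines (G.rep α) (G.rep α) (Matrix.of fun a b => c b a) := by
    unfold Intertwines
    conv_rhs => rw [← h2]
    rw [Matrix.mul_assoc, Matrix.mul_assoc, hu.star_mul, Matrix.mul_one]
  obtain ⟨d, hd⟩ := (G.isIrreducibleRep α).2 _ h4
  have hcd : ∀ i k, c i k = if i = k then d else 0 := by
    intro i k
    have := congrFun (congrFun hd k) i
    simpa [Matrix.one_apply, eq_comm] using this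
  have hsum : (G.dim α : ℂ) * d = 1 := by
    have h5 := congrFun (congrFun hu.star_mul j) j
    rw [Matrix.mul_apply, Matrix.one_apply_eq] at h5
    have h6 := congrArg G.haar h5
    simpa [hc, hcd, G.isHaarState.map_one] using h6
  rw [hc, hcd, eq_inv_of_mul_eq_one_right hsum]
  split_ifs <;> rfl

/-- For Kac type the entrywise adjoint of an irreducible unitary representation is unitary. The two
unitarity relations are the invariance of the Haar state, applied to `u_{os} u_{ot}^*` and
`u_{io}^* u_{ko}` for a fixed index `o` and evaluated by the orthogonality relations. -/
theorem IsKac.isUnitaryRep_conj (hG : G.IsKac) (α : G.Irr) :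
    IsUnitaryRep ((G.rep α).map star) := by
  have hu := G.isUnitaryRep α
  have hn := G.dim_ne_zero α
  set o : Fin (G.dim α) := ⟨0, (G.isIrreducibleRep α).1⟩
  refine ⟨?_, ?_, ?_⟩
  · ext s t
    have h1 := G.isHaarState.left_inv (G.rep α o s * star (G.rep α o t))
    rw [Bialgebra.comul_mul, hu.comul, G.comul_star_rep, Finset.sum_mul_sum, hG,
      hG.haar_star_rep_mul] at h1
    simp only [Algebra.TensorProduct.tmul_mul_tmul, map_sum, LinearMap.rTensor_tmul,
      TensorProduct.lid_tmul, hG (G.rep α _ _), hG.haar_star_rep_mul, if_true, ite_smul,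
      zero_smul, Finset.sum_ite_eq', Finset.mem_univ] at h1
    rw [← Finset.smul_sum] at h1
    simp only [Matrix.mul_apply, Matrix.conjTranspose_apply, Matrix.map_apply, star_star,
      Matrix.one_apply]
    have h2 := congrArg (fun x => (G.dim α : ℂ) • x) h1
    simp only [smul_smul, mul_inv_cancel₀ hn, one_smul, smul_ite, smul_zero] at h2
    rw [h2]
    by_cases hst : s = t
    · subst hst; simp
    · simp [hst, Ne.symm hst]
  · ext i k
    have h1 := G.isHaarState.right_inv (star (G.rep α i o) * G.rep α k o)
    rw [Bialgebra.comul_mul, hu.comul, G.comul_star_rep, Finset.sum_mul_sum,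
      hG.haar_star_rep_mul] at h1
    simp only [Algebra.TensorProduct.tmul_mul_tmul, map_sum, LinearMap.lTensor_tmul,
      TensorProduct.rid_tmul, hG.haar_star_rep_mul, if_true, ite_smul,
      zero_smul, Finset.sum_ite_eq, Finset.mem_univ] at h1
    rw [← Finset.smul_sum] at h1
    simp only [Matrix.mul_apply, Matrix.conjTranspose_apply, Matrix.map_apply, star_star,
      Matrix.one_apply]
    have h2 := congrArg (fun x => (G.dim α : ℂ) • x) h1
    simp only [smul_smul, mul_inv_cancel₀ hn, one_smul, smul_ite, smul_zero] at h2
    rw [h2]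
  · intro i j
    simpa using G.comul_star_rep α i j

theorem IsKac.antipode_star_rep (hG : G.IsKac) (α : G.Irr) (i j : Fin (G.dim α)) :
    HopfAlgebra.antipode ℂ (star (G.rep α i j)) = G.rep α j i := by
  have := (hG.isUnitaryRep_conj α).antipode_apply i j
  simpa using this

/-- `Φ(a ⊗ (u^β_{kl})^*) = ∑ₘ h((u^β_{ml})^* a) u^β_{mk}`, because `S((u^β_{kl})^*) = u^β_{lk}`. -/
theorem IsKac.twistedConv_apply (hG : G.IsKac) (a : A) (β : G.Irr) (k l : Fin (G.dim β)) :
    G.twistedConv (a ⊗ₜ star (G.rep β k l)) =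
      ∑ m, G.haar (star (G.rep β m l) * a) • G.rep β m k := by
  have h : G.twistedConv (a ⊗ₜ star (G.rep β k l)) =
      TensorProduct.lid ℂ A ((G.haar ∘ₗ LinearMap.mulRight ℂ a ∘ₗ
      HopfAlgebra.antipode ℂ (A := A)).rTensor A
        (Coalgebra.comul (HopfAlgebra.antipode ℂ (star (G.rep β k l))))) := by
    simp only [twistedConv, TensorProduct.lift.tmul, LinearMap.compl₂_apply, conv,
      LinearMap.mk₂_apply]
  rw [h, hG.antipode_star_rep, (G.isUnitaryRep β).comul]
  simp [(G.isUnitaryRep β).antipode_apply]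

theorem IsKac.twistedConv_rep (hG : G.IsKac) (α : G.Irr) (i j k l : Fin (G.dim α)) :
    G.twistedConv (G.rep α i j ⊗ₜ star (G.rep α k l)) =
      if j = l then (G.dim α : ℂ)⁻¹ • G.rep α i k else 0 := by
  rw [hG.twistedConv_apply]
  simp only [hG.haar_star_rep_mul, ite_smul, zero_smul, Finset.sum_ite_eq', Finset.mem_univ,
    if_true]
  simp only [eq_comm]

theorem IsKac.twistedConv_rep_of_ne (hG : G.IsKac) {α β : G.Irr} (h : α ≠ β)
    (i j : Fin (G.dim α)) (k l : Fin (G.dim β)) :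
    G.twistedConv (G.rep α i j ⊗ₜ star (G.rep β k l)) = 0 := by
  rw [hG.twistedConv_apply]
  simp [G.haar_star_rep_mul_of_ne h.symm]

end CompactQuantumGroup

/-! ### The duality between the Fourier algebra and the dual von Neumann algebra -/

namespace CompactQuantumGroup

variable {A : Type u} [Ring A] [StarRing A] [HopfAlgebra ℂ A] [StarModule ℂ A]
  {G : CompactQuantumGroup.{u, v} A}

section Norms

theorem summable_norm_component (ω : G.FourierAlgebra) :
    Summable fun α => ‖G.component ω α‖ := by
  have := (lp.memℓp (p := 1) ω).summable (by simp)
  simp only [ENNReal.toReal_one, Real.rpow_one] at this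
  exact this

theorem norm_eq_tsum (ω : G.FourierAlgebra) : ‖ω‖ = ∑' α, ‖G.component ω α‖ := by
  have := lp.norm_eq_tsum_rpow (p := 1) (by simp)
    (show lp (fun α => G.Block α →L[ℂ] ℂ) 1 from ω)
  simp only [ENNReal.toReal_one, Real.rpow_one, div_one] at this
  exact this

theorem norm_component_apply_le (ω : G.FourierAlgebra) (X : G.LInfty) (α : G.Irr) :
    ‖G.component ω α (X α)‖ ≤ ‖G.component ω α‖ * ‖X‖ :=
  (ContinuousLinearMap.le_opNorm _ _).trans
    (by gcongr; exact lp.norm_apply_le_norm (by simp) X α)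

theorem summable_pair (ω : G.FourierAlgebra) (X : G.LInfty) :
    Summable fun α => G.component ω α (X α) :=
  ((summable_norm_component ω).mul_right ‖X‖).of_norm_bounded (norm_component_apply_le ω X)

theorem norm_pair_le (ω : G.FourierAlgebra) (X : G.LInfty) : ‖G.pair ω X‖ ≤ ‖ω‖ * ‖X‖ := by
  rw [norm_eq_tsum, ← tsum_mul_right]
  exact tsum_of_norm_bounded ((summable_norm_component ω).mul_right ‖X‖).hasSum
    (norm_component_apply_le ω X)

variable (G) in
/-- The duality pairing as a continuous bilinear map. -/
noncomputable def pairing : G.FourierAlgebra →L[ℂ] G.LInfty →L[ℂ] ℂ :=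
  LinearMap.mkContinuous₂
    (LinearMap.mk₂ ℂ G.pair
      (fun ω φ X => (summable_pair ω X).tsum_add (summable_pair φ X))
      (fun _ _ _ => tsum_mul_left)
      (fun ω X Y => by
        unfold pair
        rw [← (summable_pair ω X).tsum_add (summable_pair ω Y)]
        exact tsum_congr fun α => map_add _ _ _)
      (fun c ω X => by
        unfold pair
        rw [smul_eq_mul, ← tsum_mul_left]
        exact tsum_congr fun α => map_smul (G.component ω α) c (X α)))
    1 fun ω X => by rw [one_mul]; exact norm_pair_le ω X

theorem pairing_apply (ω : G.FourierAlgebra) (X : G.LInfty) : G.pairing ω X = G.pair ω X := rfl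

/-- The component in `M_ι ⊗ M_{n_α}` of a matrix over `ℓ^∞(𝔾̂)`. -/
def block {ι : Type*} (X : Matrix ι ι G.LInfty) (α : G.Irr) :
    Matrix (ι × Fin (G.dim α)) (ι × Fin (G.dim α)) ℂ :=
  Matrix.of fun s t => X s.1 t.1 α s.2 t.2

variable {ι κ : Type*} [Fintype ι] [DecidableEq ι] [Fintype κ] [DecidableEq κ]

theorem norm_single_le (i : ι) (j : κ) : ‖Matrix.single i j (1 : ℂ)‖ ≤ 1 := by
  have h : Matrix.single i j (1 : ℂ) =
      (selectMatrix fun _ : Unit => i)ᴴ * selectMatrix fun _ : Unit => j := by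
    ext k l
    simp only [selectMatrix, Matrix.mul_apply, Matrix.one_apply, Matrix.single_apply, ite_and,
      Matrix.conjTranspose_apply, Matrix.submatrix_apply, id]
    split_ifs <;> simp
  rw [h]
  exact (Matrix.l2_opNorm_mul _ _).trans (mul_le_one₀ (norm_selectMatrix_conjTranspose_le
    (Function.injective_of_subsingleton _)) (norm_nonneg _)
    (norm_selectMatrix_le (Function.injective_of_subsingleton _)))

theorem norm_block_le_sum (X : Matrix ι ι G.LInfty) (α : G.Irr) :
    ‖block X α‖ ≤ ∑ s, ∑ t, ‖X s t‖ := by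
  have h : block X α = ∑ s, ∑ t, Matrix.single s t (1 : ℂ) ⊗ₖ (X s t α) := by
    ext i j
    simp only [block, Matrix.sum_apply, Matrix.kroneckerMap_apply, Matrix.of_apply,
      Matrix.single_apply]
    rw [Finset.sum_eq_single i.1 (fun s _ hs => by simp [hs]) (by simp),
      Finset.sum_eq_single j.1 (fun s _ hs => by simp [hs]) (by simp)]
    simp
  rw [h]
  refine (norm_sum_le _ _).trans (Finset.sum_le_sum fun s _ => ?_)
  refine (norm_sum_le _ _).trans (Finset.sum_le_sum fun t _ => ?_)
  calc _ ≤ ‖Matrix.single s t (1 : ℂ)‖ * ‖X s t α‖ := Matrix.l2_opNorm_kronecker_le _ _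
    _ ≤ 1 * ‖X s t‖ := by
        gcongr
        · exact norm_single_le s t
        · exact lp.norm_apply_le_norm (by simp) _ α
    _ = _ := one_mul _

/-- The norm of a matrix over `ℓ^∞(𝔾̂)` with arbitrary finite index set. -/
noncomputable def linftyNorm (X : Matrix ι ι G.LInfty) : ℝ := ⨆ α, ‖block X α‖

theorem mnorm_eq_linftyNorm {n : ℕ} (X : Matrix (Fin n) (Fin n) G.LInfty) :
    mnorm n X = linftyNorm X := rfl

theorem norm_block_le (X : Matrix ι ι G.LInfty) (α : G.Irr) : ‖block X α‖ ≤ linftyNorm X :=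
  le_ciSup (f := fun α => ‖block X α‖)
    ⟨_, by rintro _ ⟨α, rfl⟩; exact norm_block_le_sum X α⟩ α

theorem linftyNorm_le {X : Matrix ι ι G.LInfty} {C : ℝ} (hC : 0 ≤ C)
    (h : ∀ α, ‖block X α‖ ≤ C) : linftyNorm X ≤ C :=
  Real.iSup_le h hC

theorem linftyNorm_nonneg (X : Matrix ι ι G.LInfty) : 0 ≤ linftyNorm X :=
  Real.iSup_nonneg fun _ => norm_nonneg _

theorem block_smulMatrix (a : Matrix κ ι ℂ) (X : Matrix ι ι G.LInfty) (b : Matrix ι κ ℂ)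
    (α : G.Irr) : block (smulMatrix a X b) α =
      (a ⊗ₖ (1 : Matrix (Fin (G.dim α)) (Fin (G.dim α)) ℂ)) * block X α *
        (b ⊗ₖ (1 : Matrix (Fin (G.dim α)) (Fin (G.dim α)) ℂ)) := by
  have hcoe : ∀ i j, (smulMatrix a X b i j) α = ∑ k, ∑ l, (a i k * b l j) • X k l α := by
    intro i j
    simp only [smulMatrix, Matrix.of_apply]
    rw [lp.coeFn_sum, Finset.sum_apply]
    refine Finset.sum_congr rfl fun k _ => ?_
    rw [lp.coeFn_sum, Finset.sum_apply]
    rfl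
  ext i j
  simp only [block, Matrix.of_apply, hcoe, Matrix.mul_apply, Matrix.kroneckerMap_apply,
    Matrix.sum_apply, Matrix.smul_apply, smul_eq_mul, Fintype.sum_prod_type, Matrix.one_apply]
  simp only [mul_ite, mul_one, mul_zero, ite_mul, zero_mul, Finset.sum_ite_eq, Finset.mem_univ,
    if_true, Finset.sum_ite_eq', Finset.sum_mul]
  rw [Finset.sum_comm]
  exact Finset.sum_congr rfl fun k _ => Finset.sum_congr rfl fun l _ => by ring

theorem norm_kronecker_one_le {ν : Type*} [Fintype ν] [DecidableEq ν] (a : Matrix κ ι ℂ) :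
    ‖a ⊗ₖ (1 : Matrix ν ν ℂ)‖ ≤ ‖a‖ :=
  (Matrix.l2_opNorm_kronecker_le _ _).trans
    (mul_le_of_le_one_right (norm_nonneg _) Matrix.l2_opNorm_one_le)

theorem linftyNorm_smulMatrix_le (a : Matrix κ ι ℂ) (X : Matrix ι ι G.LInfty)
    (b : Matrix ι κ ℂ) : linftyNorm (smulMatrix a X b) ≤ ‖a‖ * linftyNorm X * ‖b‖ := by
  have := linftyNorm_nonneg X
  refine linftyNorm_le (by positivity) fun α => ?_
  rw [block_smulMatrix]
  refine (Matrix.l2_opNorm_mul_mul_le _ _ _).trans ?_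
  gcongr
  · exact norm_kronecker_one_le a
  · exact norm_block_le X α
  · exact norm_kronecker_one_le b

theorem linftyNorm_submatrix (X : Matrix ι ι G.LInfty) (e : κ ≃ ι) :
    linftyNorm (X.submatrix e e) = linftyNorm X := by
  unfold linftyNorm
  congr 1
  ext α
  rw [← Matrix.l2_opNorm_submatrix_equiv (block X α) (e.prodCongr (Equiv.refl _))
    (e.prodCongr (Equiv.refl _))]
  rfl

theorem norm_le_linftyNorm (X : Matrix Unit Unit G.LInfty) : ‖X () ()‖ ≤ linftyNorm X := by
  refine lp.norm_le_of_forall_le (linftyNorm_nonneg X) fun α => ?_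
  refine le_trans ?_ (norm_block_le X α)
  exact (block X α).l2_opNorm_submatrix_le (f := fun i => ((), i)) (g := fun i => ((), i))
    (fun i j h => by simpa using h) (fun i j h => by simpa using h)

/-- The matrix of pairings of the entries of a matrix over `A(𝔾)` and a matrix over
`ℓ^∞(𝔾̂)`. -/
noncomputable def pairMatrix {ι κ : Type*} (ω : Matrix ι ι G.FourierAlgebra)
    (X : Matrix κ κ G.LInfty) : Matrix (ι × κ) (ι × κ) ℂ :=
  Matrix.of fun s t => G.pair (ω s.1 t.1) (X s.2 t.2)

/-- Bounded functionals are completely bounded with the same norm. -/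
theorem norm_pair_matrix_le (ω : G.FourierAlgebra) (X : Matrix κ κ G.LInfty) :
    ‖(Matrix.of fun s t => G.pair ω (X s t) : Matrix κ κ ℂ)‖ ≤ ‖ω‖ * linftyNorm X := by
  have h0 := linftyNorm_nonneg X
  refine Matrix.l2_opNorm_le_of_compress (by positivity) fun a b => ?_
  rw [Matrix.l2_opNorm_unit]
  have h : (a * (Matrix.of fun s t => G.pair ω (X s t)) * b) () () =
      G.pair ω (smulMatrix a X b () ()) := by
    simp only [← pairing_apply, smulMatrix, Matrix.of_apply, Matrix.mul_apply, Finset.sum_mul,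
      map_sum, map_smul, smul_eq_mul]
    rw [Finset.sum_comm]
    exact Finset.sum_congr rfl fun k _ => Finset.sum_congr rfl fun l _ => by ring
  rw [h]
  calc _ ≤ ‖ω‖ * ‖smulMatrix a X b () ()‖ := norm_pair_le _ _
    _ ≤ ‖ω‖ * (‖a‖ * linftyNorm X * ‖b‖) := by
        gcongr
        exact (norm_le_linftyNorm _).trans (linftyNorm_smulMatrix_le _ _ _)
    _ = _ := by ring

theorem norm_pairMatrix_le_sum (ω : Matrix ι ι G.FourierAlgebra) (X : Matrix κ κ G.LInfty) :
    ‖pairMatrix ω X‖ ≤ (∑ i, ∑ j, ‖ω i j‖) * linftyNorm X := by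
  have h : pairMatrix ω X = ∑ i, ∑ j, Matrix.single i j (1 : ℂ) ⊗ₖ
      (Matrix.of fun s t => G.pair (ω i j) (X s t) : Matrix κ κ ℂ) := by
    ext s t
    simp only [pairMatrix, Matrix.sum_apply, Matrix.kroneckerMap_apply, Matrix.of_apply,
      Matrix.single_apply]
    rw [Finset.sum_eq_single s.1 (fun s _ hs => by simp [hs]) (by simp),
      Finset.sum_eq_single t.1 (fun s _ hs => by simp [hs]) (by simp)]
    simp
  rw [h, Finset.sum_mul]
  refine (norm_sum_le _ _).trans (Finset.sum_le_sum fun s _ => ?_)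
  rw [Finset.sum_mul]
  refine (norm_sum_le _ _).trans (Finset.sum_le_sum fun t _ => ?_)
  refine (Matrix.l2_opNorm_kronecker_le _ _).trans ?_
  calc _ ≤ 1 * (‖ω s t‖ * linftyNorm X) := by
        gcongr
        · exact norm_single_le s t
        · exact norm_pair_matrix_le _ _
    _ = _ := one_mul _

theorem pairMatrix_smul_right (ω : Matrix ι ι G.FourierAlgebra) (c : ℂ)
    (X : Matrix κ κ G.LInfty) : pairMatrix ω (c • X) = c • pairMatrix ω X := by
  ext s t
  simp [pairMatrix, ← pairing_apply]

theorem linftyNorm_smul (c : ℂ) (X : Matrix κ κ G.LInfty) :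
    linftyNorm (c • X) = ‖c‖ * linftyNorm X := by
  unfold linftyNorm
  rw [Real.mul_iSup_of_nonneg (norm_nonneg c)]
  congr 1
  ext α
  rw [← norm_smul]
  rfl

theorem fourier_mnorm_le {n : ℕ} {ω : Matrix (Fin n) (Fin n) G.FourierAlgebra} {C : ℝ}
    (hC : 0 ≤ C)
    (h : ∀ (m : ℕ) (X : Matrix (Fin m) (Fin m) G.LInfty), ‖pairMatrix ω X‖ ≤ C * linftyNorm X) :
    mnorm n ω ≤ C := by
  refine Real.sSup_le ?_ hC
  rintro r ⟨m, X, hX, rfl⟩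
  exact (h m X).trans (mul_le_of_le_one_right hC hX)

theorem fourier_norm_pairMatrix_le {n m : ℕ} (ω : Matrix (Fin n) (Fin n) G.FourierAlgebra)
    (X : Matrix (Fin m) (Fin m) G.LInfty) : ‖pairMatrix ω X‖ ≤ mnorm n ω * linftyNorm X := by
  have hbdd : BddAbove {r : ℝ | ∃ (m : ℕ) (X : Matrix (Fin m) (Fin m) G.LInfty), mnorm m X ≤ 1 ∧
      r = ‖(Matrix.of fun s t => G.pair (ω s.1 t.1) (X s.2 t.2) :
      Matrix (Fin n × Fin m) (Fin n × Fin m) ℂ)‖} := by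
    refine ⟨∑ i, ∑ j, ‖ω i j‖, ?_⟩
    rintro r ⟨m, X, hX, rfl⟩
    exact (norm_pairMatrix_le_sum ω X).trans (mul_le_of_le_one_right
      (Finset.sum_nonneg fun _ _ => Finset.sum_nonneg fun _ _ => norm_nonneg _) hX)
  rcases eq_or_lt_of_le (linftyNorm_nonneg X) with h0 | h0
  · have := norm_pairMatrix_le_sum ω X
    rw [← h0, mul_zero] at this ⊢
    exact this
  · have h1 : mnorm m ((((linftyNorm X)⁻¹ : ℝ) : ℂ) • X) ≤ 1 := by
      rw [mnorm_eq_linftyNorm, linftyNorm_smul, Complex.norm_real,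
        Real.norm_of_nonneg (by positivity), inv_mul_cancel₀ h0.ne']
    have h2 : ‖pairMatrix ω ((((linftyNorm X)⁻¹ : ℝ) : ℂ) • X)‖ ≤ mnorm n ω :=
      le_csSup hbdd ⟨m, _, h1, rfl⟩
    rw [pairMatrix_smul_right, norm_smul, Complex.norm_real,
      Real.norm_of_nonneg (by positivity), inv_mul_le_iff₀ h0] at h2
    rwa [mul_comm]

theorem fourier_matrixNormOn_le {ω : Matrix ι ι G.FourierAlgebra} {C : ℝ} (hC : 0 ≤ C)
    (h : ∀ (m : ℕ) (X : Matrix (Fin m) (Fin m) G.LInfty), ‖pairMatrix ω X‖ ≤ C * linftyNorm X) :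
    matrixNormOn mnorm ω ≤ C := by
  refine fourier_mnorm_le hC fun m X => ?_
  refine le_trans (le_of_eq ?_) (h m X)
  exact Matrix.l2_opNorm_submatrix_equiv (pairMatrix ω X)
    ((Fintype.equivFin ι).symm.prodCongr (Equiv.refl _))
    ((Fintype.equivFin ι).symm.prodCongr (Equiv.refl _))

theorem norm_pairMatrix_le (ω : Matrix ι ι G.FourierAlgebra) (X : Matrix κ κ G.LInfty) :
    ‖pairMatrix ω X‖ ≤ matrixNormOn mnorm ω * linftyNorm X := by
  rw [← linftyNorm_submatrix X (Fintype.equivFin κ).symm]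
  refine le_trans (le_of_eq ?_) (fourier_norm_pairMatrix_le _ _)
  exact (Matrix.l2_opNorm_submatrix_equiv (pairMatrix ω X)
    ((Fintype.equivFin ι).symm.prodCongr (Fintype.equivFin κ).symm)
    ((Fintype.equivFin ι).symm.prodCongr (Fintype.equivFin κ).symm)).symm

theorem pairMatrix_smulMatrix (a : Matrix ι κ ℂ) (ω : Matrix κ κ G.FourierAlgebra)
    (b : Matrix κ ι ℂ) {m : ℕ} (X : Matrix (Fin m) (Fin m) G.LInfty) :
    pairMatrix (smulMatrix a ω b) X =
      (a ⊗ₖ (1 : Matrix (Fin m) (Fin m) ℂ)) * pairMatrix ω X *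
        (b ⊗ₖ (1 : Matrix (Fin m) (Fin m) ℂ)) := by
  ext i j
  simp only [pairMatrix, smulMatrix, Matrix.of_apply, Matrix.mul_apply,
    Matrix.kroneckerMap_apply, ← pairing_apply, map_sum, map_smul, sum_apply,
    smul_apply, smul_eq_mul, Fintype.sum_prod_type, Matrix.one_apply]
  simp only [mul_ite, mul_one, mul_zero, ite_mul, zero_mul, Finset.sum_ite_eq, Finset.mem_univ,
    if_true, Finset.sum_ite_eq', Finset.sum_mul]
  rw [Finset.sum_comm]
  exact Finset.sum_congr rfl fun k _ => Finset.sum_congr rfl fun l _ => by ring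

variable (G) in
theorem isMatricialSeminorm_fourier : IsMatricialSeminorm (mnorm (E := G.FourierAlgebra)) where
  add_le n ω φ := by
    refine fourier_mnorm_le (add_nonneg (G.fourier_mnorm_nonneg n ω) (G.fourier_mnorm_nonneg n φ))
      fun m X => ?_
    have h : pairMatrix (ω + φ) X = pairMatrix ω X + pairMatrix φ X := by
      ext s t
      simp [pairMatrix, ← pairing_apply]
    rw [h, add_mul]
    exact (norm_add_le _ _).trans (add_le_add (fourier_norm_pairMatrix_le _ _)
      (fourier_norm_pairMatrix_le _ _))
  smulMatrix_le m n a ω b := by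
    have := G.fourier_mnorm_nonneg n ω
    refine fourier_mnorm_le (by positivity) fun k X => ?_
    rw [pairMatrix_smulMatrix]
    calc _ ≤ ‖a ⊗ₖ (1 : Matrix (Fin k) (Fin k) ℂ)‖ * ‖pairMatrix ω X‖ *
          ‖b ⊗ₖ (1 : Matrix (Fin k) (Fin k) ℂ)‖ := Matrix.l2_opNorm_mul_mul_le _ _ _
      _ ≤ ‖a‖ * (mnorm n ω * linftyNorm X) * ‖b‖ := by
          have ha := norm_kronecker_one_le (ν := Fin k) a
          have hb := norm_kronecker_one_le (ν := Fin k) b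
          have hX := fourier_norm_pairMatrix_le ω X
          have hX' := linftyNorm_nonneg X
          gcongr
      _ = _ := by ring
  directSum_le m n ω φ := by
    have h0 := G.fourier_mnorm_nonneg m ω
    have h0' := G.fourier_mnorm_nonneg n φ
    refine fourier_mnorm_le (le_max_of_le_left h0) fun k X => ?_
    let e : (Fin m × Fin k) ⊕ (Fin n × Fin k) ≃ Fin (m + n) × Fin k :=
      (Equiv.sumProdDistrib (Fin m) (Fin n) (Fin k)).symm.trans
        (finSumFinEquiv.prodCongr (Equiv.refl (Fin k)))
    have h : (pairMatrix (directSumMatrix ω φ) X).submatrix e e =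
        Matrix.fromBlocks (pairMatrix ω X) 0 0 (pairMatrix φ X) := by
      ext (i | i) (j | j) <;> simp [pairMatrix, directSumMatrix, ← pairing_apply, e]
    rw [← Matrix.l2_opNorm_submatrix_equiv _ e e, h]
    have hX := linftyNorm_nonneg X
    refine (Matrix.l2_opNorm_fromBlocks_zero_le _ _).trans (max_le ?_ ?_)
    · exact (fourier_norm_pairMatrix_le _ _).trans (by gcongr; exact le_max_left _ _)
    · exact (fourier_norm_pairMatrix_le _ _).trans (by gcongr; exact le_max_right _ _)

theorem fourier_mnorm_one_le (ω : G.FourierAlgebra) :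
    mnorm 1 (Matrix.of fun _ _ => ω : Matrix (Fin 1) (Fin 1) G.FourierAlgebra) ≤ ‖ω‖ := by
  refine fourier_mnorm_le (norm_nonneg _) fun m X => ?_
  simpa using norm_pairMatrix_le_sum (Matrix.of fun _ _ : Fin 1 => ω) X

/-- The norm of `A(𝔾)` is recovered from the pairing with `ℓ^∞(𝔾̂)`, already with its finitely
supported elements. -/
theorem norm_le_of_norm_pair_le {ω : G.FourierAlgebra} {C : ℝ} (hC : 0 ≤ C)
    (h : ∀ X : G.LInfty, ‖G.pair ω X‖ ≤ C * ‖X‖) : ‖ω‖ ≤ C := by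
  classical
  rw [norm_eq_tsum]
  refine (summable_norm_component ω).tsum_le_of_sum_le fun s => ?_
  refine le_of_forall_pos_le_add fun ε hε => ?_
  -- An error of `δ` in each of the blocks in `s` adds up to at most `ε`.
  set δ : ℝ := ε / (s.card + 1) with hδ
  have hδ0 : 0 < δ := by positivity
  have hY : ∀ α, ∃ Y : G.Block α, ‖Y‖ ≤ 1 ∧
      ∃ t : ℝ, G.component ω α Y = t ∧ ‖G.component ω α‖ - δ ≤ t := by
    intro α
    obtain ⟨Y, hY1, hY2⟩ := ContinuousLinearMap.exists_lt_apply_of_lt_opNorm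
      (G.component ω α) (show ‖G.component ω α‖ - δ < ‖G.component ω α‖ by linarith)
    -- Rotating `Y` makes the value real and nonnegative, so that the blocks add up.
    obtain ⟨c, hc1, hc2⟩ := RCLike.exists_norm_eq_mul_self (G.component ω α Y)
    refine ⟨c • Y, ?_, ‖G.component ω α Y‖, ?_, hY2.le⟩
    · rw [norm_smul, hc1, one_mul]
      exact hY1.le
    · rw [map_smul, smul_eq_mul]
      exact hc2.symm
  choose Y hY1 t hY2 hY3 using hY
  let X : G.LInfty := ⟨fun α => if α ∈ s then Y α else 0, memℓp_infty ⟨1, by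
    rintro _ ⟨α, rfl⟩
    by_cases hα : α ∈ s
    · simpa [hα] using hY1 α
    · simp [hα]⟩⟩
  have hX : ‖X‖ ≤ 1 := lp.norm_le_of_forall_le zero_le_one fun α => by
    by_cases hα : α ∈ s
    · simpa [X, hα] using hY1 α
    · simp [X, hα]
  have hp : G.pair ω X = ((∑ α ∈ s, t α : ℝ) : ℂ) := by
    unfold pair
    rw [tsum_eq_sum (s := s) fun α hα => by simp [X, hα]]
    push_cast
    exact Finset.sum_congr rfl fun α hα => by simp [X, hα, hY2]
  have h1 : ∑ α ∈ s, t α ≤ C := by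
    have h2 := h X
    rw [hp, Complex.norm_real] at h2
    exact (le_abs_self _).trans (h2.trans (mul_le_of_le_one_right hC hX))
  have h3 : ∑ α ∈ s, ‖G.component ω α‖ ≤ ∑ α ∈ s, (t α + δ) :=
    Finset.sum_le_sum fun α _ => by linarith [hY3 α]
  rw [Finset.sum_add_distrib, Finset.sum_const, nsmul_eq_mul] at h3
  have h4 : (s.card : ℝ) * δ ≤ ε := by
    rw [hδ, mul_div_assoc', div_le_iff₀ (by positivity)]
    nlinarith
  linarith

end Norms

end CompactQuantumGroup

/-! ### Polynomials as functionals, and complete contractivity of the multiplication -/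

namespace CompactQuantumGroup

variable {A : Type u} [Ring A] [StarRing A] [HopfAlgebra ℂ A] [StarModule ℂ A]
  {G : CompactQuantumGroup.{u, v} A}

/-- The functional `x ↦ ⟨x, X⟩` on `Pol(𝔾)`. -/
noncomputable def ev (X : G.LInfty) : A →ₗ[ℂ] ℂ :=
  (G.pairing.flip X).toLinearMap ∘ₗ G.fourierEmbedding

theorem ev_apply (X : G.LInfty) (x : A) : ev X x = G.pair (G.fourierEmbedding x) X := rfl

theorem ev_add (X Y : G.LInfty) (x : A) : ev (X + Y) x = ev X x + ev Y x := by
  simp [ev]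

theorem ev_smul (c : ℂ) (X : G.LInfty) (x : A) : ev (c • X) x = c * ev X x := by
  simp [ev]

theorem ev_sum {ι : Type*} (s : Finset ι) (X : ι → G.LInfty) (x : A) :
    ev (∑ i ∈ s, X i) x = ∑ i ∈ s, ev (X i) x := by
  simp [ev]

namespace IsKac

variable (hG : G.IsKac)
include hG

theorem fourierTransform_rep (α : G.Irr) (i j k l : Fin (G.dim α)) :
    G.fourierTransform (G.rep α i j) α k l =
      if l = i then (if k = j then (G.dim α : ℂ)⁻¹ else 0) else 0 := by
  rw [fourierTransform, Matrix.of_apply, hG.haar_star_rep_mul]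

theorem component_rep (α : G.Irr) (i j : Fin (G.dim α)) (Y : G.Block α) :
    G.component (G.fourierEmbedding (G.rep α i j)) α Y = Y i j := by
  have hn := G.dim_ne_zero α
  change (G.dim α : ℂ) • Matrix.trace (Y * G.fourierTransform (G.rep α i j) α) = Y i j
  simp only [Matrix.trace, Matrix.diag, Matrix.mul_apply, hG.fourierTransform_rep, mul_ite,
    mul_zero, Finset.sum_ite_irrel, Finset.sum_const_zero, Finset.sum_ite_eq', Finset.mem_univ,
    if_true, smul_eq_mul]
  field_simp

omit hG in
theorem component_rep_of_ne {α β : G.Irr} (h : β ≠ α) (i j : Fin (G.dim α)) :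
    G.component (G.fourierEmbedding (G.rep α i j)) β = 0 := by
  have h0 : G.fourierTransform (G.rep α i j) β = 0 := by
    ext k l
    exact G.haar_star_rep_mul_of_ne h _ _ _ _
  ext Y
  change (G.dim β : ℂ) • Matrix.trace (Y * G.fourierTransform (G.rep α i j) β) = 0
  rw [h0]
  simp

theorem ev_rep (X : G.LInfty) (α : G.Irr) (i j : Fin (G.dim α)) :
    ev X (G.rep α i j) = X α i j := by
  rw [ev_apply, pair, tsum_eq_single α fun β h => by rw [component_rep_of_ne h]; rfl,
    hG.component_rep]

/-- The product of `ℓ^∞(𝔾̂)` is convolution of functionals on `Pol(𝔾)`. -/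
theorem ev_mul (X Y : G.LInfty) (x : A) :
    ev (X * Y) x = LinearMap.mul' ℂ ℂ (TensorProduct.map (ev X) (ev Y)
      (Coalgebra.comul (R := ℂ) x)) := by
  have h : ev (X * Y) = LinearMap.mul' ℂ ℂ ∘ₗ TensorProduct.map (ev X) (ev Y) ∘ₗ
      Coalgebra.comul (R := ℂ) := by
    refine G.linearMap_ext fun α i j => ?_
    simp only [LinearMap.comp_apply, (G.isUnitaryRep α).comul, map_sum, TensorProduct.map_tmul,
      LinearMap.mul'_apply, hG.ev_rep]
    rfl
  rw [h]
  rfl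

theorem ev_star (X : G.LInfty) (x : A) :
    ev (star X) x = star (ev X (star (HopfAlgebra.antipode ℂ x))) := by
  refine G.span_induction
    (p := fun x => ev (star X) x = star (ev X (star (HopfAlgebra.antipode ℂ x))))
    ?_ (by simp) (fun x y hx hy => ?_) (fun c x hx => ?_) x
  · intro α i j
    rw [hG.ev_rep, (G.isUnitaryRep α).antipode_apply, star_star, hG.ev_rep]
    rfl
  · rw [map_add, map_add, star_add, map_add, star_add, hx, hy]
  · rw [map_smul, map_smul, star_smul, map_smul, smul_eq_mul, smul_eq_mul, star_mul', star_star, hx]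

end IsKac

section RepresentationBound

variable {κ ν : Type*} [Fintype κ] [DecidableEq κ] [Fintype ν] [DecidableEq ν]

/-- A matrix of coefficients of `ℓ^∞-⨁ M_κ ⊗ M_{n_α}` is an element of `ℓ^∞(𝔾̂)`. -/
def entryLInfty (s t : κ)
    (Z : lp (fun α : G.Irr => Matrix (κ × Fin (G.dim α)) (κ × Fin (G.dim α)) ℂ) ∞) : G.LInfty :=
  ⟨fun α => (Z α).submatrix (fun i => (s, i)) fun i => (t, i), memℓp_infty ⟨‖Z‖, by
    rintro _ ⟨α, rfl⟩
    exact (Matrix.l2_opNorm_submatrix_le _ (fun i j h => by simpa using h)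
      (fun i j h => by simpa using h)).trans (lp.norm_apply_le_norm (by simp) Z α)⟩⟩

/-- A matrix over `ℓ^∞(𝔾̂)`, viewed in `ℓ^∞-⨁ M_κ ⊗ M_{n_α}`. -/
noncomputable def ofMatrixLInfty (X : Matrix κ κ G.LInfty) :
    lp (fun α : G.Irr => Matrix (κ × Fin (G.dim α)) (κ × Fin (G.dim α)) ℂ) ∞ :=
  ⟨block X, memℓp_infty ⟨linftyNorm X, by
    rintro _ ⟨α, rfl⟩
    exact norm_block_le X α⟩⟩

theorem norm_ofMatrixLInfty_le (X : Matrix κ κ G.LInfty) : ‖ofMatrixLInfty X‖ ≤ linftyNorm X :=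
  lp.norm_le_of_forall_le (linftyNorm_nonneg X) fun α => norm_block_le X α

/-- A finite-dimensional unitary representation `v` of `𝔾` gives a representation
`X ↦ [⟨v_{ij}, X⟩]` of `ℓ^∞(𝔾̂)`. It is a `*`-homomorphism of `C*`-algebras, as are its
amplifications, and therefore completely contractive. -/
theorem IsKac.norm_ev_coefficients_le (hG : G.IsKac) {v : Matrix ν ν A}
    (hc : ∀ i j, Coalgebra.comul (R := ℂ) (v i j) = ∑ k, v i k ⊗ₜ[ℂ] v k j)
    (hs : ∀ i j, HopfAlgebra.antipode ℂ (v i j) = star (v j i)) (X : Matrix κ κ G.LInfty) :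
    ‖(Matrix.of fun s t => ev (X s.1 t.1) (v s.2 t.2) : Matrix (κ × ν) (κ × ν) ℂ)‖ ≤
      linftyNorm X := by
  let φ : lp (fun α : G.Irr => Matrix (κ × Fin (G.dim α)) (κ × Fin (G.dim α)) ℂ) ∞ →⋆ₙₐ[ℂ]
      Matrix (κ × ν) (κ × ν) ℂ :=
    { toFun := fun Z => Matrix.of fun s t => ev (entryLInfty s.1 t.1 Z) (v s.2 t.2)
      map_smul' := fun c Z => by
        ext s t
        exact ev_smul c (entryLInfty s.1 t.1 Z) _
      map_zero' := by
        ext s t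
        have : entryLInfty s.1 t.1 (0 : lp (fun α : G.Irr =>
          Matrix (κ × Fin (G.dim α)) (κ × Fin (G.dim α)) ℂ) ∞) = 0 := rfl
        rw [Matrix.of_apply, this]
        simp [ev]
      map_add' := fun Z Z' => by
        ext s t
        exact ev_add (entryLInfty s.1 t.1 Z) (entryLInfty s.1 t.1 Z') _
      map_mul' := fun Z Z' => by
        ext s t
        have h : entryLInfty s.1 t.1 (Z * Z') =
            ∑ r, entryLInfty s.1 r Z * entryLInfty r t.1 Z' := by
          refine Subtype.ext (funext fun α => ?_)
          rw [lp.coeFn_sum, Finset.sum_apply]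
          ext i j
          simp only [Matrix.sum_apply]
          change (Z α * Z' α) (s.1, i) (t.1, j) = ∑ r, _
          rw [Matrix.mul_apply, Fintype.sum_prod_type]
          rfl
        simp only [Matrix.of_apply, h, ev_sum, hG.ev_mul, hc, Matrix.mul_apply,
          Fintype.sum_prod_type, map_sum, TensorProduct.map_tmul, LinearMap.mul'_apply]
      map_star' := fun Z => by
        ext s t
        have h : entryLInfty s.1 t.1 (star Z) = star (entryLInfty t.1 s.1 Z) := rfl
        simp only [Matrix.of_apply, h, hG.ev_star, hs, star_star, Matrix.star_apply] }
  have h := NonUnitalStarAlgHom.norm_apply_le φ (ofMatrixLInfty X)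
  exact h.trans (norm_ofMatrixLInfty_le X)

theorem IsKac.norm_ev_unitary_le (hG : G.IsKac) {d : ℕ} {v : Matrix (Fin d) (Fin d) A}
    (hv : IsUnitaryRep v) (X : Matrix κ κ G.LInfty) :
    ‖(Matrix.of fun s t => ev (X s.1 t.1) (v s.2 t.2) : Matrix (κ × Fin d) (κ × Fin d) ℂ)‖ ≤
      linftyNorm X :=
  hG.norm_ev_coefficients_le hv.comul hv.antipode_apply X

theorem IsKac.norm_ev_mul_le (hG : G.IsKac) (β γ : G.Irr) (X : Matrix κ κ G.LInfty) :
    ‖(Matrix.of fun s t => ev (X s.1 t.1) (G.rep β s.2.1 t.2.1 * G.rep γ s.2.2 t.2.2) :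
      Matrix (κ × Fin (G.dim β) × Fin (G.dim γ)) (κ × Fin (G.dim β) × Fin (G.dim γ)) ℂ)‖ ≤
      linftyNorm X := by
  refine hG.norm_ev_coefficients_le (v := G.rep β ⊗ₖ G.rep γ) (fun i j => ?_) (fun i j => ?_) X
  · simp only [Matrix.kroneckerMap_apply]
    rw [Bialgebra.comul_mul, (G.isUnitaryRep β).comul, (G.isUnitaryRep γ).comul,
      Finset.sum_mul_sum, Fintype.sum_prod_type]
    simp only [Algebra.TensorProduct.tmul_mul_tmul]
  · simp only [Matrix.kroneckerMap_apply]
    rw [HopfAlgebra.antipode_mul_antidistrib, (G.isUnitaryRep β).antipode_apply,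
      (G.isUnitaryRep γ).antipode_apply, star_mul]

end RepresentationBound

section Slices

variable {ι ι' κ : Type*} [Fintype ι] [DecidableEq ι] [Fintype ι'] [DecidableEq ι'] [Fintype κ]
  [DecidableEq κ] (hG : G.IsKac)

theorem linftyNorm_unit (X : G.LInfty) :
    linftyNorm (Matrix.of fun _ _ => X : Matrix Unit Unit G.LInfty) ≤ ‖X‖ := by
  refine linftyNorm_le (norm_nonneg _) fun α => ?_
  refine ((norm_block_le_sum _ α).trans (le_of_eq ?_))
  simp

theorem norm_ev_rep_mul_rep_le (hG : G.IsKac) (β γ : G.Irr) (k l : Fin (G.dim γ)) (X : G.LInfty) :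
    ‖(Matrix.of fun a b => ev X (G.rep β a b * G.rep γ k l) : G.Block β)‖ ≤ ‖X‖ := by
  have h := (hG.norm_ev_mul_le β γ (Matrix.of fun _ _ : Unit => X)).trans (linftyNorm_unit X)
  have h2 := Matrix.l2_opNorm_submatrix_le
    (Matrix.of fun s t => ev X (G.rep β s.2.1 t.2.1 * G.rep γ s.2.2 t.2.2) :
      Matrix (Unit × Fin (G.dim β) × Fin (G.dim γ)) (Unit × Fin (G.dim β) × Fin (G.dim γ)) ℂ)
    (f := fun a : Fin (G.dim β) => ((), a, k)) (g := fun b : Fin (G.dim β) => ((), b, l))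
    (fun i j h => congrArg (fun x => x.2.1) h) (fun i j h => congrArg (fun x => x.2.1) h)
  exact h2.trans h

/-- The element `Z` of `ℓ^∞(𝔾̂)` with `⟨x, Z⟩ = ⟨x u^γ_{kl}, X⟩`. -/
noncomputable def coefficientSlice (hG : G.IsKac) (γ : G.Irr) (k l : Fin (G.dim γ))
    (X : G.LInfty) : G.LInfty :=
  ⟨fun β => Matrix.of fun a b => ev X (G.rep β a b * G.rep γ k l), memℓp_infty ⟨‖X‖, by
    rintro _ ⟨β, rfl⟩
    exact norm_ev_rep_mul_rep_le hG β γ k l X⟩⟩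

theorem ev_coefficientSlice (γ : G.Irr) (k l : Fin (G.dim γ)) (X : G.LInfty) (x : A) :
    ev (coefficientSlice hG γ k l X) x = ev X (x * G.rep γ k l) := by
  have h : ev (coefficientSlice hG γ k l X) = ev X ∘ₗ LinearMap.mulRight ℂ (G.rep γ k l) :=
    G.linearMap_ext fun β a b => by rw [hG.ev_rep]; rfl
  rw [h]
  rfl

theorem linftyNorm_coefficientSlice_le (γ : G.Irr) (X : Matrix κ κ G.LInfty) :
    linftyNorm (Matrix.of fun s t => coefficientSlice hG γ s.2 t.2 (X s.1 t.1) :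
      Matrix (κ × Fin (G.dim γ)) (κ × Fin (G.dim γ)) G.LInfty) ≤ linftyNorm X := by
  refine linftyNorm_le (linftyNorm_nonneg X) fun β => ?_
  refine le_trans (le_of_eq ?_) (hG.norm_ev_mul_le β γ X)
  let e : (κ × Fin (G.dim γ)) × Fin (G.dim β) ≃ κ × Fin (G.dim β) × Fin (G.dim γ) :=
    (Equiv.prodAssoc _ _ _).trans ((Equiv.refl κ).prodCongr (Equiv.prodComm _ _))
  exact Matrix.l2_opNorm_submatrix_equiv
    (Matrix.of fun s t => ev (X s.1 t.1) (G.rep β s.2.1 t.2.1 * G.rep γ s.2.2 t.2.2) :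
      Matrix (κ × Fin (G.dim β) × Fin (G.dim γ)) (κ × Fin (G.dim β) × Fin (G.dim γ)) ℂ) e e

/-- Moving the coefficients of `u^γ` from the product into `X` reduces the bound to the duality
between `A(𝔾)` and `ℓ^∞(𝔾̂)`. -/
theorem norm_ev_mul_rep_le (v : Matrix ι ι A) (X : Matrix κ κ G.LInfty) (γ : G.Irr) (hG : G.IsKac) :
    ‖(Matrix.of fun s t => ev (X s.1.2 t.1.2) (v s.1.1 t.1.1 * G.rep γ s.2 t.2) :
      Matrix ((ι × κ) × Fin (G.dim γ)) ((ι × κ) × Fin (G.dim γ)) ℂ)‖ ≤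
      matrixNormOn mnorm (v.map G.fourierEmbedding) * linftyNorm X := by
  have h1 := norm_pairMatrix_le (v.map G.fourierEmbedding)
    (Matrix.of fun s t => coefficientSlice hG γ s.2 t.2 (X s.1 t.1) :
      Matrix (κ × Fin (G.dim γ)) (κ × Fin (G.dim γ)) G.LInfty)
  have h2 := linftyNorm_coefficientSlice_le hG γ X
  have h3 := G.isMatricialSeminorm_fourier.matrixNormOn_nonneg (v.map G.fourierEmbedding)
  refine le_trans (le_of_eq ?_) (h1.trans (by gcongr))
  rw [← Matrix.l2_opNorm_submatrix_equiv (pairMatrix _ _) (Equiv.prodAssoc _ _ _)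
    (Equiv.prodAssoc _ _ _)]
  congr 1
  ext s t
  exact (ev_coefficientSlice hG γ s.2 t.2 (X s.1.2 t.1.2) (v s.1.1 t.1.1)).symm

theorem norm_ev_mul_rep_block_le (hG : G.IsKac) (x : A) (γ : G.Irr) (X : G.LInfty) :
    ‖(Matrix.of fun k l => ev X (x * G.rep γ k l) : G.Block γ)‖ ≤
      matrixNormOn mnorm ((Matrix.of fun _ _ : Unit => x).map G.fourierEmbedding) *
        linftyNorm (Matrix.of fun _ _ : Unit => X) := by
  have h := norm_ev_mul_rep_le (Matrix.of fun _ _ : Unit => x) (Matrix.of fun _ _ : Unit => X) γ hG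
  have h2 := Matrix.l2_opNorm_submatrix_le
    (Matrix.of fun s t => ev X (x * G.rep γ s.2 t.2) :
      Matrix ((Unit × Unit) × Fin (G.dim γ)) ((Unit × Unit) × Fin (G.dim γ)) ℂ)
    (f := fun a : Fin (G.dim γ) => (((), ()), a)) (g := fun b : Fin (G.dim γ) => (((), ()), b))
    (fun i j h => congrArg (fun x => x.2) h) (fun i j h => congrArg (fun x => x.2) h)
  exact h2.trans h

/-- The element `Z` of `ℓ^∞(𝔾̂)` with `⟨y, Z⟩ = ⟨x y, X⟩`. -/
noncomputable def slice (hG : G.IsKac) (x : A) (X : G.LInfty) : G.LInfty :=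
  ⟨fun γ => Matrix.of fun k l => ev X (x * G.rep γ k l), memℓp_infty ⟨_, by
    rintro _ ⟨γ, rfl⟩
    exact norm_ev_mul_rep_block_le hG x γ X⟩⟩

theorem ev_slice (x : A) (X : G.LInfty) (y : A) : ev (slice hG x X) y = ev X (x * y) := by
  have h : ev (slice hG x X) = ev X ∘ₗ LinearMap.mulLeft ℂ x :=
    G.linearMap_ext fun β a b => by rw [hG.ev_rep]; rfl
  rw [h]
  rfl

/-- The multiplication of `A(𝔾)` is completely contractive. -/
theorem IsKac.matrixNormOn_kronecker_le (hG : G.IsKac) (v : Matrix ι ι A) (w : Matrix ι' ι' A) :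
    matrixNormOn mnorm ((v ⊗ₖ w).map G.fourierEmbedding) ≤
      matrixNormOn mnorm (v.map G.fourierEmbedding) *
        matrixNormOn mnorm (w.map G.fourierEmbedding) := by
  have h3 := G.isMatricialSeminorm_fourier.matrixNormOn_nonneg (v.map G.fourierEmbedding)
  have h4 := G.isMatricialSeminorm_fourier.matrixNormOn_nonneg (w.map G.fourierEmbedding)
  refine fourier_matrixNormOn_le (by positivity) fun m X => ?_
  have h1 := norm_pairMatrix_le (w.map G.fourierEmbedding)
    (Matrix.of fun s t => slice hG (v s.1 t.1) (X s.2 t.2) :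
      Matrix (ι × Fin m) (ι × Fin m) G.LInfty)
  have h5 := linftyNorm_nonneg X
  have h2 : linftyNorm (Matrix.of fun s t => slice hG (v s.1 t.1) (X s.2 t.2) :
      Matrix (ι × Fin m) (ι × Fin m) G.LInfty) ≤
      matrixNormOn mnorm (v.map G.fourierEmbedding) * linftyNorm X :=
    linftyNorm_le (by positivity) fun γ => norm_ev_mul_rep_le v X γ hG
  refine le_trans (le_of_eq ?_) (h1.trans ((mul_le_mul_of_nonneg_left h2 h4).trans_eq (by ring)))
  let e : (ι × ι') × Fin m ≃ ι' × ι × Fin m :=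
    ((Equiv.prodComm ι ι').prodCongr (Equiv.refl (Fin m))).trans (Equiv.prodAssoc _ _ _)
  rw [← Matrix.l2_opNorm_submatrix_equiv (pairMatrix (w.map G.fourierEmbedding) _) e e]
  congr 1
  ext s t
  exact (ev_slice hG (v s.1.1 t.1.1) (X s.2 t.2) (w s.1.2 t.1.2)).symm

end Slices

end CompactQuantumGroup

/-! ### Truncation to finitely many irreducible representations -/

namespace CompactQuantumGroup

variable {A : Type u} [Ring A] [StarRing A] [HopfAlgebra ℂ A] [StarModule ℂ A]
  {G : CompactQuantumGroup.{u, v} A}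

open Classical in
/-- The restriction of `X ∈ ℓ^∞(𝔾̂)` to the blocks in a finite set. -/
noncomputable def restrict (F : Finset G.Irr) (X : G.LInfty) : G.LInfty :=
  ⟨fun α => if α ∈ F then X α else 0, memℓp_infty ⟨‖X‖, by
    rintro _ ⟨α, rfl⟩
    by_cases h : α ∈ F
    · simpa [h] using lp.norm_apply_le_norm (by simp) X α
    · simp [h]⟩⟩

theorem linftyNorm_restrict_le {κ : Type*} [Fintype κ] [DecidableEq κ] (F : Finset G.Irr)
    (X : Matrix κ κ G.LInfty) : linftyNorm (X.map (restrict F)) ≤ linftyNorm X := by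
  refine linftyNorm_le (linftyNorm_nonneg X) fun α => ?_
  by_cases h : α ∈ F
  · have : block (X.map (restrict F)) α = block X α := by
      ext s t
      simp [block, restrict, h]
    rw [this]
    exact norm_block_le X α
  · have : block (X.map (restrict F)) α = 0 := by
      ext s t
      simp [block, restrict, h]
    rw [this, norm_zero]
    exact linftyNorm_nonneg X

/-- The polynomial whose components agree with those of `ω` in a finite set of irreducible
representations and vanish outside it. -/
noncomputable def truncate (F : Finset G.Irr) : G.FourierAlgebra →ₗ[ℂ] A where
  toFun ω := ∑ α ∈ F, ∑ i, ∑ j, G.component ω α (Matrix.single i j 1) • G.rep α i j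
  map_add' ω φ := by
    have h : ∀ α, G.component (ω + φ) α = G.component ω α + G.component φ α := fun α => rfl
    simp only [h, add_apply, add_smul, Finset.sum_add_distrib]
  map_smul' c ω := by
    have h : ∀ α, G.component (c • ω) α = c • G.component ω α := fun α => rfl
    simp only [h, smul_apply, smul_assoc, Finset.smul_sum, RingHom.id_apply]

theorem truncate_apply (F : Finset G.Irr) (ω : G.FourierAlgebra) : truncate F ω =
    ∑ α ∈ F, ∑ i, ∑ j, G.component ω α (Matrix.single i j 1) • G.rep α i j := rfl

theorem IsKac.ev_truncate (hG : G.IsKac) (F : Finset G.Irr) (ω : G.FourierAlgebra) (X : G.LInfty) :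
    ev X (truncate F ω) = G.pair ω (restrict F X) := by
  rw [pair, tsum_eq_sum (s := F) fun α hα => by simp [restrict, hα], truncate_apply]
  simp only [map_sum, map_smul, hG.ev_rep, smul_eq_mul]
  refine Finset.sum_congr rfl fun α hα => ?_
  have h : restrict F X α = ∑ i, ∑ j, (X α i j) • Matrix.single i j (1 : ℂ) := by
    have : restrict F X α = X α := by simp [restrict, hα]
    rw [this]
    conv_lhs => rw [Matrix.matrix_eq_sum_single (X α)]
    simp
  rw [h]
  simp only [map_sum, map_smul, smul_eq_mul, mul_comm]

theorem IsKac.matrixNormOn_truncate_le {ι : Type*} [Fintype ι] [DecidableEq ι] (hG : G.IsKac)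
    (F : Finset G.Irr) (ω : Matrix ι ι G.FourierAlgebra) :
    matrixNormOn mnorm ((ω.map (truncate F)).map G.fourierEmbedding) ≤ matrixNormOn mnorm ω := by
  have h0 := G.isMatricialSeminorm_fourier.matrixNormOn_nonneg ω
  refine fourier_matrixNormOn_le h0 fun m X => ?_
  have h : pairMatrix ((ω.map (truncate F)).map G.fourierEmbedding) X =
      pairMatrix ω (X.map (restrict F)) := by
    ext s t
    exact hG.ev_truncate F _ _
  rw [h]
  refine (norm_pairMatrix_le _ _).trans ?_
  gcongr
  exact linftyNorm_restrict_le F X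

open Filter in
theorem IsKac.eventually_truncate (hG : G.IsKac) (x : A) :
    ∀ᶠ F in atTop, truncate F (G.fourierEmbedding x) = x := by
  classical
  refine G.span_induction (p := fun x => ∀ᶠ F in atTop, truncate F (G.fourierEmbedding x) = x)
    (fun α i j => ?_) (by simp) (fun x y hx hy => ?_) (fun c x hx => ?_) x
  · filter_upwards [eventually_ge_atTop {α}] with F hF
    have hα : α ∈ F := hF (Finset.mem_singleton_self α)
    rw [truncate_apply, Finset.sum_eq_single α]
    · simp only [hG.component_rep, Matrix.single_apply, ite_smul, one_smul, zero_smul, ite_and]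
      simp
    · intro β _ hβ
      simp [component_rep_of_ne hβ]
    · exact fun h => absurd hα h
  · filter_upwards [hx, hy] with F h1 h2
    rw [map_add, map_add, h1, h2]
  · filter_upwards [hx] with F h1
    rw [map_smul, map_smul, h1]

open Filter in
theorem IsKac.eventually_truncate_tensor (hG : G.IsKac) (U : A ⊗[ℂ] A) :
    ∀ᶠ F in atTop, TensorProduct.map (truncate F) (truncate F) (G.tensorEmbedding U) = U := by
  induction U using TensorProduct.induction_on with
  | zero => simp
  | tmul x y =>
    filter_upwards [hG.eventually_truncate x, hG.eventually_truncate y] with F h1 h2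
    simp [tensorEmbedding, h1, h2]
  | add U V hU hV =>
    filter_upwards [hU, hV] with F h1 h2
    rw [map_add, map_add, h1, h2]

variable (G) in
/-- The projective norm of `A(𝔾) ⊗ A(𝔾)` on matrices over `Pol(𝔾) ⊙ Pol(𝔾)`. -/
noncomputable def polNorm (n : ℕ) (U : Matrix (Fin n) (Fin n) (A ⊗[ℂ] A)) : ℝ :=
  mnorm n (U.map G.tensorEmbedding)

variable (G) in
theorem isMatricialSeminorm_polNorm : IsMatricialSeminorm G.polNorm where
  add_le n U V := by
    have h : (U + V).map G.tensorEmbedding = U.map G.tensorEmbedding + V.map G.tensorEmbedding :=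
      Matrix.map_add _ (map_add _) _ _
    unfold polNorm
    rw [h]
    exact (isMatricialSeminorm_projective G.isMatricialSeminorm_fourier
      G.isMatricialSeminorm_fourier).add_le _ _ _
  smulMatrix_le m n a U b := by
    unfold polNorm
    rw [smulMatrix_map]
    exact (isMatricialSeminorm_projective G.isMatricialSeminorm_fourier
      G.isMatricialSeminorm_fourier).smulMatrix_le _ _ _ _ _
  directSum_le m n U V := by
    have h : (directSumMatrix U V).map G.tensorEmbedding =
        directSumMatrix (U.map G.tensorEmbedding) (V.map G.tensorEmbedding) := by
      simp only [directSumMatrix_eq_add, Matrix.map_add _ (map_add G.tensorEmbedding),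
        smulMatrix_map]
    unfold polNorm
    rw [h]
    exact (isMatricialSeminorm_projective G.isMatricialSeminorm_fourier
      G.isMatricialSeminorm_fourier).directSum_le _ _ _ _

theorem polNorm_le {ι κ : Type*} [Fintype ι] [DecidableEq ι] [Fintype κ] [DecidableEq κ] {n : ℕ}
    (a : Matrix (Fin n) (ι × κ) ℂ) (v : Matrix ι ι A) (w : Matrix κ κ A)
    (b : Matrix (ι × κ) (Fin n) ℂ) :
    G.polNorm n (smulMatrix a (v ⊗ₖₜ[ℂ] w) b) ≤
      ‖a‖ * matrixNormOn mnorm (v.map G.fourierEmbedding) *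
        matrixNormOn mnorm (w.map G.fourierEmbedding) * ‖b‖ := by
  have h : (v ⊗ₖₜ[ℂ] w).map G.tensorEmbedding =
      v.map G.fourierEmbedding ⊗ₖₜ[ℂ] w.map G.fourierEmbedding := by
    ext s t
    simp [tensorEmbedding]
  unfold polNorm
  rw [smulMatrix_map, h]
  exact projective_le G.isMatricialSeminorm_fourier G.isMatricialSeminorm_fourier _ _ _ _

/-- The projective norm of a matrix over `Pol(𝔾) ⊙ Pol(𝔾)` is already computed by decompositions
over `Pol(𝔾)`: truncating a decomposition over `A(𝔾)` does not increase the norms. -/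
theorem IsKac.exists_decomposition_of_polNorm_lt (hG : G.IsKac) {n : ℕ} {r : ℝ}
    {U : Matrix (Fin n) (Fin n) (A ⊗[ℂ] A)} (hU : G.polNorm n U < r) :
    ∃ (p q : ℕ) (v : Matrix (Fin p) (Fin p) A) (w : Matrix (Fin q) (Fin q) A)
      (a : Matrix (Fin n) (Fin p × Fin q) ℂ) (b : Matrix (Fin p × Fin q) (Fin n) ℂ),
      U = smulMatrix a (v ⊗ₖₜ[ℂ] w) b ∧ matrixNormOn mnorm (v.map G.fourierEmbedding) ≤ 1 ∧
      matrixNormOn mnorm (w.map G.fourierEmbedding) ≤ 1 ∧ ‖a‖ ≤ √r ∧ ‖b‖ ≤ √r := by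
  obtain ⟨p, q, v, w, a, b, h, hv, hw, ha, hb⟩ := isProjectivelyBounded_of_lt
    G.isMatricialSeminorm_fourier G.isMatricialSeminorm_fourier hU
  obtain ⟨F, hF⟩ : ∃ F : Finset G.Irr, ∀ i j,
      TensorProduct.map (truncate F) (truncate F) (G.tensorEmbedding (U i j)) = U i j := by
    have : ∀ᶠ F : Finset G.Irr in Filter.atTop, ∀ i j,
        TensorProduct.map (truncate F) (truncate F) (G.tensorEmbedding (U i j)) = U i j := by
      simp only [Filter.eventually_all]
      exact fun i j => hG.eventually_truncate_tensor _
    exact this.exists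
  rw [← G.isMatricialSeminorm_fourier.matrixNormOn_fin] at hv hw
  refine ⟨p, q, v.map (truncate F), w.map (truncate F), a, b, ?_,
    (hG.matrixNormOn_truncate_le F v).trans hv, (hG.matrixNormOn_truncate_le F w).trans hw, ha, hb⟩
  have h1 : U = (U.map G.tensorEmbedding).map
      (TensorProduct.map (truncate (G := G) F) (truncate (G := G) F)) := by
    ext i j
    exact (hF i j).symm
  have h2 : (v ⊗ₖₜ[ℂ] w).map (TensorProduct.map (truncate (G := G) F) (truncate (G := G) F)) =
      v.map (truncate F) ⊗ₖₜ[ℂ] w.map (truncate F) := by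
    ext s t
    simp
  rw [h1, h, smulMatrix_map, h2]

/-- A tensor product of two completely contractive maps is contractive for the projective norm. -/
theorem IsKac.polNorm_map_le (hG : G.IsKac) {T T' : A →ₗ[ℂ] A}
    (hT : ∀ (n : ℕ) (v : Matrix (Fin n) (Fin n) A), matrixNormOn mnorm ((v.map T).map
      G.fourierEmbedding) ≤ matrixNormOn mnorm (v.map G.fourierEmbedding))
    (hT' : ∀ (n : ℕ) (v : Matrix (Fin n) (Fin n) A), matrixNormOn mnorm ((v.map T').map
      G.fourierEmbedding) ≤ matrixNormOn mnorm (v.map G.fourierEmbedding))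
    {n : ℕ} (U : Matrix (Fin n) (Fin n) (A ⊗[ℂ] A)) :
    G.polNorm n (U.map (TensorProduct.map T T')) ≤ G.polNorm n U := by
  refine le_of_forall_pos_le_add fun ε hε => ?_
  have h0 := G.isMatricialSeminorm_polNorm.nonneg n U
  obtain ⟨p, q, v, w, a, b, h, hv, hw, ha, hb⟩ :=
    hG.exists_decomposition_of_polNorm_lt (show G.polNorm n U < G.polNorm n U + ε by linarith)
  have h1 : U.map (TensorProduct.map T T') = smulMatrix a (v.map T ⊗ₖₜ[ℂ] w.map T') b := by
    rw [h, smulMatrix_map]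
    congr 1
  rw [h1]
  refine (polNorm_le _ _ _ _).trans ?_
  have h2 := (hT p v).trans hv
  have h3 := (hT' q w).trans hw
  have h4 := G.isMatricialSeminorm_fourier.matrixNormOn_nonneg ((v.map T).map G.fourierEmbedding)
  have h5 := G.isMatricialSeminorm_fourier.matrixNormOn_nonneg ((w.map T').map G.fourierEmbedding)
  calc _ ≤ √(G.polNorm n U + ε) * 1 * 1 * √(G.polNorm n U + ε) := by gcongr
    _ = _ := by rw [mul_one, mul_one, Real.mul_self_sqrt (by positivity)]

end CompactQuantumGroup

/-! ### Averaging families of contractions -/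

section Averaging

/-- Independent random signs are orthonormal. -/
theorem sum_sign_mul_sign {K : Type*} [Fintype K] [DecidableEq K] (x y : K) :
    ∑ ε : K → ℤˣ, (((ε x : ℤˣ) : ℤ) : ℂ) * (((ε y : ℤˣ) : ℤ) : ℂ) =
      if x = y then (Fintype.card (K → ℤˣ) : ℂ) else 0 := by
  split_ifs with h
  · subst h
    have : ∀ ε : K → ℤˣ, (((ε x : ℤˣ) : ℤ) : ℂ) * (((ε x : ℤˣ) : ℤ) : ℂ) = 1 := fun ε => by
      rw [← Int.cast_mul, ← Units.val_mul, Int.units_mul_self]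
      simp
    simp [this]
  · -- Flipping the sign at `x` changes the sign of every summand.
    have h1 := Equiv.sum_comp (Equiv.mulLeft (Pi.mulSingle x (-1) : K → ℤˣ))
      fun ε => (((ε x : ℤˣ) : ℤ) : ℂ) * (((ε y : ℤˣ) : ℤ) : ℂ)
    have h2 : ∀ ε : K → ℤˣ, ((((Equiv.mulLeft (Pi.mulSingle x (-1) : K → ℤˣ) ε) x : ℤˣ) : ℤ) : ℂ) *
        ((((Equiv.mulLeft (Pi.mulSingle x (-1) : K → ℤˣ) ε) y : ℤˣ) : ℤ) : ℂ) =
        -((((ε x : ℤˣ) : ℤ) : ℂ) * (((ε y : ℤˣ) : ℤ) : ℂ)) := fun ε => by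
      simp [Pi.mulSingle_eq_of_ne (Ne.symm h)]
    simp only [h2, Finset.sum_neg_distrib] at h1
    exact self_eq_neg.1 h1.symm

/-- The normalized Fourier matrix is unitary, with entries of constant modulus. -/
theorem exists_unitary_flat {d : ℕ} (hd : 0 < d) :
    ∃ M : Matrix (Fin d) (Fin d) ℂ, M * Mᴴ = 1 ∧ ∀ i j, M i j * star (M i j) = (d : ℂ)⁻¹ := by
  set ζ := Complex.exp (2 * Real.pi * Complex.I / d) with hζdef
  have hζ : IsPrimitiveRoot ζ d := Complex.isPrimitiveRoot_exp d hd.ne'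
  have hnorm : ‖ζ‖ = 1 := hζ.norm'_eq_one hd.ne'
  have hz : ζ * star ζ = 1 := by
    rw [Complex.star_def, Complex.mul_conj, Complex.normSq_eq_norm_sq, hnorm]
    simp
  have hs : ((√(d : ℝ) : ℝ) : ℂ)⁻¹ * ((√(d : ℝ) : ℝ) : ℂ)⁻¹ = (d : ℂ)⁻¹ := by
    rw [← mul_inv, ← Complex.ofReal_mul, Real.mul_self_sqrt (Nat.cast_nonneg d)]
    simp
  have hzk : ∀ k : ℕ, ζ ^ k * star ζ ^ k = 1 := fun k => by rw [← mul_pow, hz, one_pow]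
  refine ⟨Matrix.of fun i j => ((√(d : ℝ) : ℝ) : ℂ)⁻¹ * ζ ^ ((i : ℕ) * (j : ℕ)), ?_, ?_⟩
  · ext i k
    have h1 : ∀ j : Fin d, (((√(d : ℝ) : ℝ) : ℂ)⁻¹ * ζ ^ ((i : ℕ) * (j : ℕ))) *
        star (((√(d : ℝ) : ℝ) : ℂ)⁻¹ * ζ ^ ((k : ℕ) * (j : ℕ))) =
        (d : ℂ)⁻¹ * (ζ ^ (i : ℕ) * star ζ ^ (k : ℕ)) ^ (j : ℕ) := fun j => by
      rw [star_mul', star_inv₀, Complex.star_def, Complex.conj_ofReal, ← Complex.star_def, star_pow,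
        mul_mul_mul_comm, hs, mul_pow, ← pow_mul, ← pow_mul]
    simp only [Matrix.mul_apply, Matrix.conjTranspose_apply, Matrix.of_apply, h1]
    rw [← Finset.mul_sum, Fin.sum_univ_eq_sum_range
      (fun j => (ζ ^ (i : ℕ) * star ζ ^ (k : ℕ)) ^ j), Matrix.one_apply]
    split_ifs with hik
    · subst hik
      simp only [hzk, one_pow, Finset.sum_const, Finset.card_range, nsmul_eq_mul, mul_one]
      exact inv_mul_cancel₀ (Nat.cast_ne_zero.2 hd.ne')
    · have hne : ζ ^ (i : ℕ) * star ζ ^ (k : ℕ) ≠ 1 := by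
        intro h
        have h2 : ζ ^ (i : ℕ) = ζ ^ (k : ℕ) := by
          calc ζ ^ (i : ℕ) = ζ ^ (i : ℕ) * star ζ ^ (k : ℕ) * ζ ^ (k : ℕ) := by
                rw [mul_assoc, mul_comm (star ζ ^ (k : ℕ)), hzk, mul_one]
            _ = _ := by rw [h, one_mul]
        exact hik (Fin.ext (hζ.pow_inj i.2 k.2 h2))
      have hpow : (ζ ^ (i : ℕ) * star ζ ^ (k : ℕ)) ^ d = 1 := by
        rw [mul_pow, ← pow_mul, ← pow_mul, mul_comm (i : ℕ), mul_comm (k : ℕ), pow_mul, pow_mul,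
          ← star_pow, hζ.pow_eq_one]
        simp
      rw [geom_sum_eq hne, hpow]
      simp
  · intro i j
    rw [Matrix.of_apply, star_mul', star_inv₀, Complex.star_def, Complex.conj_ofReal,
      ← Complex.star_def, star_pow, mul_mul_mul_comm, hs, hzk, mul_one]

end Averaging

namespace CompactQuantumGroup

variable {A : Type u} [Ring A] [StarRing A] [HopfAlgebra ℂ A] [StarModule ℂ A]
  {G : CompactQuantumGroup.{u, v} A}

/-- A finite family of contractions in `ℓ^∞(𝔾̂)` such that, on the blocks in `F`, averaging
`W_s ⊗ W̄_s` reproduces the Schur orthogonality relations. -/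
structure IsAveraging (F : Finset G.Irr) {S : Type v} [Fintype S] (W : S → G.LInfty) : Prop where
  norm_le : ∀ s, ‖W s‖ ≤ 1
  sum_self : ∀ α ∈ F, ∀ i j k l, (Fintype.card S : ℂ)⁻¹ * ∑ s, W s α i j * star (W s α k l) =
    if i = k then (if j = l then (G.dim α : ℂ)⁻¹ else 0) else 0
  sum_of_ne : ∀ α ∈ F, ∀ β, β ≠ α → ∀ i j k l,
    (Fintype.card S : ℂ)⁻¹ * ∑ s, W s α i j * star (W s β k l) = 0

/-- The family consists of the Fourier matrices of the blocks, with random signs attached to their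
rows and columns. -/
theorem exists_isAveraging (F : Finset G.Irr) :
    ∃ (S : Type v) (_ : Fintype S) (W : S → G.LInfty), IsAveraging F W := by
  classical
  have hM := fun α : G.Irr => exists_unitary_flat (G.isIrreducibleRep α).1
  choose M hM1 hM2 using hM
  let K := Σ α : F, Fin (G.dim α)
  let σ : (K → ℤˣ) → K → ℂ := fun ε x => ((ε x : ℤ) : ℂ)
  have hσ : ∀ ε x, ‖σ ε x‖ ≤ 1 := fun ε x => by
    rcases Int.units_eq_one_or (ε x) with h | h <;> simp [σ, h]
  have hσs : ∀ ε x, star (σ ε x) = σ ε x := fun ε x => by simp [σ]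
  let V : (K → ℤˣ) × (K → ℤˣ) → ∀ α, G.Block α := fun s α =>
    if h : α ∈ F then Matrix.diagonal (fun i => σ s.1 ⟨⟨α, h⟩, i⟩) * M α *
      Matrix.diagonal (fun j => σ s.2 ⟨⟨α, h⟩, j⟩) else 0
  have hV : ∀ s α, ‖V s α‖ ≤ 1 := by
    intro s α
    by_cases h : α ∈ F
    · simp only [V, h, dif_pos]
      have h1 : ∀ (ε : K → ℤˣ), ‖(Matrix.diagonal (fun i => σ ε ⟨⟨α, h⟩, i⟩) : G.Block α)‖ ≤ 1 :=
        fun ε => by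
          rw [Matrix.l2_opNorm_diagonal]
          exact (pi_norm_le_iff_of_nonneg zero_le_one).2 fun i => hσ _ _
      have h2 : ‖M α‖ ≤ 1 := Matrix.l2_opNorm_le_of_mul_conjTranspose_le zero_le_one (by
        rw [hM1, one_mul]; exact Matrix.l2_opNorm_one_le)
      refine (Matrix.l2_opNorm_mul_mul_le _ _ _).trans ?_
      calc _ ≤ (1 : ℝ) * 1 * 1 := by gcongr <;> exact h1 _
        _ = 1 := by norm_num
    · simp [V, h]
  have hVapply : ∀ s α (h : α ∈ F) i j,
      V s α i j = σ s.1 ⟨⟨α, h⟩, i⟩ * M α i j * σ s.2 ⟨⟨α, h⟩, j⟩ := by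
    intro s α h i j
    simp only [V, h, dif_pos, Matrix.mul_diagonal, Matrix.diagonal_mul]
  have hcard : (Fintype.card (K → ℤˣ) : ℂ) ≠ 0 := Nat.cast_ne_zero.2 Fintype.card_ne_zero
  -- The signs of rows and columns are independent, so the average factors.
  have hsum : ∀ α (hα : α ∈ F) β (hβ : β ∈ F) i j k l,
      (Fintype.card ((K → ℤˣ) × (K → ℤˣ)) : ℂ)⁻¹ * ∑ s, V s α i j * star (V s β k l) =
      (M α i j * star (M β k l)) * ((if (⟨⟨α, hα⟩, i⟩ : K) = ⟨⟨β, hβ⟩, k⟩ then 1 else 0) *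
        (if (⟨⟨α, hα⟩, j⟩ : K) = ⟨⟨β, hβ⟩, l⟩ then 1 else 0)) := by
    intro α hα β hβ i j k l
    have h1 : ∀ s, V s α i j * star (V s β k l) = (M α i j * star (M β k l)) *
        ((σ s.1 ⟨⟨α, hα⟩, i⟩ * σ s.1 ⟨⟨β, hβ⟩, k⟩) *
          (σ s.2 ⟨⟨α, hα⟩, j⟩ * σ s.2 ⟨⟨β, hβ⟩, l⟩)) := by
      intro s
      rw [hVapply s α hα, hVapply s β hβ, star_mul', star_mul', hσs, hσs]
      ring
    have h2 : ∀ f g : (K → ℤˣ) → ℂ, ∑ s : (K → ℤˣ) × (K → ℤˣ), f s.1 * g s.2 =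
        (∑ ε, f ε) * ∑ ε, g ε := fun f g => by rw [Fintype.sum_prod_type, Finset.sum_mul_sum]
    simp only [h1]
    rw [← Finset.mul_sum, h2 (fun ε => σ ε ⟨⟨α, hα⟩, i⟩ * σ ε ⟨⟨β, hβ⟩, k⟩)
      (fun ε => σ ε ⟨⟨α, hα⟩, j⟩ * σ ε ⟨⟨β, hβ⟩, l⟩), sum_sign_mul_sign, sum_sign_mul_sign,
      Fintype.card_prod, Nat.cast_mul]
    split_ifs
    · field_simp
    all_goals simp
  refine ⟨(K → ℤˣ) × (K → ℤˣ), inferInstance, fun s => ⟨V s, memℓp_infty ⟨1, ?_⟩⟩, ?_, ?_, ?_⟩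
  · rintro _ ⟨α, rfl⟩
    exact hV s α
  · exact fun s => lp.norm_le_of_forall_le zero_le_one fun α => hV s α
  · intro α hα i j k l
    rw [hsum α hα α hα]
    by_cases hik : i = k
    · by_cases hjl : j = l
      · subst hik hjl
        simpa using hM2 α i j
      · simp [hik, hjl]
    · simp [hik]
  · intro α hα β hne i j k l
    by_cases hβ : β ∈ F
    · rw [hsum α hα β hβ]
      have : (⟨⟨α, hα⟩, i⟩ : K) ≠ ⟨⟨β, hβ⟩, k⟩ := by
        intro h
        exact hne (congrArg (fun x : K => (x.1 : G.Irr)) h).symm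
      simp [this]
    · have h0 : ∀ s, V s β = 0 := fun s => by simp [V, hβ]
      change _ * ∑ s, V s α i j * star (V s β k l) = 0
      simp [h0]

end CompactQuantumGroup

/-! ### The averaging operators on `Pol(𝔾) ⊙ Pol(𝔾)` -/

namespace CompactQuantumGroup

variable {A : Type u} [Ring A] [StarRing A] [HopfAlgebra ℂ A] [StarModule ℂ A]
  {G : CompactQuantumGroup.{u, v} A}

/-- The slice map `x ↦ x₍₁₎ f(x₍₂₎)`. -/
noncomputable def rightSlice (f : A →ₗ[ℂ] ℂ) : A →ₗ[ℂ] A :=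
  (TensorProduct.rid ℂ A).toLinearMap ∘ₗ f.lTensor A ∘ₗ Coalgebra.comul

theorem rightSlice_apply_of_isUnitaryRep (f : A →ₗ[ℂ] ℂ) {n : ℕ} {w : Matrix (Fin n) (Fin n) A}
    (hw : IsUnitaryRep w) (i j : Fin n) : rightSlice f (w i j) = ∑ m, f (w m j) • w i m := by
  simp [rightSlice, hw.comul]

theorem IsKac.ev_rightSlice (hG : G.IsKac) (X W : G.LInfty) (x : A) :
    ev X (rightSlice (ev W) x) = ev (X * W) x := by
  have h : ev X ∘ₗ rightSlice (ev W) = ev (X * W) := by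
    refine G.linearMap_ext fun α i j => ?_
    rw [hG.ev_rep, LinearMap.comp_apply, rightSlice_apply_of_isUnitaryRep _ (G.isUnitaryRep α)]
    simp only [map_sum, map_smul, hG.ev_rep, smul_eq_mul]
    change _ = (X α * W α) i j
    rw [Matrix.mul_apply]
    exact Finset.sum_congr rfl fun m _ => mul_comm _ _
  exact LinearMap.congr_fun h x

/-- The functional conjugate to `x ↦ ⟨x, W⟩`. -/
noncomputable def conjEv (W : G.LInfty) : A →ₗ[ℂ] ℂ where
  toFun b := star (ev W (star b))
  map_add' a b := by simp
  map_smul' c b := by simp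

theorem conjEv_apply (W : G.LInfty) (b : A) : conjEv W b = star (ev W (star b)) := rfl

theorem IsKac.conjEv_star_rep (hG : G.IsKac) (W : G.LInfty) (α : G.Irr) (i j : Fin (G.dim α)) :
    conjEv W (star (G.rep α i j)) = star (W α i j) := by
  rw [conjEv_apply, star_star, hG.ev_rep]

/-- For `𝔾` of Kac type the conjugate functional is given by an element of `ℓ^∞(𝔾̂)` of no larger
norm, because the entrywise adjoint of a unitary representation is again one. -/
theorem IsKac.exists_ev_eq_conjEv (hG : G.IsKac) (W : G.LInfty) :
    ∃ Z : G.LInfty, ‖Z‖ ≤ ‖W‖ ∧ ev Z = conjEv W := by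
  have hb : ∀ β, ‖(Matrix.of fun k l => conjEv W (G.rep β k l) : G.Block β)‖ ≤ ‖W‖ := by
    intro β
    have h1 := (hG.norm_ev_unitary_le (hG.isUnitaryRep_conj β)
      (Matrix.of fun _ _ : Unit => W)).trans (linftyNorm_unit W)
    have h2 := Matrix.l2_opNorm_submatrix_le
      (Matrix.of fun s t => ev W (((G.rep β).map star) s.2 t.2) :
        Matrix (Unit × Fin (G.dim β)) (Unit × Fin (G.dim β)) ℂ)
      (f := fun a : Fin (G.dim β) => ((), a)) (g := fun b : Fin (G.dim β) => ((), b))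
      (fun i j h => congrArg (fun x => x.2) h) (fun i j h => congrArg (fun x => x.2) h)
    exact (Matrix.l2_opNorm_map_star_le _).trans (h2.trans h1)
  refine ⟨⟨fun β => Matrix.of fun k l => conjEv W (G.rep β k l), memℓp_infty ⟨‖W‖, ?_⟩⟩, ?_, ?_⟩
  · rintro _ ⟨β, rfl⟩
    exact hb β
  · exact lp.norm_le_of_forall_le (norm_nonneg _) hb
  · refine G.linearMap_ext fun β k l => ?_
    rw [hG.ev_rep]
    rfl

theorem linftyNorm_map_mul_right_le {κ : Type*} [Fintype κ] [DecidableEq κ]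
    (X : Matrix κ κ G.LInfty) (W : G.LInfty) :
    linftyNorm (X.map (· * W)) ≤ linftyNorm X * ‖W‖ := by
  have h0 := linftyNorm_nonneg X
  refine linftyNorm_le (by positivity) fun α => ?_
  have h : block (X.map (· * W)) α = block X α * ((1 : Matrix κ κ ℂ) ⊗ₖ (W α)) := by
    ext s t
    change (X s.1 t.1 α * W α) s.2 t.2 = _
    simp [block, Matrix.mul_apply, Fintype.sum_prod_type, Matrix.kroneckerMap_apply,
      Matrix.one_apply]
  rw [h]
  refine (Matrix.l2_opNorm_mul _ _).trans ?_
  have h1 : ‖(1 : Matrix κ κ ℂ) ⊗ₖ (W α)‖ ≤ ‖W‖ :=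
    (Matrix.l2_opNorm_kronecker_le _ _).trans
      ((mul_le_of_le_one_left (norm_nonneg _) Matrix.l2_opNorm_one_le).trans
        (lp.norm_apply_le_norm (by simp) W α))
  have := norm_block_le X α
  gcongr

theorem IsKac.matrixNormOn_rightSlice_le (hG : G.IsKac) {W : G.LInfty} (hW : ‖W‖ ≤ 1) {n : ℕ}
    (v : Matrix (Fin n) (Fin n) A) :
    matrixNormOn mnorm ((v.map (rightSlice (ev W))).map G.fourierEmbedding) ≤
      matrixNormOn mnorm (v.map G.fourierEmbedding) := by
  have h0 := G.isMatricialSeminorm_fourier.matrixNormOn_nonneg (v.map G.fourierEmbedding)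
  refine fourier_matrixNormOn_le h0 fun m X => ?_
  have h : pairMatrix ((v.map (rightSlice (ev W))).map G.fourierEmbedding) X =
      pairMatrix (v.map G.fourierEmbedding) (X.map (· * W)) := by
    ext s t
    exact hG.ev_rightSlice _ _ _
  rw [h]
  refine (norm_pairMatrix_le _ _).trans ?_
  gcongr
  exact (linftyNorm_map_mul_right_le X W).trans
    (mul_le_of_le_one_right (linftyNorm_nonneg X) hW)

/-- The average of the operators `x ⊗ y ↦ x₍₁₎ ⟨x₍₂₎, W_s⟩ ⊗ y₍₁₎ ⟨y₍₂₎, W̄_s⟩`. -/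
noncomputable def averageTwist {S : Type*} [Fintype S] (W : S → G.LInfty) :
    A ⊗[ℂ] A →ₗ[ℂ] A ⊗[ℂ] A :=
  (Fintype.card S : ℂ)⁻¹ •
    ∑ s, TensorProduct.map (rightSlice (ev (W s))) (rightSlice (conjEv (W s)))

theorem IsKac.polNorm_averageTwist_le (hG : G.IsKac) {S : Type*} [Fintype S] {W : S → G.LInfty}
    (hW : ∀ s, ‖W s‖ ≤ 1) {n : ℕ} (U : Matrix (Fin n) (Fin n) (A ⊗[ℂ] A)) :
    G.polNorm n (U.map (averageTwist W)) ≤ G.polNorm n U := by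
  have h : U.map (averageTwist W) = (Fintype.card S : ℂ)⁻¹ •
      ∑ s, U.map (TensorProduct.map (rightSlice (ev (W s))) (rightSlice (conjEv (W s)))) := by
    ext i j
    simp [averageTwist, Matrix.sum_apply]
  have hN := G.isMatricialSeminorm_polNorm
  have h0 := hN.nonneg n U
  rw [h, hN.smul_eq]
  have h1 : ∀ s, G.polNorm n (U.map (TensorProduct.map (rightSlice (ev (W s)))
      (rightSlice (conjEv (W s))))) ≤ G.polNorm n U := fun s => by
    obtain ⟨Z, hZ, hZ'⟩ := hG.exists_ev_eq_conjEv (W s)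
    rw [← hZ']
    exact hG.polNorm_map_le (fun n v => hG.matrixNormOn_rightSlice_le (hW s) v)
      (fun n v => hG.matrixNormOn_rightSlice_le (hZ.trans (hW s)) v) U
  calc _ ≤ ‖(Fintype.card S : ℂ)⁻¹‖ * ∑ s : S, G.polNorm n U := by
        gcongr
        exact (hN.sum_le _ _ _).trans (Finset.sum_le_sum fun s _ => h1 s)
    _ = ((Fintype.card S : ℝ)⁻¹ * Fintype.card S) * G.polNorm n U := by
        simp [mul_assoc]
    _ ≤ _ := mul_le_of_le_one_left h0 inv_mul_le_one

/-- To prove a linear statement on `Pol(𝔾) ⊙ Pol(𝔾)` it suffices to treat coefficients tensored with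
adjoints of coefficients, which are the tensors on which `Φ` is explicit. -/
theorem tensor_induction {p : A ⊗[ℂ] A → Prop}
    (hrep : ∀ α i j β k l, p (G.rep α i j ⊗ₜ star (G.rep β k l))) (h0 : p 0)
    (hadd : ∀ x y, p x → p y → p (x + y)) (hsmul : ∀ (c : ℂ) x, p x → p (c • x))
    (U : A ⊗[ℂ] A) : p U := by
  induction U using TensorProduct.induction_on with
  | zero => exact h0
  | add U V hU hV => exact hadd U V hU hV
  | tmul x y =>
    refine G.span_induction (p := fun x => p (x ⊗ₜ y)) (fun α i j => ?_) (by simpa using h0)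
      (fun x x' hx hx' => by rw [TensorProduct.add_tmul]; exact hadd _ _ hx hx')
      (fun c x hx => by rw [← TensorProduct.smul_tmul']; exact hsmul _ _ hx) x
    rw [← star_star y]
    exact G.span_induction (p := fun y => p (G.rep α i j ⊗ₜ star y)) (hrep α i j)
      (by simpa using h0)
      (fun x x' hx hx' => by rw [star_add, TensorProduct.tmul_add]; exact hadd _ _ hx hx')
      (fun c x hx => by rw [star_smul, TensorProduct.tmul_smul]; exact hsmul _ _ hx) (star y)

/-- `Φ(a ⊗ d) = a₍₁₎ h(d a₍₂₎)`. -/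
theorem IsKac.twistedConv_tmul (hG : G.IsKac) (a d : A) :
    G.twistedConv (a ⊗ₜ d) = rightSlice (G.haar ∘ₗ LinearMap.mulLeft ℂ d) a := by
  have h : ∀ d' : A, ∀ α i j, G.twistedConv (G.rep α i j ⊗ₜ star d') =
      rightSlice (G.haar ∘ₗ LinearMap.mulLeft ℂ (star d')) (G.rep α i j) := by
    intro d' α i j
    rw [rightSlice_apply_of_isUnitaryRep _ (G.isUnitaryRep α)]
    simp only [LinearMap.comp_apply, LinearMap.mulLeft_apply]
    refine G.span_induction (p := fun d' => G.twistedConv (G.rep α i j ⊗ₜ star d') =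
      ∑ m, G.haar (star d' * G.rep α m j) • G.rep α i m) (fun β k l => ?_) (by simp)
      (fun x y hx hy => ?_) (fun c x hx => ?_) d'
    · by_cases hαβ : α = β
      · subst hαβ
        rw [hG.twistedConv_rep]
        simp only [hG.haar_star_rep_mul, ite_smul, zero_smul, Finset.sum_ite_eq, Finset.mem_univ,
          if_true]
        simp only [eq_comm]
      · rw [hG.twistedConv_rep_of_ne hαβ]
        simp [G.haar_star_rep_mul_of_ne (Ne.symm hαβ)]
    · rw [star_add, TensorProduct.tmul_add, map_add, hx, hy]
      simp [add_mul, add_smul, Finset.sum_add_distrib]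
    · rw [star_smul, TensorProduct.tmul_smul, map_smul, hx]
      simp [Finset.smul_sum, smul_smul]
  have h2 : G.twistedConv ∘ₗ (TensorProduct.mk ℂ A A).flip d =
      rightSlice (G.haar ∘ₗ LinearMap.mulLeft ℂ d) := by
    refine G.linearMap_ext fun α i j => ?_
    have := h (star d) α i j
    rw [star_star] at this
    exact this
  exact LinearMap.congr_fun h2 a

/-- The product of `Pol(𝔾) ⊙ Pol(𝔾)^op`: `(a ⊗ b)(c ⊗ d) = ac ⊗ db`. -/
noncomputable def opMul : A ⊗[ℂ] A →ₗ[ℂ] A ⊗[ℂ] A →ₗ[ℂ] A ⊗[ℂ] A :=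
  TensorProduct.map₂ (LinearMap.mul ℂ A) (LinearMap.mul ℂ A).flip

theorem opMul_tmul (a b c d : A) : opMul (a ⊗ₜ[ℂ] b) (c ⊗ₜ d) = (a * c) ⊗ₜ (d * b) := by
  simp [opMul]

theorem IsKac.averageTwist_rep_tmul_star_rep (hG : G.IsKac) {S : Type*} [Fintype S]
    (W : S → G.LInfty) {α β : G.Irr} (i j : Fin (G.dim α)) (k l : Fin (G.dim β)) :
    averageTwist W (G.rep α i j ⊗ₜ star (G.rep β k l)) =
      ∑ m, ∑ n, ((Fintype.card S : ℂ)⁻¹ * ∑ s, W s α m j * star (W s β n l)) •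
        (G.rep α i m ⊗ₜ[ℂ] star (G.rep β k n)) := by
  have h1 : ∀ s, TensorProduct.map (rightSlice (ev (W s))) (rightSlice (conjEv (W s)))
      (G.rep α i j ⊗ₜ star (G.rep β k l)) =
      ∑ m, ∑ n, (W s α m j * star (W s β n l)) • (G.rep α i m ⊗ₜ[ℂ] star (G.rep β k n)) := by
    intro s
    have h2 := rightSlice_apply_of_isUnitaryRep (conjEv (W s)) (hG.isUnitaryRep_conj β) k l
    simp only [Matrix.map_apply, hG.conjEv_star_rep] at h2
    rw [TensorProduct.map_tmul, rightSlice_apply_of_isUnitaryRep _ (G.isUnitaryRep α), h2]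
    simp only [hG.ev_rep, TensorProduct.sum_tmul, TensorProduct.tmul_sum,
      TensorProduct.smul_tmul_smul]
    exact Finset.sum_comm
  simp only [averageTwist, LinearMap.smul_apply, LinearMap.sum_apply, h1]
  rw [Finset.sum_comm, Finset.smul_sum]
  refine Finset.sum_congr rfl fun m _ => ?_
  rw [Finset.sum_comm, Finset.smul_sum]
  refine Finset.sum_congr rfl fun n _ => ?_
  rw [← Finset.sum_smul, smul_smul]

theorem IsAveraging.averageTwist_rep (hG : G.IsKac) {F : Finset G.Irr} {S : Type v} [Fintype S]
    {W : S → G.LInfty} (hW : IsAveraging F W) {α : G.Irr} (hα : α ∈ F) (i j k l : Fin (G.dim α)) :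
    averageTwist W (G.rep α i j ⊗ₜ star (G.rep α k l)) =
      if j = l then (G.dim α : ℂ)⁻¹ • ∑ m, G.rep α i m ⊗ₜ star (G.rep α k m) else 0 := by
  rw [hG.averageTwist_rep_tmul_star_rep]
  simp_rw [hW.sum_self α hα, ite_smul, zero_smul]
  split_ifs <;> simp [Finset.smul_sum]

theorem IsAveraging.averageTwist_rep_of_ne (hG : G.IsKac) {F : Finset G.Irr} {S : Type v}
    [Fintype S] {W : S → G.LInfty} (hW : IsAveraging F W) {α β : G.Irr} (hα : α ∈ F) (hβ : β ≠ α)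
    (i j : Fin (G.dim α)) (k l : Fin (G.dim β)) :
    averageTwist W (G.rep α i j ⊗ₜ star (G.rep β k l)) = 0 := by
  rw [hG.averageTwist_rep_tmul_star_rep]
  simp_rw [hW.sum_of_ne α hα β hβ, zero_smul]
  simp

/-- In `∑ₘ u_{im} ⊗ u_{km}^*`, the second legs of the coproducts cancel by unitarity, so `Φ` is
multiplicative on it. -/
theorem IsKac.twistedConv_opMul_diagonal (hG : G.IsKac) (α : G.Irr) (i k : Fin (G.dim α))
    (V : A ⊗[ℂ] A) :
    G.twistedConv (opMul (∑ m, G.rep α i m ⊗ₜ star (G.rep α k m)) V) =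
      G.rep α i k * G.twistedConv V := by
  refine G.tensor_induction (p := fun V =>
    G.twistedConv (opMul (∑ m, G.rep α i m ⊗ₜ star (G.rep α k m)) V) =
      G.rep α i k * G.twistedConv V) (fun γ a b δ c d => ?_) (by simp)
      (fun x y hx hy => by rw [map_add, map_add, hx, hy, map_add, mul_add])
      (fun c x hx => by rw [map_smul, map_smul, hx, map_smul, mul_smul_comm]) V
  have hu : ∀ n, ∑ m, star (G.rep α k m) * G.rep α n m = if k = n then 1 else 0 := fun n => by
    have := congrFun (congrFun (hG.isUnitaryRep_conj α).mul_star k) n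
    simpa [Matrix.mul_apply, Matrix.one_apply] using this
  have hs : ∀ m, rightSlice
      (G.haar ∘ₗ LinearMap.mulLeft ℂ (star (G.rep δ c d) * star (G.rep α k m)))
      (G.rep α i m * G.rep γ a b) = ∑ n, ∑ e, G.haar (star (G.rep δ c d) *
        (star (G.rep α k m) * G.rep α n m) * G.rep γ e b) • (G.rep α i n * G.rep γ a e) := by
    intro m
    simp only [rightSlice, LinearMap.comp_apply, Bialgebra.comul_mul, (G.isUnitaryRep α).comul,
      (G.isUnitaryRep γ).comul, Finset.sum_mul_sum, Algebra.TensorProduct.tmul_mul_tmul, map_sum,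
      LinearMap.lTensor_tmul, LinearMap.mulLeft_apply, LinearEquiv.coe_coe, TensorProduct.rid_tmul,
      mul_assoc]
  rw [map_sum, LinearMap.sum_apply, map_sum, hG.twistedConv_tmul (G.rep γ a b),
    rightSlice_apply_of_isUnitaryRep _ (G.isUnitaryRep γ)]
  simp only [opMul_tmul, hG.twistedConv_tmul, hs]
  rw [Finset.sum_comm]
  have hn : ∀ n, ∑ m, ∑ e, G.haar (star (G.rep δ c d) *
      (star (G.rep α k m) * G.rep α n m) * G.rep γ e b) • (G.rep α i n * G.rep γ a e) =
      if k = n then ∑ e, G.haar (star (G.rep δ c d) * G.rep γ e b) • (G.rep α i n * G.rep γ a e)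
        else 0 := by
    intro n
    rw [Finset.sum_comm]
    simp only [← Finset.sum_smul, ← map_sum, ← Finset.sum_mul, ← Finset.mul_sum, hu]
    split_ifs <;> simp
  simp only [hn]
  simp [Finset.mul_sum]

open Filter in
/-- Averaging makes the twisted convolution multiplicative. -/
theorem IsKac.eventually_twistedConv_opMul (hG : G.IsKac) (U : A ⊗[ℂ] A) :
    ∀ᶠ F in atTop, ∀ (S : Type v) [Fintype S] (W : S → G.LInfty), IsAveraging F W →
      ∀ V, G.twistedConv (opMul (averageTwist W U) V) = G.twistedConv U * G.twistedConv V := by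
  classical
  refine G.tensor_induction (p := fun U => ∀ᶠ F in atTop, ∀ (S : Type v) [Fintype S]
    (W : S → G.LInfty), IsAveraging F W → ∀ V, G.twistedConv (opMul (averageTwist W U) V) =
      G.twistedConv U * G.twistedConv V) (fun α i j β k l => ?_) (by simp)
      (fun x y hx hy => ?_) (fun c x hx => ?_) U
  · filter_upwards [eventually_ge_atTop {α}] with F hF S _ W hW V
    have hα : α ∈ F := hF (Finset.mem_singleton_self α)
    by_cases hβ : β = α
    · subst hβ
      rw [hW.averageTwist_rep hG hα, hG.twistedConv_rep]
      split_ifs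
      · rw [map_smul, LinearMap.smul_apply, map_smul, hG.twistedConv_opMul_diagonal,
          smul_mul_assoc]
      · simp
    · rw [hW.averageTwist_rep_of_ne hG hα hβ, hG.twistedConv_rep_of_ne (Ne.symm hβ)]
      simp
  · filter_upwards [hx, hy] with F h1 h2 S _ W hW V
    rw [map_add, map_add, LinearMap.add_apply, map_add, h1 S W hW, h2 S W hW, map_add, add_mul]
  · filter_upwards [hx] with F h1 S _ W hW V
    rw [map_smul, map_smul, LinearMap.smul_apply, map_smul, h1 S W hW, map_smul, smul_mul_assoc]

open Filter in
/-- Averaging turns the twisted convolution into a combination of elementary tensors of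
functionals. -/
theorem IsKac.eventually_ev_twistedConv (hG : G.IsKac) (X : G.LInfty) (U : A ⊗[ℂ] A) :
    ∀ᶠ F in atTop, ∀ (S : Type v) [Fintype S] (W : S → G.LInfty), IsAveraging F W →
      ev X (G.twistedConv U) = (Fintype.card S : ℂ)⁻¹ *
        ∑ s, LinearMap.mul' ℂ ℂ (TensorProduct.map (ev (X * W s)) (conjEv (W s)) U) := by
  classical
  refine G.tensor_induction (p := fun U => ∀ᶠ F in atTop, ∀ (S : Type v) [Fintype S]
    (W : S → G.LInfty), IsAveraging F W → ev X (G.twistedConv U) = (Fintype.card S : ℂ)⁻¹ *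
        ∑ s, LinearMap.mul' ℂ ℂ (TensorProduct.map (ev (X * W s)) (conjEv (W s)) U))
      (fun α i j β k l => ?_) (by simp) (fun x y hx hy => ?_) (fun c x hx => ?_) U
  · filter_upwards [eventually_ge_atTop {α}] with F hF S _ W hW
    have hα : α ∈ F := hF (Finset.mem_singleton_self α)
    have h1 : ∀ s, LinearMap.mul' ℂ ℂ (TensorProduct.map (ev (X * W s)) (conjEv (W s))
        (G.rep α i j ⊗ₜ star (G.rep β k l))) =
        ∑ m, X α i m * (W s α m j * star (W s β k l)) := fun s => by
      rw [TensorProduct.map_tmul, LinearMap.mul'_apply, hG.ev_rep, hG.conjEv_star_rep]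
      change (X α * W s α) i j * _ = _
      rw [Matrix.mul_apply, Finset.sum_mul]
      exact Finset.sum_congr rfl fun m _ => mul_assoc _ _ _
    simp only [h1]
    have h2 : (Fintype.card S : ℂ)⁻¹ * ∑ s, ∑ m, X α i m * (W s α m j * star (W s β k l)) =
        ∑ m, X α i m * ((Fintype.card S : ℂ)⁻¹ * ∑ s, W s α m j * star (W s β k l)) := by
      rw [Finset.sum_comm, Finset.mul_sum]
      refine Finset.sum_congr rfl fun m _ => ?_
      rw [← Finset.mul_sum, mul_left_comm]
    rw [h2]
    by_cases hβ : β = α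
    · subst hβ
      simp only [hW.sum_self β hα, mul_ite, mul_zero]
      rw [hG.twistedConv_rep]
      split_ifs
      · rw [map_smul, hG.ev_rep]
        simp [mul_comm]
      · simp
    · simp only [hW.sum_of_ne α hα β hβ, hG.twistedConv_rep_of_ne (Ne.symm hβ)]
      simp
  · filter_upwards [hx, hy] with F h1 h2 S _ W hW
    simp only [map_add, h1 S W hW, h2 S W hW, Finset.sum_add_distrib, mul_add]
  · filter_upwards [hx] with F h1 S _ W hW
    simp only [map_smul, h1 S W hW, smul_eq_mul, ← Finset.mul_sum]
    ring

end CompactQuantumGroup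

/-! ### Norm estimates for the twisted convolution -/

/-- Amplified bilinear maps are bimodular over scalar matrices. -/
theorem smulMatrix_kronecker_bilinear {ι κ ι' κ' E F H : Type*} [Fintype ι] [Fintype ι']
    [AddCommGroup E] [Module ℂ E] [AddCommGroup F] [Module ℂ F] [AddCommGroup H] [Module ℂ H]
    (f : E →ₗ[ℂ] F →ₗ[ℂ] H) (a : Matrix κ ι ℂ) (x : Matrix ι ι E) (b : Matrix ι κ ℂ)
    (a' : Matrix κ' ι' ℂ) (y : Matrix ι' ι' F) (b' : Matrix ι' κ' ℂ) :
    smulMatrix (a ⊗ₖ a') (Matrix.of fun s t => f (x s.1 t.1) (y s.2 t.2)) (b ⊗ₖ b') =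
      Matrix.of fun s t => f (smulMatrix a x b s.1 t.1) (smulMatrix a' y b' s.2 t.2) := by
  ext s t
  simp only [smulMatrix, Matrix.of_apply, map_sum, LinearMap.sum_apply, map_smul,
    LinearMap.smul_apply, Matrix.kroneckerMap_apply, Fintype.sum_prod_type, Finset.smul_sum,
    smul_smul]
  have h : ∀ k k' l l', (a s.1 k * a' s.2 k' * (b l t.1 * b' l' t.2)) • f (x k l) (y k' l') =
      (a' s.2 k' * b' l' t.2 * (a s.1 k * b l t.1)) • f (x k l) (y k' l') := fun k k' l l' => by
    congr 1
    ring
  simp only [h]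
  calc _ = ∑ k, ∑ k', ∑ l', ∑ l, (a' s.2 k' * b' l' t.2 * (a s.1 k * b l t.1)) •
        f (x k l) (y k' l') :=
        Finset.sum_congr rfl fun k _ => Finset.sum_congr rfl fun k' _ => Finset.sum_comm
    _ = ∑ k', ∑ k, ∑ l', ∑ l, (a' s.2 k' * b' l' t.2 * (a s.1 k * b l t.1)) •
        f (x k l) (y k' l') := Finset.sum_comm
    _ = _ := Finset.sum_congr rfl fun k' _ => Finset.sum_comm

namespace CompactQuantumGroup

variable {A : Type u} [Ring A] [StarRing A] [HopfAlgebra ℂ A] [StarModule ℂ A]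
  {G : CompactQuantumGroup.{u, v} A}

theorem norm_ev_matrix_le {ι : Type*} [Fintype ι] [DecidableEq ι] (v : Matrix ι ι A)
    (Y : G.LInfty) : ‖(v.map (ev Y) : Matrix ι ι ℂ)‖ ≤
      matrixNormOn mnorm (v.map G.fourierEmbedding) * ‖Y‖ := by
  have h := norm_pairMatrix_le (v.map G.fourierEmbedding) (Matrix.of fun _ _ : Unit => Y)
  have h2 := Matrix.l2_opNorm_submatrix_le (pairMatrix (v.map G.fourierEmbedding)
    (Matrix.of fun _ _ : Unit => Y)) (f := fun a : ι => (a, ())) (g := fun b : ι => (b, ()))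
    (fun i j h => congrArg Prod.fst h) (fun i j h => congrArg Prod.fst h)
  have h3 := G.isMatricialSeminorm_fourier.matrixNormOn_nonneg (v.map G.fourierEmbedding)
  exact (h2.trans h).trans (mul_le_mul_of_nonneg_left (linftyNorm_unit Y) h3)

/-- Elementary tensors of functionals are bounded for the projective norm. -/
theorem IsKac.norm_map_ev_le (hG : G.IsKac) (Y Z : G.LInfty) (U : A ⊗[ℂ] A) :
    ‖LinearMap.mul' ℂ ℂ (TensorProduct.map (ev Y) (ev Z) U)‖ ≤
      ‖Y‖ * ‖Z‖ * G.polNorm 1 (Matrix.of fun _ _ => U) := by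
  set r := G.polNorm 1 (Matrix.of fun _ _ => U) with hr
  have hr0 : 0 ≤ r := G.isMatricialSeminorm_polNorm.nonneg _ _
  have key : ∀ ε > 0, ‖LinearMap.mul' ℂ ℂ (TensorProduct.map (ev Y) (ev Z) U)‖ ≤
      ‖Y‖ * ‖Z‖ * (r + ε) := by
    intro ε hε
    obtain ⟨p, q, v, w, a, b, h, hv, hw, ha, hb⟩ :=
      hG.exists_decomposition_of_polNorm_lt (show G.polNorm 1 (Matrix.of fun _ _ => U) < r + ε by
        rw [← hr]; linarith)
    let T := LinearMap.mul' ℂ ℂ ∘ₗ TensorProduct.map (ev (G := G) Y) (ev (G := G) Z)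
    have h1 : T U = (a * (v.map (ev Y) ⊗ₖ w.map (ev Z)) * b) 0 0 := by
      have h2 := congrFun (congrFun (congrArg (fun M => M.map T) h) 0) 0
      rw [smulMatrix_map] at h2
      refine h2.trans ?_
      simp only [smulMatrix, Matrix.of_apply, Matrix.mul_apply, Finset.sum_mul]
      rw [Finset.sum_comm]
      refine Finset.sum_congr rfl fun s _ => Finset.sum_congr rfl fun t _ => ?_
      simp [T]
      ring
    change ‖T U‖ ≤ _
    have h3 := (norm_ev_matrix_le v Y).trans (mul_le_of_le_one_left (norm_nonneg _) hv)
    have h4 := (norm_ev_matrix_le w Z).trans (mul_le_of_le_one_left (norm_nonneg _) hw)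
    have h5 := Matrix.l2_opNorm_kronecker_le (v.map (ev (G := G) Y)) (w.map (ev (G := G) Z))
    have h6 : ‖(a * (v.map (ev Y) ⊗ₖ w.map (ev Z)) * b) 0 0‖ ≤
        ‖a * (v.map (ev Y) ⊗ₖ w.map (ev Z)) * b‖ := by
      have h7 := Matrix.l2_opNorm_submatrix_le (a * (v.map (ev Y) ⊗ₖ w.map (ev Z)) * b)
        (f := fun _ : Unit => 0) (g := fun _ : Unit => 0) (Function.injective_of_subsingleton _)
        (Function.injective_of_subsingleton _)
      rwa [Matrix.l2_opNorm_unit] at h7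
    rw [h1]
    calc _ ≤ ‖a‖ * ‖v.map (ev Y) ⊗ₖ w.map (ev Z)‖ * ‖b‖ :=
          h6.trans (Matrix.l2_opNorm_mul_mul_le _ _ _)
      _ ≤ √(r + ε) * (‖Y‖ * ‖Z‖) * √(r + ε) := by
          have := h5.trans (mul_le_mul h3 h4 (norm_nonneg _) (norm_nonneg _))
          gcongr
      _ = ‖Y‖ * ‖Z‖ * (√(r + ε) * √(r + ε)) := by ring
      _ = _ := by rw [Real.mul_self_sqrt (by positivity)]
  have hlim : Filter.Tendsto (fun ε : ℝ => ‖Y‖ * ‖Z‖ * (r + ε)) (nhdsWithin 0 (Set.Ioi 0))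
      (nhds (‖Y‖ * ‖Z‖ * (r + 0))) :=
    ((continuous_const.mul (continuous_const.add continuous_id)).tendsto _).mono_left
      nhdsWithin_le_nhds
  rw [add_zero] at hlim
  exact ge_of_tendsto hlim (eventually_nhdsWithin_of_forall key)

theorem IsKac.norm_map_ev_conjEv_le (hG : G.IsKac) (X : G.LInfty) {W : G.LInfty}
    (U : A ⊗[ℂ] A) (hW : ‖W‖ ≤ 1) :
    ‖LinearMap.mul' ℂ ℂ (TensorProduct.map (ev (X * W)) (conjEv W) U)‖ ≤
      G.polNorm 1 (Matrix.of fun _ _ => U) * ‖X‖ := by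
  obtain ⟨Z, hZ, hZ'⟩ := hG.exists_ev_eq_conjEv W
  have hr0 := G.isMatricialSeminorm_polNorm.nonneg 1 (Matrix.of fun _ _ => U)
  have h1 : ‖X * W‖ ≤ ‖X‖ :=
    (norm_mul_le X W).trans (mul_le_of_le_one_right (norm_nonneg X) hW)
  have h2 : ‖X * W‖ * ‖Z‖ ≤ ‖X‖ :=
    (mul_le_of_le_one_right (norm_nonneg _) (hZ.trans hW)).trans h1
  rw [← hZ', mul_comm]
  exact (hG.norm_map_ev_le _ _ _).trans (mul_le_mul_of_nonneg_right h2 hr0)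

/-- The twisted convolution is contractive for the projective norm. -/
theorem IsKac.norm_twistedConv_le (hG : G.IsKac) (U : A ⊗[ℂ] A) :
    ‖G.fourierEmbedding (G.twistedConv U)‖ ≤ G.polNorm 1 (Matrix.of fun _ _ => U) := by
  have hr0 := G.isMatricialSeminorm_polNorm.nonneg 1 (Matrix.of fun _ _ => U)
  refine norm_le_of_norm_pair_le hr0 fun X => ?_
  obtain ⟨F, hF⟩ := (hG.eventually_ev_twistedConv X U).exists
  obtain ⟨S, hS, W, hW⟩ := exists_isAveraging F
  rw [← ev_apply, hF S W hW, norm_mul]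
  calc _ ≤ ‖(Fintype.card S : ℂ)⁻¹‖ *
          ∑ s : S, G.polNorm 1 (Matrix.of fun _ _ => U) * ‖X‖ := by
        gcongr
        exact norm_sum_le_of_le _ fun s _ => hG.norm_map_ev_conjEv_le X U (hW.norm_le s)
    _ = ((Fintype.card S : ℝ)⁻¹ * Fintype.card S) *
          (G.polNorm 1 (Matrix.of fun _ _ => U) * ‖X‖) := by simp [mul_assoc]
    _ ≤ _ := mul_le_of_le_one_left (mul_nonneg hr0 (norm_nonneg X)) inv_mul_le_one

theorem IsKac.norm_twistedConv_entry_le (hG : G.IsKac) {n : ℕ}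
    (U : Matrix (Fin n) (Fin n) (A ⊗[ℂ] A)) (i j : Fin n) :
    ‖G.fourierEmbedding (G.twistedConv (U i j))‖ ≤ G.polNorm n U :=
  (hG.norm_twistedConv_le _).trans (G.isMatricialSeminorm_polNorm.entry_le n U i j)

/-- The projective norm is submultiplicative for the product of `Pol(𝔾) ⊙ Pol(𝔾)^op`, jointly
completely: the matrix over `Fin p × Fin q` with entries `U_{ij} ∙ V_{kl}` has norm at most
`‖U‖ ‖V‖`. -/
theorem IsKac.polNorm_opMul_le (hG : G.IsKac) {n p q : ℕ}
    (a : Matrix (Fin n) (Fin p × Fin q) ℂ) (U : Matrix (Fin p) (Fin p) (A ⊗[ℂ] A))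
    (V : Matrix (Fin q) (Fin q) (A ⊗[ℂ] A)) (b : Matrix (Fin p × Fin q) (Fin n) ℂ) :
    G.polNorm n (smulMatrix a (Matrix.of fun s t => opMul (U s.1 t.1) (V s.2 t.2)) b) ≤
      ‖a‖ * G.polNorm p U * G.polNorm q V * ‖b‖ := by
  set N := G.polNorm n (smulMatrix a (Matrix.of fun s t => opMul (U s.1 t.1) (V s.2 t.2)) b)
    with hN
  set r := G.polNorm p U with hr
  set r' := G.polNorm q V with hr'
  have hr0 : 0 ≤ r := G.isMatricialSeminorm_polNorm.nonneg _ _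
  have hr0' : 0 ≤ r' := G.isMatricialSeminorm_polNorm.nonneg _ _
  have key : ∀ ε > 0, N ≤ ‖a‖ * (r + ε) * (r' + ε) * ‖b‖ := by
    intro ε hε
    obtain ⟨p₁, q₁, v₁, w₁, a₁, b₁, h₁, hv₁, hw₁, ha₁, hb₁⟩ :=
      hG.exists_decomposition_of_polNorm_lt (show G.polNorm p U < r + ε by rw [← hr]; linarith)
    obtain ⟨p₂, q₂, v₂, w₂, a₂, b₂, h₂, hv₂, hw₂, ha₂, hb₂⟩ :=
      hG.exists_decomposition_of_polNorm_lt (show G.polNorm q V < r' + ε by rw [← hr']; linarith)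
    let e : (Fin p₁ × Fin p₂) × (Fin q₂ × Fin q₁) ≃ (Fin p₁ × Fin q₁) × (Fin p₂ × Fin q₂) :=
      ((Equiv.refl _).prodCongr (Equiv.prodComm _ _)).trans (Equiv.prodProdProdComm _ _ _ _)
    have h : smulMatrix a (Matrix.of fun s t => opMul (U s.1 t.1) (V s.2 t.2)) b =
        smulMatrix (a * (a₁ ⊗ₖ a₂).submatrix id e) ((v₁ ⊗ₖ v₂) ⊗ₖₜ[ℂ] (w₂ ⊗ₖ w₁))
          ((b₁ ⊗ₖ b₂).submatrix e id * b) := by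
      rw [← smulMatrix_smulMatrix]
      congr 1
      rw [h₁, h₂]
      refine (smulMatrix_kronecker_bilinear (E := A ⊗[ℂ] A) (F := A ⊗[ℂ] A) (H := A ⊗[ℂ] A) opMul
        a₁ _ b₁ a₂ _ b₂).symm.trans ?_
      ext s t
      simp only [smulMatrix, Matrix.of_apply]
      rw [← Equiv.sum_comp e]
      refine Finset.sum_congr rfl fun k _ => ?_
      rw [← Equiv.sum_comp e]
      refine Finset.sum_congr rfl fun l _ => ?_
      have h3 : opMul (v₁ (e k).1.1 (e l).1.1 ⊗ₜ[ℂ] w₁ (e k).1.2 (e l).1.2)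
          (v₂ (e k).2.1 (e l).2.1 ⊗ₜ[ℂ] w₂ (e k).2.2 (e l).2.2) =
          ((v₁ ⊗ₖ v₂) ⊗ₖₜ[ℂ] (w₂ ⊗ₖ w₁)) k l := opMul_tmul _ _ _ _
      exact congrArg _ h3
    rw [hN, h]
    refine (polNorm_le _ _ _ _).trans ?_
    have h3 := (hG.matrixNormOn_kronecker_le v₁ v₂).trans (mul_le_one₀ hv₁
      (G.isMatricialSeminorm_fourier.matrixNormOn_nonneg _) hv₂)
    have h4 := (hG.matrixNormOn_kronecker_le w₂ w₁).trans (mul_le_one₀ hw₂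
      (G.isMatricialSeminorm_fourier.matrixNormOn_nonneg _) hw₁)
    have h5 : ‖a * (a₁ ⊗ₖ a₂).submatrix id e‖ ≤ ‖a‖ * (√(r + ε) * √(r' + ε)) := by
      refine (Matrix.l2_opNorm_mul _ _).trans ?_
      gcongr
      refine (Matrix.l2_opNorm_submatrix_le _ Function.injective_id e.injective).trans ?_
      exact (Matrix.l2_opNorm_kronecker_le _ _).trans (by gcongr)
    have h6 : ‖(b₁ ⊗ₖ b₂).submatrix e id * b‖ ≤ (√(r + ε) * √(r' + ε)) * ‖b‖ := by
      refine (Matrix.l2_opNorm_mul _ _).trans ?_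
      gcongr
      refine (Matrix.l2_opNorm_submatrix_le _ e.injective Function.injective_id).trans ?_
      exact (Matrix.l2_opNorm_kronecker_le _ _).trans (by gcongr)
    have h7 := G.isMatricialSeminorm_fourier.matrixNormOn_nonneg
      ((v₁ ⊗ₖ v₂).map G.fourierEmbedding)
    have h8 := G.isMatricialSeminorm_fourier.matrixNormOn_nonneg
      ((w₂ ⊗ₖ w₁).map G.fourierEmbedding)
    calc _ ≤ (‖a‖ * (√(r + ε) * √(r' + ε))) * 1 * 1 * ((√(r + ε) * √(r' + ε)) * ‖b‖) := by
          gcongr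
      _ = ‖a‖ * (√(r + ε) * √(r + ε)) * (√(r' + ε) * √(r' + ε)) * ‖b‖ := by ring
      _ = _ := by rw [Real.mul_self_sqrt (by positivity), Real.mul_self_sqrt (by positivity)]
  have hlim : Filter.Tendsto (fun ε : ℝ => ‖a‖ * (r + ε) * (r' + ε) * ‖b‖)
      (nhdsWithin 0 (Set.Ioi 0)) (nhds (‖a‖ * (r + 0) * (r' + 0) * ‖b‖)) := by
    refine Filter.Tendsto.mono_left (Continuous.tendsto ?_ _) nhdsWithin_le_nhds
    fun_prop
  rw [add_zero, add_zero] at hlim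
  exact ge_of_tendsto hlim (eventually_nhdsWithin_of_forall key)

end CompactQuantumGroup

/-! ### The operator space `A_Δ(𝔾)` -/

theorem IsMatricialSeminorm.norm_one_neg {E : Type*} [AddCommGroup E] [Module ℂ E]
    [MatrixNormed E] (hN : IsMatricialSeminorm (mnorm (E := E))) (x : E) :
    norm₁ (-x) = norm₁ x := by
  have h := hN.smul_eq 1 (-1) (Matrix.of fun _ _ => x)
  have h1 : ((-1 : ℂ) • Matrix.of fun _ _ => x : Matrix (Fin 1) (Fin 1) E) =
      Matrix.of fun _ _ => -x := by
    ext
    simp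
  rw [norm_neg, norm_one, one_mul, h1] at h
  exact h

/-- For a matricially normed space, completeness follows from the convergence of absolutely
convergent series. -/
theorem IsMatricialSeminorm.complete_of_summable {E : Type*} [AddCommGroup E] [Module ℂ E]
    [MatrixNormed E] (hN : IsMatricialSeminorm (mnorm (E := E)))
    (h0 : ∀ x : E, norm₁ x = 0 → x = 0)
    (hsum : ∀ u : ℕ → E, Summable (fun k => norm₁ (u k)) →
      ∃ a, Filter.Tendsto (fun n => norm₁ (∑ i ∈ Finset.range n, u i - a)) Filter.atTop (nhds 0))
    (x : ℕ → E) (hx : ∀ ε > 0, ∃ N, ∀ j ≥ N, ∀ k ≥ N, norm₁ (x j - x k) < ε) :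
    ∃ y : E, Filter.Tendsto (fun k => norm₁ (x k - y)) Filter.atTop (nhds 0) := by
  let p : AddGroupNorm E :=
    { toFun := norm₁
      map_zero' := hN.map_zero 1
      add_le' := fun x y => hN.add_le 1 _ _
      neg' := hN.norm_one_neg
      eq_zero_of_map_eq_zero' := h0 }
  let _ : NormedAddCommGroup E := p.toNormedAddCommGroup
  have : CompleteSpace E := by
    refine NormedAddCommGroup.completeSpace_of_summable_imp_tendsto fun u hu => ?_
    obtain ⟨a, ha⟩ := hsum u hu
    exact ⟨a, tendsto_iff_norm_sub_tendsto_zero.2 ha⟩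
  have hc : CauchySeq x := by
    refine Metric.cauchySeq_iff.2 fun ε hε => ?_
    obtain ⟨N, hN⟩ := hx ε hε
    exact ⟨N, fun j hj k hk => by rw [dist_eq_norm]; exact hN j hj k hk⟩
  obtain ⟨y, hy⟩ := cauchySeq_tendsto_of_complete hc
  exact ⟨y, tendsto_iff_norm_sub_tendsto_zero.1 hy⟩

/-- Replacing the first `N` terms of a series by their sum. -/
def regroup {E : Type*} [AddCommMonoid E] (N : ℕ) (f : ℕ → E) : ℕ → E
  | 0 => ∑ k ∈ Finset.range N, f k
  | k + 1 => f (k + N)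

theorem hasSum_regroup {E : Type*} [AddCommGroup E] [TopologicalSpace E] [IsTopologicalAddGroup E]
    {f : ℕ → E} {a : E} (h : HasSum f a) (N : ℕ) : HasSum (regroup N f) a := by
  refine (hasSum_nat_add_iff' 1).1 ?_
  simpa [regroup] using (hasSum_nat_add_iff' N).2 h

namespace CompactQuantumGroup

variable {A : Type u} [Ring A] [StarRing A] [HopfAlgebra ℂ A] [StarModule ℂ A]
  {G : CompactQuantumGroup.{u, v} A}

theorem Represents.summable_polNorm {n : ℕ} {U : ℕ → Matrix (Fin n) (Fin n) (A ⊗[ℂ] A)}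
    {ω : Matrix (Fin n) (Fin n) G.FourierAlgebra} (h : G.Represents U ω) :
    Summable fun k => G.polNorm n (U k) := h.1

/-- Series over any countable index set may be used to represent elements: enumerate the index set
and fill the gaps with zeros. -/
theorem exists_represents_of_countable {κ : Type*} [Countable κ] {n : ℕ}
    {U : κ → Matrix (Fin n) (Fin n) (A ⊗[ℂ] A)} {ω : Matrix (Fin n) (Fin n) G.FourierAlgebra}
    (hs : Summable fun k => G.polNorm n (U k))
    (h : ∀ i j, HasSum (fun k => G.fourierEmbedding (G.twistedConv (U k i j))) (ω i j)) :
    ∃ V : ℕ → Matrix (Fin n) (Fin n) (A ⊗[ℂ] A), G.Represents V ω ∧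
      ∑' k, G.polNorm n (V k) = ∑' k, G.polNorm n (U k) := by
  obtain ⟨e, he⟩ := exists_injective_nat κ
  have hx : ∀ k, k ∉ Set.range e → Function.extend e U 0 k = 0 := fun k hk => by
    rw [Function.extend_apply' _ _ _ (by simpa using hk)]
    rfl
  have h0 : ∀ k, k ∉ Set.range e → G.polNorm n (Function.extend e U 0 k) = 0 := fun k hk => by
    rw [hx k hk]
    exact G.isMatricialSeminorm_polNorm.map_zero n
  have hc : (fun k => G.polNorm n (Function.extend e U 0 k)) ∘ e = fun k => G.polNorm n (U k) := by
    ext k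
    simp [he.extend_apply]
  refine ⟨Function.extend e U 0, ⟨?_, fun i j => ?_⟩, ?_⟩
  · refine (he.summable_iff h0).1 ?_
    rw [hc]
    exact hs
  · refine (he.hasSum_iff fun k hk => ?_).1 ?_
    · rw [hx k hk]
      simp
    · convert h i j using 1
      ext1 k
      simp [he.extend_apply]
  · rw [← hc]
    refine (he.tsum_eq (f := fun k => G.polNorm n (Function.extend e U 0 k)) fun k hk => ?_).symm
    by_contra hk'
    exact hk (h0 k hk')

theorem ADelta_bddBelow {n : ℕ} (ω : Matrix (Fin n) (Fin n) G.ADelta) :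
    ∀ r ∈ {r : ℝ | ∃ U : ℕ → Matrix (Fin n) (Fin n) (A ⊗[ℂ] A),
      G.Represents U (ω.map Subtype.val) ∧ r = ∑' k, mnorm n ((U k).map G.tensorEmbedding)},
      0 ≤ r := by
  rintro r ⟨U, -, rfl⟩
  exact tsum_nonneg fun k => G.isMatricialSeminorm_polNorm.nonneg n (U k)

theorem ADelta_mnorm_le {κ : Type*} [Countable κ] {n : ℕ}
    {U : κ → Matrix (Fin n) (Fin n) (A ⊗[ℂ] A)} {ω : Matrix (Fin n) (Fin n) G.ADelta}
    (hs : Summable fun k => G.polNorm n (U k))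
    (h : ∀ i j, HasSum (fun k => G.fourierEmbedding (G.twistedConv (U k i j)))
      (ω i j : G.FourierAlgebra)) :
    mnorm n ω ≤ ∑' k, G.polNorm n (U k) := by
  obtain ⟨V, hV, hV'⟩ := exists_represents_of_countable (ω := ω.map Subtype.val) hs h
  rw [← hV']
  exact csInf_le ⟨0, ADelta_bddBelow ω⟩ ⟨V, hV, rfl⟩

theorem mem_ADelta {κ : Type*} [Countable κ] {U : κ → A ⊗[ℂ] A} {ω : G.FourierAlgebra}
    (hs : Summable fun k => G.polNorm 1 (Matrix.of fun _ _ => U k))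
    (h : HasSum (fun k => G.fourierEmbedding (G.twistedConv (U k))) ω) : ω ∈ G.ADelta := by
  obtain ⟨V, hV, -⟩ := exists_represents_of_countable
    (U := fun k => (Matrix.of fun _ _ => U k : Matrix (Fin 1) (Fin 1) (A ⊗[ℂ] A)))
    (ω := Matrix.of fun _ _ => ω) hs fun _ _ => h
  exact ⟨V, hV⟩

/-- A matrix over `A_Δ(𝔾)` is represented by a single series of matrices, assembled from series
representing its entries. -/
theorem exists_represents {n : ℕ} (ω : Matrix (Fin n) (Fin n) G.ADelta) :
    ∃ U : ℕ → Matrix (Fin n) (Fin n) (A ⊗[ℂ] A), G.Represents U (ω.map Subtype.val) := by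
  choose U hU using fun i j => (ω i j).2
  refine ⟨fun k => Matrix.of fun i j => U i j k 0 0, ?_, fun i j => (hU i j).2 0 0⟩
  refine Summable.of_nonneg_of_le (fun k => G.isMatricialSeminorm_polNorm.nonneg n _)
    (fun k => G.isMatricialSeminorm_polNorm.le_sum_entries n _)
    (summable_sum fun i _ => summable_sum fun j _ => ?_)
  convert (hU i j).summable_polNorm using 2 with k
  congr 1
  ext a b
  rw [Subsingleton.elim a 0, Subsingleton.elim b 0]
  rfl

theorem exists_represents_of_lt {n : ℕ} {ω : Matrix (Fin n) (Fin n) G.ADelta} {r : ℝ}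
    (h : mnorm n ω < r) : ∃ U : ℕ → Matrix (Fin n) (Fin n) (A ⊗[ℂ] A),
      G.Represents U (ω.map Subtype.val) ∧ ∑' k, G.polNorm n (U k) < r := by
  obtain ⟨U, hU⟩ := exists_represents ω
  obtain ⟨_, ⟨V, hV, rfl⟩, hlt⟩ := exists_lt_of_csInf_lt (by exact ⟨_, U, hU, rfl⟩) h
  exact ⟨V, hV, hlt⟩

theorem IsKac.norm_le_tsum (hG : G.IsKac) {n : ℕ} {U : ℕ → Matrix (Fin n) (Fin n) (A ⊗[ℂ] A)}
    {ω : Matrix (Fin n) (Fin n) G.FourierAlgebra} (h : G.Represents U ω) (i j : Fin n) :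
    ‖ω i j‖ ≤ ∑' k, G.polNorm n (U k) := by
  rw [← (h.2 i j).tsum_eq]
  exact tsum_of_norm_bounded h.summable_polNorm.hasSum fun k => hG.norm_twistedConv_entry_le _ _ _

/-- The inclusion of `A_Δ(𝔾)` in `A(𝔾)` is contractive, because `Φ` is. -/
theorem IsKac.norm_le_ADelta_mnorm (hG : G.IsKac) {n : ℕ} (ω : Matrix (Fin n) (Fin n) G.ADelta)
    (i j : Fin n) : ‖(ω i j : G.FourierAlgebra)‖ ≤ mnorm n ω := by
  obtain ⟨U, hU⟩ := exists_represents ω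
  refine le_csInf ⟨_, U, hU, rfl⟩ ?_
  rintro _ ⟨V, hV, rfl⟩
  exact hG.norm_le_tsum hV i j

variable (G) in
/-- The quotient norms are matricial seminorms. For the norm of a direct sum, long initial segments
of the two series are combined into one term each, so that only the tails contribute the sum of
the two norms instead of their maximum. -/
theorem isMatricialSeminorm_ADelta : IsMatricialSeminorm (mnorm (E := G.ADelta)) where
  add_le n ω φ := by
    refine le_of_forall_pos_le_add fun ε hε => ?_
    obtain ⟨U, hU, hU'⟩ := exists_represents_of_lt (show mnorm n ω < mnorm n ω + ε / 2 by linarith)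
    obtain ⟨V, hV, hV'⟩ := exists_represents_of_lt (show mnorm n φ < mnorm n φ + ε / 2 by linarith)
    have hN := G.isMatricialSeminorm_polNorm
    have hs := hU.summable_polNorm.add hV.summable_polNorm
    have hs' : Summable fun k => G.polNorm n (U k + V k) :=
      Summable.of_nonneg_of_le (fun k => hN.nonneg n _) (fun k => hN.add_le n _ _) hs
    refine (ADelta_mnorm_le hs' fun i j => ?_).trans ?_
    · simpa using (hU.2 i j).add (hV.2 i j)
    · have h1 := hs'.tsum_le_tsum (fun k => hN.add_le n (U k) (V k)) hs
      rw [hU.summable_polNorm.tsum_add hV.summable_polNorm] at h1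
      linarith
  smulMatrix_le m n a ω b := by
    have hN := G.isMatricialSeminorm_polNorm
    have key : ∀ ε > 0, mnorm m (smulMatrix a ω b) ≤ ‖a‖ * (mnorm n ω + ε) * ‖b‖ := by
      intro ε hε
      obtain ⟨U, hU, hU'⟩ := exists_represents_of_lt (show mnorm n ω < mnorm n ω + ε by linarith)
      have hs := (hU.summable_polNorm.mul_left ‖a‖).mul_right ‖b‖
      have hs' : Summable fun k => G.polNorm m (smulMatrix a (U k) b) :=
        Summable.of_nonneg_of_le (fun k => hN.nonneg m _) (fun k => hN.smulMatrix_le _ _ _ _ _) hs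
      refine (ADelta_mnorm_le hs' fun i j => ?_).trans ?_
      · simp only [smulMatrix, Matrix.of_apply, map_sum, map_smul, Submodule.coe_sum,
          Submodule.coe_smul]
        exact hasSum_sum fun k _ => hasSum_sum fun l _ => (hU.2 k l).const_smul _
      · have h1 := hs'.tsum_le_tsum (fun k => hN.smulMatrix_le m n a (U k) b) hs
        rw [tsum_mul_right, tsum_mul_left] at h1
        exact h1.trans (by gcongr)
    have hlim : Filter.Tendsto (fun ε : ℝ => ‖a‖ * (mnorm n ω + ε) * ‖b‖)
        (nhdsWithin 0 (Set.Ioi 0)) (nhds (‖a‖ * (mnorm n ω + 0) * ‖b‖)) := by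
      refine Filter.Tendsto.mono_left (Continuous.tendsto ?_ _) nhdsWithin_le_nhds
      fun_prop
    rw [add_zero] at hlim
    exact ge_of_tendsto hlim (eventually_nhdsWithin_of_forall key)
  directSum_le m n ω φ := by
    have hN := G.isMatricialSeminorm_polNorm
    refine le_of_forall_pos_le_add fun ε hε => ?_
    set r := max (mnorm m ω) (mnorm n φ) with hr
    obtain ⟨U, hU, hU'⟩ := exists_represents_of_lt
      (show mnorm m ω < r + ε / 3 by linarith [le_max_left (mnorm m ω) (mnorm n φ)])
    obtain ⟨V, hV, hV'⟩ := exists_represents_of_lt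
      (show mnorm n φ < r + ε / 3 by linarith [le_max_right (mnorm m ω) (mnorm n φ)])
    have h1 := (tendsto_sum_nat_add fun k => G.polNorm m (U k)).eventually_lt_const
      (show (0 : ℝ) < ε / 3 by positivity)
    have h2 := (tendsto_sum_nat_add fun k => G.polNorm n (V k)).eventually_lt_const
      (show (0 : ℝ) < ε / 3 by positivity)
    -- Three errors of `ε / 3`: the initial segments, and the two tails beyond `N`.
    obtain ⟨N, hN1, hN2⟩ := (h1.and h2).exists
    have hs1 := (summable_nat_add_iff N).2 hU.summable_polNorm
    have hs2 := (summable_nat_add_iff N).2 hV.summable_polNorm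
    let T : ℕ → Matrix (Fin (m + n)) (Fin (m + n)) (A ⊗[ℂ] A) := fun k =>
      directSumMatrix (U k) (V k)
    have hT : ∀ k, G.polNorm (m + n) (T (k + N)) ≤
        G.polNorm m (U (k + N)) + G.polNorm n (V (k + N)) := fun k =>
      (hN.directSum_le _ _ _ _).trans (max_le_add_of_nonneg (hN.nonneg _ _) (hN.nonneg _ _))
    have hsT : Summable fun k => G.polNorm (m + n) (regroup N T (k + 1)) :=
      Summable.of_nonneg_of_le (fun k => hN.nonneg _ _) hT (hs1.add hs2)
    have hs := (summable_nat_add_iff (f := fun k => G.polNorm (m + n) (regroup N T k)) 1).1 hsT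
    have h0 : G.polNorm (m + n) (regroup N T 0) ≤ r + ε / 3 := by
      have h3 : regroup N T 0 = directSumMatrix (∑ k ∈ Finset.range N, U k)
          (∑ k ∈ Finset.range N, V k) := by
        ext i j
        simp only [regroup, T, directSumMatrix, Matrix.sum_apply, Matrix.reindex_apply,
          Matrix.submatrix_apply]
        rcases finSumFinEquiv.symm i with i | i <;> rcases finSumFinEquiv.symm j with j | j <;>
          simp [Matrix.sum_apply]
      rw [h3]
      refine (hN.directSum_le _ _ _ _).trans (max_le ?_ ?_)
      · exact (hN.sum_le _ _ _).trans ((hU.summable_polNorm.sum_le_tsum _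
          fun k _ => hN.nonneg _ _).trans hU'.le)
      · exact (hN.sum_le _ _ _).trans ((hV.summable_polNorm.sum_le_tsum _
          fun k _ => hN.nonneg _ _).trans hV'.le)
    refine (ADelta_mnorm_le hs fun i j => ?_).trans ?_
    · have h4 : HasSum (fun k => G.fourierEmbedding (G.twistedConv (T k i j)))
          ((directSumMatrix ω φ i j : G.ADelta) : G.FourierAlgebra) := by
        simp only [T, directSumMatrix, Matrix.reindex_apply, Matrix.submatrix_apply]
        rcases finSumFinEquiv.symm i with i | i <;> rcases finSumFinEquiv.symm j with j | j
        · simpa using hU.2 i j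
        · simp [hasSum_zero]
        · simp [hasSum_zero]
        · simpa using hV.2 i j
      have h5 := hasSum_regroup h4 N
      convert h5 using 1
      ext1 k
      cases k <;> simp [regroup, Matrix.sum_apply]
    · rw [hs.tsum_eq_zero_add]
      have h6 : ∑' k, G.polNorm (m + n) (regroup N T (k + 1)) ≤ _ :=
        hsT.tsum_le_tsum hT (hs1.add hs2)
      rw [hs1.tsum_add hs2] at h6
      linarith

/-- An absolutely convergent series in `A_Δ(𝔾)` is represented by the double series assembled from
nearly optimal representations of its terms. -/
theorem IsKac.ADelta_complete (hG : G.IsKac) (x : ℕ → G.ADelta)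
    (hx : ∀ ε > 0, ∃ N, ∀ j ≥ N, ∀ k ≥ N, norm₁ (x j - x k) < ε) :
    ∃ y : G.ADelta, Filter.Tendsto (fun k => norm₁ (x k - y)) Filter.atTop (nhds 0) := by
  have hN := G.isMatricialSeminorm_polNorm
  refine G.isMatricialSeminorm_ADelta.complete_of_summable (fun y hy => ?_) (fun u hu => ?_) x hx
  · have h := hG.norm_le_ADelta_mnorm (Matrix.of fun _ _ : Fin 1 => y) 0 0
    exact Subtype.ext (norm_le_zero_iff.1 (h.trans hy.le))
  have hpos : ∀ k : ℕ, (0 : ℝ) < (1 / 2) ^ k := fun k => by positivity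
  choose U hU hU' using fun k => exists_represents_of_lt
    (show mnorm 1 (Matrix.of fun _ _ => u k : Matrix (Fin 1) (Fin 1) G.ADelta) <
      mnorm 1 (Matrix.of fun _ _ => u k : Matrix (Fin 1) (Fin 1) G.ADelta) + (1 / 2) ^ k by
        linarith [hpos k])
  have hbound : Summable fun k => norm₁ (u k) + (1 / 2 : ℝ) ^ k :=
    hu.add (summable_geometric_of_lt_one (by norm_num) (by norm_num))
  have : CompleteSpace G.FourierAlgebra :=
    inferInstanceAs (CompleteSpace (lp (fun α => G.Block α →L[ℂ] ℂ) 1))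
  have hsu : Summable fun k => (u k : G.FourierAlgebra) :=
    hu.of_norm_bounded fun k => hG.norm_le_ADelta_mnorm (Matrix.of fun _ _ => u k) 0 0
  -- The tails of the series of the `u k` are represented by double series.
  have hsn : ∀ n, Summable fun p : ℕ × ℕ => G.polNorm 1 (U (p.1 + n) p.2) := fun n => by
    refine (summable_prod_of_nonneg fun p => hN.nonneg 1 _).2
      ⟨fun k => (hU (k + n)).summable_polNorm, ?_⟩
    exact Summable.of_nonneg_of_le (fun k => tsum_nonneg fun _ => hN.nonneg 1 _)
      (fun k => (hU' (k + n)).le) ((summable_nat_add_iff n).2 hbound)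
  have hsum : ∀ n, HasSum
      (fun p : ℕ × ℕ => G.fourierEmbedding (G.twistedConv (U (p.1 + n) p.2 0 0)))
      (∑' k, (u (k + n) : G.FourierAlgebra)) := fun n => by
    have h1 : Summable fun p : ℕ × ℕ =>
        G.fourierEmbedding (G.twistedConv (U (p.1 + n) p.2 0 0)) :=
      (hsn n).of_norm_bounded fun p => hG.norm_twistedConv_entry_le _ 0 0
    have h2 := h1.hasSum.prod_fiberwise fun k => (hU (k + n)).2 0 0
    have h3 := h2.unique ((summable_nat_add_iff n).2 hsu).hasSum
    exact h3 ▸ h1.hasSum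
  have hmat : ∀ V : Matrix (Fin 1) (Fin 1) (A ⊗[ℂ] A), (Matrix.of fun _ _ => V 0 0) = V := by
    intro V
    ext a b
    rw [Subsingleton.elim a 0, Subsingleton.elim b 0]
    rfl
  have hmem : ∑' k, (u k : G.FourierAlgebra) ∈ G.ADelta := by
    have h1 := hsum 0
    have h2 := hsn 0
    simp only [add_zero] at h1 h2
    exact mem_ADelta (U := fun p : ℕ × ℕ => U p.1 p.2 0 0) (by simpa only [hmat] using h2) h1
  refine ⟨⟨_, hmem⟩, ?_⟩
  have hle : ∀ n, norm₁ (∑ i ∈ Finset.range n, u i - ⟨_, hmem⟩) ≤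
      ∑' k, (norm₁ (u (k + n)) + (1 / 2 : ℝ) ^ (k + n)) := by
    intro n
    rw [← neg_sub, G.isMatricialSeminorm_ADelta.norm_one_neg]
    have h1 : ((⟨_, hmem⟩ - ∑ i ∈ Finset.range n, u i : G.ADelta) : G.FourierAlgebra) =
        ∑' k, (u (k + n) : G.FourierAlgebra) := by
      rw [Submodule.coe_sub, Submodule.coe_sum, sub_eq_iff_eq_add]
      exact (add_comm _ _).trans (hsu.sum_add_tsum_nat_add n) |>.symm
    have h2 := ADelta_mnorm_le (ω := Matrix.of fun _ _ : Fin 1 =>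
      (⟨_, hmem⟩ - ∑ i ∈ Finset.range n, u i : G.ADelta)) (hsn n) fun i j => by
        rw [Subsingleton.elim i 0, Subsingleton.elim j 0, Matrix.of_apply, h1]
        exact hsum n
    refine h2.trans ?_
    have h3 : ∑' p : ℕ × ℕ, G.polNorm 1 (U (p.1 + n) p.2) =
        ∑' k, ∑' l, G.polNorm 1 (U (k + n) l) := (hsn n).tsum_prod
    rw [h3]
    exact Summable.tsum_le_tsum (fun k => (hU' (k + n)).le) (hsn n).prod
      ((summable_nat_add_iff n).2 hbound)
  exact squeeze_zero (fun n => G.isMatricialSeminorm_ADelta.nonneg 1 _) hle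
    (tendsto_sum_nat_add fun k => norm₁ (u k) + (1 / 2 : ℝ) ^ k)

theorem IsKac.isOperatorSpace_ADelta (hG : G.IsKac) : IsOperatorSpace G.ADelta where
  eq_zero_iff n ω := by
    refine ⟨fun h => ?_, fun h => h ▸ G.isMatricialSeminorm_ADelta.map_zero n⟩
    ext i j
    have := hG.norm_le_ADelta_mnorm ω i j
    rw [h] at this
    simpa using norm_le_zero_iff.1 this
  add_le := G.isMatricialSeminorm_ADelta.add_le
  smul_eq := G.isMatricialSeminorm_ADelta.smul_eq
  directSum_eq := G.isMatricialSeminorm_ADelta.directSum_eq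
  smulMatrix_le := G.isMatricialSeminorm_ADelta.smulMatrix_le
  complete := hG.ADelta_complete

end CompactQuantumGroup

/-! ### The multiplication of the Fourier algebra -/

namespace CompactQuantumGroup

variable {A : Type u} [Ring A] [StarRing A] [HopfAlgebra ℂ A] [StarModule ℂ A]
  {G : CompactQuantumGroup.{u, v} A}

theorem matrixNormOn_unit_le (x : A) :
    matrixNormOn mnorm ((Matrix.of fun _ _ : Unit => x).map G.fourierEmbedding) ≤
      ‖G.fourierEmbedding x‖ := by
  have h : ((Matrix.of fun _ _ : Unit => x).map G.fourierEmbedding).submatrix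
      (Equiv.ofUnique (Fin 1) Unit) (Equiv.ofUnique (Fin 1) Unit) =
      Matrix.of fun _ _ => G.fourierEmbedding x := rfl
  rw [G.isMatricialSeminorm_fourier.matrixNormOn_eq _ (Equiv.ofUnique (Fin 1) Unit), h]
  exact fourier_mnorm_one_le (G.fourierEmbedding x)

theorem norm_ev_le_matrixNormOn (x : A) (X : G.LInfty) :
    ‖ev X x‖ ≤ matrixNormOn mnorm ((Matrix.of fun _ _ : Unit × Unit => x).map
      G.fourierEmbedding) * ‖X‖ := by
  have h2 := Matrix.l2_opNorm_submatrix_le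
    ((Matrix.of fun _ _ : Unit × Unit => x).map (ev X))
    (f := fun _ : Unit => ((), ())) (g := fun _ : Unit => ((), ()))
    (Function.injective_of_subsingleton _) (Function.injective_of_subsingleton _)
  rw [Matrix.l2_opNorm_unit] at h2
  exact h2.trans (norm_ev_matrix_le _ X)

theorem IsKac.norm_fourierEmbedding_mul_le (hG : G.IsKac) (x y : A) :
    ‖G.fourierEmbedding (x * y)‖ ≤ ‖G.fourierEmbedding x‖ * ‖G.fourierEmbedding y‖ := by
  have h1 := hG.matrixNormOn_kronecker_le (Matrix.of fun _ _ : Unit => x)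
    (Matrix.of fun _ _ : Unit => y)
  have h0 : (Matrix.of fun _ _ : Unit => x) ⊗ₖ (Matrix.of fun _ _ : Unit => y) =
    Matrix.of fun _ _ => x * y := rfl
  rw [h0] at h1
  have h2 := h1.trans (mul_le_mul (matrixNormOn_unit_le x) (matrixNormOn_unit_le y)
    (G.isMatricialSeminorm_fourier.matrixNormOn_nonneg _) (norm_nonneg _))
  refine norm_le_of_norm_pair_le (mul_nonneg (norm_nonneg _) (norm_nonneg _)) fun X => ?_
  rw [← ev_apply]
  exact (norm_ev_le_matrixNormOn _ X).trans (mul_le_mul_of_nonneg_right h2 (norm_nonneg X))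

theorem IsKac.norm_truncate_singleton_le (hG : G.IsKac) (ω : G.FourierAlgebra) (α : G.Irr) :
    ‖G.fourierEmbedding (truncate {α} ω)‖ ≤ ‖G.component ω α‖ := by
  refine norm_le_of_norm_pair_le (norm_nonneg _) fun X => ?_
  rw [← ev_apply, hG.ev_truncate, pair, tsum_eq_single α fun β h => by simp [restrict, h]]
  have : restrict {α} X α = X α := by simp [restrict]
  rw [this]
  exact norm_component_apply_le ω X α

theorem truncate_singleton_rep_self (hG : G.IsKac) (α : G.Irr) (i j : Fin (G.dim α)) :
    truncate {α} (G.fourierEmbedding (G.rep α i j)) = G.rep α i j := by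
  rw [truncate_apply, Finset.sum_singleton]
  simp only [hG.component_rep, Matrix.single_apply, ite_smul, one_smul, zero_smul, ite_and]
  simp

theorem truncate_singleton_rep_of_ne {α β : G.Irr} (h : β ≠ α) (i j : Fin (G.dim α)) :
    truncate {β} (G.fourierEmbedding (G.rep α i j)) = 0 := by
  rw [truncate_apply, Finset.sum_singleton]
  simp [IsKac.component_rep_of_ne h]

/-- The term of index `(β, γ)` in the product of `ω` and `φ`. -/
noncomputable def mulTerm (ω φ : G.FourierAlgebra) (b : G.Irr × G.Irr) : G.FourierAlgebra :=
  G.fourierEmbedding (truncate {b.1} ω * truncate {b.2} φ)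

theorem IsKac.norm_mulTerm_le (hG : G.IsKac) (ω φ : G.FourierAlgebra) (b : G.Irr × G.Irr) :
    ‖mulTerm ω φ b‖ ≤ ‖G.component ω b.1‖ * ‖G.component φ b.2‖ :=
  (hG.norm_fourierEmbedding_mul_le _ _).trans
    (mul_le_mul (hG.norm_truncate_singleton_le ω b.1) (hG.norm_truncate_singleton_le φ b.2)
      (norm_nonneg _) (norm_nonneg _))

theorem hasSum_norm_component_mul (ω φ : G.FourierAlgebra) :
    HasSum (fun b : G.Irr × G.Irr => ‖G.component ω b.1‖ * ‖G.component φ b.2‖) (‖ω‖ * ‖φ‖) := by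
  rw [norm_eq_tsum ω, norm_eq_tsum φ]
  exact HasSum.mul (f := fun β => ‖G.component ω β‖) (g := fun γ => ‖G.component φ γ‖)
    (summable_norm_component ω).hasSum (summable_norm_component φ).hasSum
    ((summable_norm_component ω).mul_of_nonneg (summable_norm_component φ)
      (fun _ => norm_nonneg _) fun _ => norm_nonneg _)

instance : CompleteSpace G.FourierAlgebra :=
  inferInstanceAs (CompleteSpace (lp (fun α => G.Block α →L[ℂ] ℂ) 1))

theorem IsKac.summable_mulTerm (hG : G.IsKac) (ω φ : G.FourierAlgebra) :
    Summable (mulTerm ω φ) :=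
  (hasSum_norm_component_mul ω φ).summable.of_norm_bounded (hG.norm_mulTerm_le ω φ)

/-- The multiplication `Δ̂_*` of `A(𝔾)`, the continuous extension of that of `Pol(𝔾)`. -/
noncomputable def IsKac.fourierMul (hG : G.IsKac) :
    G.FourierAlgebra →L[ℂ] G.FourierAlgebra →L[ℂ] G.FourierAlgebra :=
  LinearMap.mkContinuous₂
    (LinearMap.mk₂ ℂ (fun ω φ => ∑' b, mulTerm ω φ b)
      (fun ω ω' φ => by
        rw [← (hG.summable_mulTerm ω φ).tsum_add (hG.summable_mulTerm ω' φ)]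
        exact tsum_congr fun b => by simp [mulTerm, add_mul])
      (fun c ω φ => by
        rw [← (hG.summable_mulTerm ω φ).tsum_const_smul c]
        exact tsum_congr fun b => by simp [mulTerm])
      (fun ω φ φ' => by
        rw [← (hG.summable_mulTerm ω φ).tsum_add (hG.summable_mulTerm ω φ')]
        exact tsum_congr fun b => by simp [mulTerm, mul_add])
      (fun c ω φ => by
        rw [← (hG.summable_mulTerm ω φ).tsum_const_smul c]
        exact tsum_congr fun b => by simp [mulTerm]))
    1 fun ω φ => by
      rw [one_mul]
      exact tsum_of_norm_bounded (hasSum_norm_component_mul ω φ) (hG.norm_mulTerm_le ω φ)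

theorem IsKac.hasSum_mulTerm (hG : G.IsKac) (ω φ : G.FourierAlgebra) :
    HasSum (mulTerm ω φ) (hG.fourierMul ω φ) := (hG.summable_mulTerm ω φ).hasSum

/-- The terms of the product are the terms of `(ω ⊗ φ)(Δ̂(X))`. -/
theorem pair_mulTerm (ω φ : G.FourierAlgebra) (X : G.LInfty) (b : G.Irr × G.Irr) :
    G.pair (mulTerm ω φ b) X = G.tensorPair ω φ b.1 b.2 (G.dualCoproduct X b.1 b.2) := by
  rw [mulTerm, ← ev_apply, truncate_apply, truncate_apply, Finset.sum_singleton,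
    Finset.sum_singleton, tensorPair]
  simp only [Finset.sum_mul_sum, smul_mul_smul_comm, map_sum, map_smul, smul_eq_mul,
    Fintype.sum_prod_type]
  rfl

theorem IsKac.hasSum_tensorPair (hG : G.IsKac) (ω φ : G.FourierAlgebra) (X : G.LInfty) :
    HasSum (fun b : G.Irr × G.Irr => G.tensorPair ω φ b.1 b.2 (G.dualCoproduct X b.1 b.2))
      (G.pair (hG.fourierMul ω φ) X) := by
  have h := (G.pairing.flip X).hasSum (hG.hasSum_mulTerm ω φ)
  exact (funext fun b => pair_mulTerm ω φ X b) ▸ h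

theorem IsKac.fourierMul_fourierEmbedding (hG : G.IsKac) (x y : A) :
    hG.fourierMul (G.fourierEmbedding x) (G.fourierEmbedding y) = G.fourierEmbedding (x * y) := by
  have h : hG.fourierMul.toLinearMap₁₂.compl₁₂ G.fourierEmbedding G.fourierEmbedding =
      (LinearMap.mul ℂ A).compr₂ G.fourierEmbedding := by
    refine G.linearMap_ext fun α i j => G.linearMap_ext fun β k l => ?_
    refine (hG.hasSum_mulTerm _ _).unique ?_
    have h1 : mulTerm (G.fourierEmbedding (G.rep α i j)) (G.fourierEmbedding (G.rep β k l)) (α, β) =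
        G.fourierEmbedding (G.rep α i j * G.rep β k l) := by
      rw [mulTerm, truncate_singleton_rep_self hG, truncate_singleton_rep_self hG]
    change HasSum _ (G.fourierEmbedding (G.rep α i j * G.rep β k l))
    rw [← h1]
    refine hasSum_single _ fun b hb => ?_
    by_cases hα : b.1 = α
    · have hβ : b.2 ≠ β := fun hβ => hb (Prod.ext hα hβ)
      rw [mulTerm, truncate_singleton_rep_of_ne hβ, mul_zero, map_zero]
    · rw [mulTerm, truncate_singleton_rep_of_ne hα, zero_mul, map_zero]
  exact LinearMap.congr_fun (LinearMap.congr_fun h x) y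

/-- `Pol(𝔾)` is dense in `A(𝔾)`. -/
theorem IsKac.denseRange_fourierEmbedding (hG : G.IsKac) : DenseRange G.fourierEmbedding := by
  intro ω
  have hs : Summable fun α => G.fourierEmbedding (truncate {α} ω) :=
    (summable_norm_component ω).of_norm_bounded (hG.norm_truncate_singleton_le ω)
  have h : ∑' α, G.fourierEmbedding (truncate {α} ω) = ω := by
    rw [← sub_eq_zero, ← norm_le_zero_iff]
    refine norm_le_of_norm_pair_le le_rfl fun X => ?_
    have h1 := (G.pairing.flip X).hasSum hs.hasSum
    have h2 : HasSum (fun α => G.pair (G.fourierEmbedding (truncate {α} ω)) X) (G.pair ω X) := by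
      have h3 : (fun α => G.pair (G.fourierEmbedding (truncate {α} ω)) X) =
          fun α => G.component ω α (X α) := by
        ext α
        rw [← ev_apply, hG.ev_truncate, pair, tsum_eq_single α fun β h => by simp [restrict, h]]
        simp [restrict]
      rw [h3]
      exact (summable_pair ω X).hasSum
    have h3 : G.pair (∑' α, G.fourierEmbedding (truncate {α} ω)) X = G.pair ω X := h1.unique h2
    have h4 : G.pair (∑' α, G.fourierEmbedding (truncate {α} ω) - ω) X = 0 := by
      rw [← pairing_apply, map_sub, sub_apply, pairing_apply, pairing_apply, h3, sub_self]
    rw [h4]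
    simp
  rw [← h]
  refine mem_closure_of_tendsto hs.hasSum (Filter.Eventually.of_forall fun s => ?_)
  exact ⟨∑ α ∈ s, truncate {α} ω, map_sum _ _ _⟩

theorem IsKac.fourierMul_assoc (hG : G.IsKac) (ω φ ψ : G.FourierAlgebra) :
    hG.fourierMul (hG.fourierMul ω φ) ψ = hG.fourierMul ω (hG.fourierMul φ ψ) := by
  have hd := hG.denseRange_fourierEmbedding
  refine hd.induction_on (p := fun ω => hG.fourierMul (hG.fourierMul ω φ) ψ =
    hG.fourierMul ω (hG.fourierMul φ ψ)) ω (isClosed_eq (by fun_prop) (by fun_prop)) fun x => ?_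
  refine hd.induction_on (p := fun φ => hG.fourierMul (hG.fourierMul (G.fourierEmbedding x) φ) ψ =
    hG.fourierMul (G.fourierEmbedding x) (hG.fourierMul φ ψ)) φ
    (isClosed_eq (by fun_prop) (by fun_prop)) fun y => ?_
  refine hd.induction_on (p := fun ψ => hG.fourierMul (hG.fourierMul (G.fourierEmbedding x)
    (G.fourierEmbedding y)) ψ = hG.fourierMul (G.fourierEmbedding x)
      (hG.fourierMul (G.fourierEmbedding y) ψ)) ψ
    (isClosed_eq (by fun_prop) (by fun_prop)) fun z => ?_
  simp only [hG.fourierMul_fourierEmbedding, mul_assoc]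

end CompactQuantumGroup

/-! ### The algebra `A_Δ(𝔾)` -/

namespace CompactQuantumGroup

variable {A : Type u} [Ring A] [StarRing A] [HopfAlgebra ℂ A] [StarModule ℂ A]
  {G : CompactQuantumGroup.{u, v} A}

/-- A finite matrix `U` can be replaced by one of no larger norm for which `Φ` is multiplicative. -/
theorem IsKac.exists_multiplicative_twist (hG : G.IsKac) {n : ℕ}
    (U : Matrix (Fin n) (Fin n) (A ⊗[ℂ] A)) :
    ∃ U' : Matrix (Fin n) (Fin n) (A ⊗[ℂ] A), G.polNorm n U' ≤ G.polNorm n U ∧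
      ∀ i j V, G.twistedConv (opMul (U' i j) V) = G.twistedConv (U i j) * G.twistedConv V := by
  have h : ∀ᶠ F in Filter.atTop, ∀ i j, ∀ (S : Type v) [Fintype S] (W : S → G.LInfty),
      IsAveraging F W → ∀ V, G.twistedConv (opMul (averageTwist W (U i j)) V) =
        G.twistedConv (U i j) * G.twistedConv V := by
    simp only [Filter.eventually_all]
    exact fun i j => hG.eventually_twistedConv_opMul _
  obtain ⟨F, hF⟩ := h.exists
  obtain ⟨S, hS, W, hW⟩ := exists_isAveraging F
  exact ⟨U.map (averageTwist W), hG.polNorm_averageTwist_le hW.norm_le U,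
    fun i j V => hF i j S W hW V⟩

theorem hasSum_bilinear {E : Type*} [NormedAddCommGroup E] [NormedSpace ℂ E]
    (B : E →L[ℂ] E →L[ℂ] E) {f g : ℕ → E} {x y : E} (hf : HasSum f x) (hg : HasSum g y)
    (hs : Summable fun k : ℕ × ℕ => B (f k.1) (g k.2)) :
    HasSum (fun k : ℕ × ℕ => B (f k.1) (g k.2)) (B x y) := by
  have h1 := hs.hasSum.prod_fiberwise fun k => (B (f k)).hasSum hg
  have h2 := (B.flip y).hasSum hf
  exact h1.unique h2 ▸ hs.hasSum

theorem hasSum_mul_mul_mul {x y : ℕ → ℝ} (hx : Summable x) (hy : Summable y) (hx0 : ∀ k, 0 ≤ x k)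
    (hy0 : ∀ k, 0 ≤ y k) (c d : ℝ) :
    HasSum (fun k : ℕ × ℕ => c * (x k.1 * y k.2) * d) (c * ((∑' k, x k) * ∑' k, y k) * d) :=
  ((hx.hasSum.mul hy.hasSum (hx.mul_of_nonneg hy hx0 hy0)).mul_left c).mul_right d

theorem IsKac.hasSum_fourierMul (hG : G.IsKac) {p q : ℕ}
    {U : ℕ → Matrix (Fin p) (Fin p) (A ⊗[ℂ] A)} {V : ℕ → Matrix (Fin q) (Fin q) (A ⊗[ℂ] A)}
    {v : Matrix (Fin p) (Fin p) G.FourierAlgebra} {w : Matrix (Fin q) (Fin q) G.FourierAlgebra}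
    (hU : G.Represents U v) (hV : G.Represents V w) (i j : Fin p) (k l : Fin q) :
    HasSum (fun m : ℕ × ℕ => G.fourierEmbedding
      (G.twistedConv (U m.1 i j) * G.twistedConv (V m.2 k l)))
      (hG.fourierMul (v i j) (w k l)) := by
  have hN := G.isMatricialSeminorm_polNorm
  have hs := (hasSum_mul_mul_mul hU.summable_polNorm hV.summable_polNorm (fun _ => hN.nonneg p _)
    (fun _ => hN.nonneg q _) 1 1).summable
  simp only [one_mul, mul_one] at hs
  have h := hasSum_bilinear hG.fourierMul (hU.2 i j) (hV.2 k l)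
  simp only [hG.fourierMul_fourierEmbedding] at h
  refine h (hs.of_norm_bounded fun m => ?_)
  exact (hG.norm_fourierEmbedding_mul_le _ _).trans
    (mul_le_mul (hG.norm_twistedConv_entry_le _ _ _) (hG.norm_twistedConv_entry_le _ _ _)
      (norm_nonneg _) (hN.nonneg p _))

/-- Products of series representing `v` and `w` represent the matrix with entries
`v_{ij} w_{kl}`. -/
theorem IsKac.exists_represents_mul (hG : G.IsKac) {n p q : ℕ}
    {U : ℕ → Matrix (Fin p) (Fin p) (A ⊗[ℂ] A)} {V : ℕ → Matrix (Fin q) (Fin q) (A ⊗[ℂ] A)}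
    {v : Matrix (Fin p) (Fin p) G.FourierAlgebra} {w : Matrix (Fin q) (Fin q) G.FourierAlgebra}
    (hU : G.Represents U v) (hV : G.Represents V w) (a : Matrix (Fin n) (Fin p × Fin q) ℂ)
    (b : Matrix (Fin p × Fin q) (Fin n) ℂ) :
    ∃ T : ℕ × ℕ → Matrix (Fin n) (Fin n) (A ⊗[ℂ] A),
      (Summable fun k => G.polNorm n (T k)) ∧
      ∑' k, G.polNorm n (T k) ≤
        ‖a‖ * ((∑' k, G.polNorm p (U k)) * ∑' k, G.polNorm q (V k)) * ‖b‖ ∧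
      ∀ i j, HasSum (fun k => G.fourierEmbedding (G.twistedConv (T k i j)))
        (smulMatrix a (Matrix.of fun s t => hG.fourierMul (v s.1 t.1) (w s.2 t.2)) b i j) := by
  have hN := G.isMatricialSeminorm_polNorm
  choose U' hU' hmul using fun k => hG.exists_multiplicative_twist (U k)
  have hsum := hasSum_mul_mul_mul hU.summable_polNorm hV.summable_polNorm
    (fun _ => hN.nonneg p _) (fun _ => hN.nonneg q _) ‖a‖ ‖b‖
  have hT : ∀ k : ℕ × ℕ, G.polNorm n
      (smulMatrix a (Matrix.of fun s t => opMul (U' k.1 s.1 t.1) (V k.2 s.2 t.2)) b) ≤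
      ‖a‖ * (G.polNorm p (U k.1) * G.polNorm q (V k.2)) * ‖b‖ := fun k => by
    refine (hG.polNorm_opMul_le a (U' k.1) (V k.2) b).trans ?_
    rw [mul_assoc ‖a‖]
    exact mul_le_mul_of_nonneg_right (mul_le_mul_of_nonneg_left
      (mul_le_mul_of_nonneg_right (hU' k.1) (hN.nonneg q _)) (norm_nonneg a)) (norm_nonneg b)
  have hs := hsum.summable.of_nonneg_of_le (fun k => hN.nonneg n _) hT
  refine ⟨_, hs, ?_, fun i j => ?_⟩
  · exact (hs.tsum_le_tsum hT hsum.summable).trans_eq hsum.tsum_eq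
  · simp only [smulMatrix, Matrix.of_apply, map_sum, map_smul, hmul]
    exact hasSum_sum fun s _ => hasSum_sum fun t _ =>
      (hG.hasSum_fourierMul hU hV s.1 t.1 s.2 t.2).const_smul _

theorem IsKac.fourierMul_mem_ADelta (hG : G.IsKac) (ω φ : G.ADelta) :
    hG.fourierMul ω φ ∈ G.ADelta := by
  obtain ⟨U, hU⟩ := ω.2
  obtain ⟨V, hV⟩ := φ.2
  obtain ⟨T, hs, -, hT⟩ := hG.exists_represents_mul hU hV
    (selectMatrix fun _ : Fin 1 => ((0, 0) : Fin 1 × Fin 1))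
    (selectMatrix fun _ : Fin 1 => ((0, 0) : Fin 1 × Fin 1))ᴴ
  obtain ⟨T', hT', -⟩ := exists_represents_of_countable hs hT
  rw [smulMatrix_select] at hT'
  exact ⟨T', hT'⟩

/-- The multiplication of `A_Δ(𝔾)`, the restriction of that of `A(𝔾)`. -/
noncomputable def IsKac.deltaMul (hG : G.IsKac) : G.ADelta →ₗ[ℂ] G.ADelta →ₗ[ℂ] G.ADelta :=
  LinearMap.mk₂ ℂ (fun ω φ => ⟨hG.fourierMul ω φ, hG.fourierMul_mem_ADelta ω φ⟩)
    (fun ω ω' φ => Subtype.ext (by simp)) (fun c ω φ => Subtype.ext (by simp))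
    (fun ω φ φ' => Subtype.ext (by simp)) (fun c ω φ => Subtype.ext (by simp))

theorem IsKac.coe_deltaMul (hG : G.IsKac) (ω φ : G.ADelta) :
    (hG.deltaMul ω φ : G.FourierAlgebra) = hG.fourierMul ω φ := rfl

/-- Joint complete contractivity of the multiplication. With `1 × 1` scalar matrices it contains the
submultiplicativity of the norm. -/
theorem IsKac.mnorm_deltaMul_le (hG : G.IsKac) {n p q : ℕ} (v : Matrix (Fin p) (Fin p) G.ADelta)
    (w : Matrix (Fin q) (Fin q) G.ADelta) (a : Matrix (Fin n) (Fin p × Fin q) ℂ)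
    (b : Matrix (Fin p × Fin q) (Fin n) ℂ) :
    mnorm n (smulMatrix a (Matrix.of fun s t => hG.deltaMul (v s.1 t.1) (w s.2 t.2)) b) ≤
      ‖a‖ * mnorm p v * mnorm q w * ‖b‖ := by
  have hN := G.isMatricialSeminorm_polNorm
  have key : ∀ ε > 0, mnorm n
      (smulMatrix a (Matrix.of fun s t => hG.deltaMul (v s.1 t.1) (w s.2 t.2)) b) ≤
      ‖a‖ * ((mnorm p v + ε) * (mnorm q w + ε)) * ‖b‖ := by
    intro ε hε
    obtain ⟨U, hU, hU'⟩ := exists_represents_of_lt (show mnorm p v < mnorm p v + ε by linarith)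
    obtain ⟨V, hV, hV'⟩ := exists_represents_of_lt (show mnorm q w < mnorm q w + ε by linarith)
    obtain ⟨T, hs, hle, hT⟩ := hG.exists_represents_mul hU hV a b
    refine (ADelta_mnorm_le hs fun i j => ?_).trans (hle.trans ?_)
    · simpa [smulMatrix, hG.coe_deltaMul] using hT i j
    · have hU0 : 0 ≤ ∑' k, G.polNorm p (U k) := tsum_nonneg fun k => hN.nonneg p (U k)
      have hV0 : 0 ≤ ∑' k, G.polNorm q (V k) := tsum_nonneg fun k => hN.nonneg q (V k)
      exact mul_le_mul_of_nonneg_right (mul_le_mul_of_nonneg_left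
        (mul_le_mul hU'.le hV'.le hV0 (hU0.trans hU'.le)) (norm_nonneg a)) (norm_nonneg b)
  have hlim : Filter.Tendsto (fun ε : ℝ => ‖a‖ * ((mnorm p v + ε) * (mnorm q w + ε)) * ‖b‖)
      (nhdsWithin 0 (Set.Ioi 0)) (nhds (‖a‖ * ((mnorm p v + 0) * (mnorm q w + 0)) * ‖b‖)) := by
    refine Filter.Tendsto.mono_left (Continuous.tendsto ?_ _) nhdsWithin_le_nhds
    fun_prop
  rw [add_zero, add_zero, ← mul_assoc ‖a‖] at hlim
  exact ge_of_tendsto hlim (eventually_nhdsWithin_of_forall key)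

theorem IsKac.isCompleteContraction_deltaMul (hG : G.IsKac) :
    IsCompleteContraction (TensorProduct.lift hG.deltaMul) := by
  intro n x
  obtain ⟨p, q, v, w, a, b, hx⟩ := exists_decomposition x
  refine le_csInf ⟨_, p, q, v, w, a, b, hx, rfl⟩ ?_
  rintro _ ⟨p, q, v, w, a, b, rfl, rfl⟩
  rw [smulMatrix_map]
  exact hG.mnorm_deltaMul_le v w a b

theorem IsKac.norm_deltaMul_le (hG : G.IsKac) (ω φ : G.ADelta) :
    norm₁ (hG.deltaMul ω φ) ≤ norm₁ ω * norm₁ φ := by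
  have h := hG.mnorm_deltaMul_le (Matrix.of fun _ _ => ω) (Matrix.of fun _ _ => φ)
    (selectMatrix fun _ : Fin 1 => ((0, 0) : Fin 1 × Fin 1))
    (selectMatrix fun _ : Fin 1 => ((0, 0) : Fin 1 × Fin 1))ᴴ
  rw [smulMatrix_select] at h
  have h1 : ‖selectMatrix fun _ : Fin 1 => ((0, 0) : Fin 1 × Fin 1)‖ ≤ 1 :=
    norm_selectMatrix_le (Function.injective_of_subsingleton _)
  have h2 : ‖(selectMatrix fun _ : Fin 1 => ((0, 0) : Fin 1 × Fin 1))ᴴ‖ ≤ 1 :=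
    norm_selectMatrix_conjTranspose_le (Function.injective_of_subsingleton _)
  have h3 : 0 ≤ norm₁ ω := G.isMatricialSeminorm_ADelta.nonneg 1 _
  have h4 : 0 ≤ norm₁ φ := G.isMatricialSeminorm_ADelta.nonneg 1 _
  refine h.trans ?_
  calc _ ≤ 1 * norm₁ ω * norm₁ φ * 1 := by
        gcongr
        · exact le_rfl
        · exact le_rfl
    _ = _ := by ring

theorem IsKac.fourierEmbedding_mem_ADelta (hG : G.IsKac) (x : A) :
    G.fourierEmbedding x ∈ G.ADelta := by
  refine G.span_induction (p := fun x => G.fourierEmbedding x ∈ G.ADelta) (fun α i k => ?_)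
    (by simp) (fun x y hx hy => by rw [map_add]; exact add_mem hx hy)
    (fun c x hx => by rw [map_smul]; exact Submodule.smul_mem _ c hx) x
  have h : G.twistedConv ((G.dim α : ℂ) • (G.rep α i i ⊗ₜ star (G.rep α k i))) = G.rep α i k := by
    rw [map_smul, hG.twistedConv_rep, if_pos rfl, smul_smul, mul_inv_cancel₀ (G.dim_ne_zero α),
      one_smul]
  refine mem_ADelta (U := fun _ : Unit => (G.dim α : ℂ) • (G.rep α i i ⊗ₜ star (G.rep α k i)))
    (hasSum_fintype _).summable ?_
  simp only [h]
  exact hasSum_unique _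

end CompactQuantumGroup

/-- For a compact quantum group `𝔾` of Kac type, `A_Δ(𝔾)` contains `Pol(𝔾)`, and it is a completely
contractive Banach algebra for the multiplication `Δ̂_*`, `⟨Δ̂_*(ω ⊗ φ), X⟩ = ⟨ω ⊗ φ, Δ̂(X)⟩`. -/
theorem mainTheorem3 {A : Type u} [Ring A] [StarRing A] [HopfAlgebra ℂ A] [StarModule ℂ A]
    (G : CompactQuantumGroup.{u, v} A) (hG : G.IsKac) :
    (∀ x : A, G.fourierEmbedding x ∈ G.ADelta) ∧
    ∃ mul : G.ADelta →ₗ[ℂ] G.ADelta →ₗ[ℂ] G.ADelta,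
      (∀ (ω φ : G.ADelta) (X : G.LInfty),
        HasSum (fun b : G.Irr × G.Irr =>
          G.tensorPair ω φ b.1 b.2 (G.dualCoproduct X b.1 b.2)) (G.pair (mul ω φ) X)) ∧
      IsCompletelyContractiveBanachAlgebra mul :=
  ⟨hG.fourierEmbedding_mem_ADelta, hG.deltaMul, fun ω φ X => hG.hasSum_tensorPair ω φ X,
    { isOperatorSpace := hG.isOperatorSpace_ADelta
      mul_assoc := fun ω φ ψ => Subtype.ext (hG.fourierMul_assoc ω φ ψ)
      norm_mul_le := hG.norm_deltaMul_le
      completelyContractive := hG.isCompleteContraction_deltaMul }⟩
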